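/- Setting. Let $d$ be a fixed dimension and $\sigma:\mathbb R\to\mathbb R$ a $C_\sigma$-Lipschitz activation function. Let $(\Omega,\mathcal G,\{\mathcal G_t\}_{t\ge0},\mathrm P)$ be a filtered probability space, $T\ge3$, and \[ Y_t=m(X_t)+\eta(X_t)v_t,\qquad t=1,\dots,T, \] with $Y_t\in\mathbb R$, $X_t\in\mathbb R^d$, measurable $m,\eta:\mathbb R^d\to\mathbb R$ and $C_\eta=\sup_{x\in[0,1]^d}|\eta(x)|<\infty$. Put $f_0=m\mathbf 1_{[0,1]^d}$ and $\|f\|_\infty=\sup_{x\in[0,1]^d}|f(x)|$. Assume, for $t=1,\dots,T$: (i) $v_t$ is $\mathcal G_t$-measurable, $\mathrm E[v_t\mid\mathcal G_{t-1}]=0$, $\mathrm E[v_t^2\mid\mathcal G_{t-1}]=1$, and $\mathrm E[\exp(v_t^2/K_t^2)\mid\mathcal G_{t-1}]\le2$ for a constant $K_t>0$; put $K=\max_{1\le t\le T}K_t$. (ii) $X=\{X_t\}_{t=1}^T$ is exponentially $\beta$-mixing: $\beta_X(t)\le C_{1,\beta}e^{-C_{2,\beta}t}$ for all $t\ge1$,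 with constants $C_{1,\beta}$ and $C_{2,\beta}>0$. Here $\beta_X(t)=\sup_{1\le k\le T-t}\beta(\sigma(X_1,\dots,X_k),\sigma(X_{k+t},\dots,X_T))$ and $\beta(\mathcal A,\mathcal B)=\frac12\sup\sum_{i,j}|\mathrm P(A_i\cap B_j)-\mathrm P(A_i)\mathrm P(B_j)|$, the supremum being over finite partitions $\{A_i\}\subset\mathcal A$ and $\{B_j\}\subset\mathcal B$ of $\Omega$. (iii) $X_t$ is $\mathcal G_{t-1}$-measurable. For $L,N,B,F,S>0$ let $\mathcal F=\mathcal F_\sigma(L,N,B,F,S)$ be the set of functions $f\mathbf 1_{[0,1]^d}$, where $f=A_{\ell+1}\circ\sigma\circ A_\ell\circ\cdots\circ\sigma\circ A_1:\mathbb R^d\to\mathbb R$ is a neural network ($A_i$ affine, $\sigma$ applied componentwise) with $1\le\ell\le L$ hidden layers, hidden widths at most $N$, all weights and shifts at most $B$ in absolute value and at most $S$ of them non-zero, and $\|f\|_\infty\le F$. An estimator $\hat f_T$ is a random function on $\mathbb R^d$ such that $(\omega,x)\mapsto\hat f_T(\omega,x)$ is measurable for the product of the $\sigma$-field generated by $\{Y_t,X_t\}_{t=1}^T$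 and the Borel $\sigma$-field. Put $Q_T(f)=\frac1T\sum_{t=1}^T(Y_t-f(X_t))^2$ and \[ R(\hat f_T,f_0)=\mathrm E\Big[\frac1T\sum_{t=1}^T(\hat f_T(X^*_t)-f_0(X^*_t))^2\Big],\qquad \Psi_T^{\mathcal F}(\hat f_T)=\mathrm E\Big[Q_T(\hat f_T)-\inf_{f\in\mathcal F}Q_T(f)\Big], \] where $X^*$ is a copy of $X$ independent of the data $\{Y_t,X_t\}_{t=1}^T$. Theorem. Suppose (i)--(iii) hold, $F\ge1$, $B\ge1$ and $\|f_0\|_\infty\le F$, and let $\hat f_T$ be any estimator taking values in $\mathcal F=\mathcal F_\sigma(L,N,B,F,S)$. Then for any $\rho>1$ there is a constant $C_\rho$, depending only on $(C_\eta,C_{1,\beta},C_{2,\beta},K,\rho)$ and on $d$, $C_\sigma$ and $|\sigma(0)|$, such that \[ R(\hat f_T,f_0)\le\rho\Big(\Psi_T^{\mathcal F}(\hat f_T)+\inf_{f\in\mathcal F}R(f,f_0)\Big)+C_\rho F^2\,\frac{S(L+1)\log\big((L+1)(N+1)BT\big)(\log T)}{T}. \] -/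

import Mathlib

open MeasureTheory ProbabilityTheory
open scoped NNReal

noncomputable section

/-! ### Deep neural networks -/

/-- The parameters of a neural network with output dimension `m`, as a function of the input
dimension: either the last affine map `A_{L+1}`, given by a weight matrix and a shift vector, or
a first affine map `A_1` into `ℝ^p` (followed by the activation) and the remaining network. -/
inductive DNN (m : ℕ) : ℕ → Type
  | output {n : ℕ} (W : Matrix (Fin m) (Fin n) ℝ) (b : Fin m → ℝ) : DNN m n
  | layer {n : ℕ} (p : ℕ) (W : Matrix (Fin p) (Fin n) ℝ) (b : Fin p → ℝ) (g : DNN m p) : DNN m n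

namespace DNN

variable {m : ℕ}

/-- The function `A_{L+1} ∘ σ_L ∘ A_L ∘ ⋯ ∘ σ_1 ∘ A_1` realised by the network, where `σ_ℓ` is
the componentwise application of `σ`. -/
def eval (σ : ℝ → ℝ) : {n : ℕ} → DNN m n → (Fin n → ℝ) → (Fin m → ℝ)
  | _, output W b, x => W.mulVec x + b
  | _, layer _ W b g, x => g.eval σ (fun i => σ ((W.mulVec x + b) i))

/-- The widths `p_1, …, p_L` of the hidden layers. -/
def hiddenWidths : {n : ℕ} → DNN m n → List ℕ
  | _, output _ _ => []
  | _, layer p _ _ g => p :: g.hiddenWidths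

/-- The number `L` of hidden layers. -/
def depth {n : ℕ} (g : DNN m n) : ℕ := g.hiddenWidths.length

/-- The columns of a matrix, concatenated. -/
def vec {p n : ℕ} (W : Matrix (Fin p) (Fin n) ℝ) : List ℝ :=
  (List.finRange n).flatMap fun j => List.ofFn fun i => W i j

/-- The parameter vector `θ = (vec W_1, b_1, …, vec W_{L+1}, b_{L+1})`. -/
def theta : {n : ℕ} → DNN m n → List ℝ
  | _, output W b => vec W ++ List.ofFn b
  | _, layer _ W b g => vec W ++ List.ofFn b ++ g.theta

/-- The number `|θ|_0` of non-zero parameters. -/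
def sparsity {n : ℕ} (g : DNN m n) : ℕ := (g.theta.filter fun a => a ≠ 0).length

end DNN

/-- The unit cube `[0,1]^d`. -/
def unitCube (d : ℕ) : Set (Fin d → ℝ) := Set.Icc 0 1

/-- The class `F_σ(L,N,B,F,S)` of functions `f 1_{[0,1]^d}`, where `f` is realised by a network
with input dimension `d`, output dimension `1`, between `1` and `L` hidden layers, widths between
`1` and `N`, parameters bounded by `B` in absolute value of which at most `S` are non-zero, and
`|f| ≤ F` on `[0,1]^d`. -/
def sparseDNNClass (d : ℕ) (σ : ℝ → ℝ) (L N B F S : ℝ) : Set ((Fin d → ℝ) → ℝ) :=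
  {h | ∃ g : DNN 1 d,
    1 ≤ g.depth ∧ (g.depth : ℝ) ≤ L ∧
    (∀ p ∈ g.hiddenWidths, 1 ≤ p ∧ (p : ℝ) ≤ N) ∧
    (∀ a ∈ g.theta, |a| ≤ B) ∧
    (g.sparsity : ℝ) ≤ S ∧
    (∀ x ∈ unitCube d, |g.eval σ x 0| ≤ F) ∧
    h = (unitCube d).indicator (fun x => g.eval σ x 0)}

/-! ### β-mixing -/

section

variable {Ω : Type*} [mΩ : MeasurableSpace Ω]

/-- `A` is a finite partition of `Ω` into members of the σ-field `𝒜`. -/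
def IsFinPartition (𝒜 : MeasurableSpace Ω) {n : ℕ} (A : Fin n → Set Ω) : Prop :=
  (∀ i, MeasurableSet[𝒜] (A i)) ∧ Pairwise (fun i j => Disjoint (A i) (A j)) ∧
    (⋃ i, A i) = Set.univ

/-- The β-mixing coefficient between two σ-fields: half the supremum over finite partitions
`(A_i) ⊂ 𝒜`, `(B_j) ⊂ ℬ` of `∑_{i,j} |P(A_i ∩ B_j) - P(A_i) P(B_j)|`. -/
def betaCoeff (P : Measure Ω) (𝒜 ℬ : MeasurableSpace Ω) : ℝ :=
  (1 / 2) * sSup {s : ℝ | ∃ (n k : ℕ) (A : Fin n → Set Ω) (B : Fin k → Set Ω),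
    IsFinPartition 𝒜 A ∧ IsFinPartition ℬ B ∧
    s = ∑ i, ∑ j, |P.real (A i ∩ B j) - P.real (A i) * P.real (B j)|}

/-- The σ-field generated by `X_a, …, X_b`. -/
@[reducible] def sigmaBetween {E : Type*} [MeasurableSpace E] (X : ℕ → Ω → E) (a b : ℕ) : MeasurableSpace Ω :=
  ⨆ s ∈ Set.Icc a b, MeasurableSpace.comap (X s) inferInstance

/-- The β-mixing coefficient `β_X(t) = sup_k β(σ(X_1,…,X_k), σ(X_{k+t},…,X_T))` of the possibly
nonstationary process `X_1, …, X_T`; the supremum is over `1 ≤ k ≤ T - t` (and is `0` if there is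
no such `k`). -/
def betaMixing {E : Type*} [MeasurableSpace E] (P : Measure Ω) (T : ℕ) (X : ℕ → Ω → E)
    (t : ℕ) : ℝ :=
  sSup {b : ℝ | ∃ k : ℕ, 1 ≤ k ∧ k + t ≤ T ∧
    b = betaCoeff P (sigmaBetween X 1 k) (sigmaBetween X (k + t) T)}

/-! ### The regression model -/

/-- The model `Y_t = m(X_t) + η(X_t) v_t`, `1 ≤ t ≤ T`, with `|η| ≤ Cη` on `[0,1]^d`, noise `v`
that is adapted, conditionally centred with conditional variance `1` and conditionally
sub-Gaussian with constants `κ_t ≤ K`, and regressors `X` that are predictable and exponentially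
β-mixing. (Conditional expectations of non-integrable functions are `0` in Mathlib, so that the
integrability implied by the sub-Gaussian bound is written out.) -/
structure RegressionModel {d : ℕ} (P : Measure Ω) (𝒢 : Filtration ℕ mΩ) (T : ℕ)
    (X : ℕ → Ω → (Fin d → ℝ)) (v Y : ℕ → Ω → ℝ) (m η : (Fin d → ℝ) → ℝ)
    (Cη C₁ C₂ K : ℝ) : Prop where
  measurable_m : Measurable m
  measurable_η : Measurable η
  η_le : ∀ x ∈ unitCube d, |η x| ≤ Cη
  model : ∀ t ∈ Set.Icc 1 T, ∀ ω, Y t ω = m (X t ω) + η (X t ω) * v t ω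
  adapted : ∀ t ∈ Set.Icc 1 T, Measurable[𝒢 t] (v t)
  centred : ∀ t ∈ Set.Icc 1 T, P[v t | 𝒢 (t - 1)] =ᵐ[P] 0
  subGaussian : ∃ κ : ℕ → ℝ, ∀ t ∈ Set.Icc 1 T, 0 < κ t ∧ κ t ≤ K ∧
    Integrable (fun ω => Real.exp ((v t ω) ^ 2 / (κ t) ^ 2)) P ∧
    P[fun ω => Real.exp ((v t ω) ^ 2 / (κ t) ^ 2) | 𝒢 (t - 1)] ≤ᵐ[P] fun _ => 2
  variance : ∀ t ∈ Set.Icc 1 T, P[fun ω => (v t ω) ^ 2 | 𝒢 (t - 1)] =ᵐ[P] fun _ => 1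
  mixing : ∀ t : ℕ, 1 ≤ t → betaMixing P T X t ≤ C₁ * Real.exp (-C₂ * t)
  predictable : ∀ t ∈ Set.Icc 1 T, Measurable[𝒢 (t - 1)] (X t)

/-- `(ω, x) ↦ fhat ω x` is measurable for the product of the σ-field generated by
`(Y_t, X_t)`, `1 ≤ t ≤ T`, and the Borel σ-field of `ℝ^d`. -/
def IsEstimator {d : ℕ} (T : ℕ) (X : ℕ → Ω → (Fin d → ℝ)) (Y : ℕ → Ω → ℝ)
    (fhat : Ω → (Fin d → ℝ) → ℝ) : Prop :=
  @Measurable (Ω × (Fin d → ℝ)) ℝ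
    (MeasurableSpace.prod (sigmaBetween (fun t ω => (Y t ω, X t ω)) 1 T) inferInstance)
    inferInstance (fun p => fhat p.1 p.2)

/-- The generalization error `R(fhat, f₀) = E[T⁻¹ ∑_t (fhat(X*_t) - f₀(X*_t))²]`. The independent
copy `X*` of `X`, independent of the data, is realised on the product space `(Ω × Ω, P ⊗ P)` by
`X*_t (ω, ω') = X_t ω'`, while `fhat` depends on `ω`. -/
def genError {d : ℕ} (P : Measure Ω) (T : ℕ) (X : ℕ → Ω → (Fin d → ℝ))
    (fhat : Ω → (Fin d → ℝ) → ℝ) (f₀ : (Fin d → ℝ) → ℝ) : ℝ :=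
  ∫ p : Ω × Ω, (1 / (T : ℝ)) *
    ∑ t ∈ Finset.Icc 1 T, (fhat p.1 (X t p.2) - f₀ (X t p.2)) ^ 2 ∂(P.prod P)

/-- The empirical risk `Q_T(f) = T⁻¹ ∑_t (Y_t - f(X_t))²` at the sample point `ω`. -/
def empRisk {d : ℕ} (T : ℕ) (X : ℕ → Ω → (Fin d → ℝ)) (Y : ℕ → Ω → ℝ)
    (f : (Fin d → ℝ) → ℝ) (ω : Ω) : ℝ :=
  (1 / (T : ℝ)) * ∑ t ∈ Finset.Icc 1 T, (Y t ω - f (X t ω)) ^ 2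

/-- The expected optimization gap `Ψ_T^𝓕(fhat) = E[Q_T(fhat) - inf_{f ∈ 𝓕} Q_T(f)]`. -/
def optGap {d : ℕ} (P : Measure Ω) (T : ℕ) (X : ℕ → Ω → (Fin d → ℝ)) (Y : ℕ → Ω → ℝ)
    (𝓕 : Set ((Fin d → ℝ) → ℝ)) (fhat : Ω → (Fin d → ℝ) → ℝ) : ℝ :=
  ∫ ω, (empRisk T X Y (fhat ω) ω - ⨅ f : 𝓕, empRisk T X Y f ω) ∂P

end

end

/-!
Write `Q_T(f̂) - Q_T(f)` through the squares `∑ (f̂ - f₀)(X_t)²` and the martingale transforms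
`∑ η (f̂ - f₀)(X_t) v_t`. This bounds the in-sample squared error of `f̂` by the optimization gap,
the risk of `f` and the noise term of `f̂`. Over a finite net of size `n` the noise term is at most
`log (1 + n) / λ` plus a small multiple of the squared error itself, because the exponential of
a conditionally sub-Gaussian transform minus its compensator is a supermartingale; the multiple is
absorbed.

To pass from the sample to an independent copy, cut `1, …, T` into blocks of length about `log T`.
Blocks of the same parity are nearly independent by β-mixing, so that a Laplace-transform bound,
applied one block at a time and once more uniformly over the net, compares `∑ (f̂ - f₀)(X_t)²` with
its expectation, again up to a small multiple of the latter. The factor `ρ > 1` pays for the two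
small multiples.

Finally, rounding the non-zero parameters of a sparse network to a grid gives a `1 / T`-net of
logarithmic size at most a constant times `S (L + 1) log ((L + 1)(N + 1) B T)`.
-/

/-! ### Covering numbers of sparse networks -/

section Counting

theorem exists_finset_lists_of_length_le {α : Type*} (K : Finset α) (n : ℕ) :
    ∃ 𝓛 : Finset (List α), 𝓛.card ≤ (K.card + 1) ^ n ∧
      ∀ l : List α, l.length ≤ n → (∀ a ∈ l, a ∈ K) → l ∈ 𝓛 := by
  classical
  induction n with
  | zero => exact ⟨{[]}, by simp, fun l hl _ => by simpa using hl⟩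
  | succ n ih =>
    obtain ⟨𝓛, hcard, hmem⟩ := ih
    refine ⟨insert [] (Finset.image₂ List.cons K 𝓛), ?_, fun l hl hK => ?_⟩
    · have hone : 1 ≤ (K.card + 1) ^ n := Nat.one_le_pow _ _ (Nat.succ_pos _)
      calc _ ≤ (Finset.image₂ List.cons K 𝓛).card + 1 := Finset.card_insert_le _ _
        _ ≤ K.card * (K.card + 1) ^ n + (K.card + 1) ^ n := by
          gcongr
          exact Finset.card_image₂_le _ _ _ |>.trans (by gcongr)
        _ = (K.card + 1) ^ (n + 1) := by ring
    · cases l with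
      | nil => exact Finset.mem_insert_self _ _
      | cons a l =>
        simp only [List.length_cons, List.mem_cons, forall_eq_or_imp] at hl hK
        exact Finset.mem_insert_of_mem
          (Finset.mem_image₂_of_mem hK.1 (hmem l (by omega) hK.2))

theorem exists_finset_representatives {α β : Type*} (P : Set α) (code : α → β)
    (K : Finset β) (hK : ∀ a ∈ P, code a ∈ K) :
    ∃ R : Finset α, ↑R ⊆ P ∧ R.card ≤ K.card ∧ ∀ a ∈ P, ∃ a' ∈ R, code a' = code a := by
  classical
  obtain ⟨R, hRP, hinj, himage⟩ := Finset.exists_subset_injOn_image_eq_of_surjOn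
    (f := code) P (K.filter (· ∈ code '' P)) (fun b hb => (Finset.mem_filter.1 hb).2)
  refine ⟨R, hRP, ?_, fun a ha => ?_⟩
  · rw [← Finset.card_image_of_injOn hinj, himage]
    exact Finset.card_filter_le _ _
  · have : code a ∈ R.image code := himage ▸ Finset.mem_filter.2 ⟨hK a ha, a, ha, rfl⟩
    exact Finset.mem_image.1 this

theorem eq_of_filter_zipIdx_eq {β : Type*} [Zero β] [DecidableEq β] {l l' : List β}
    (hlen : l.length = l'.length)
    (h : l.zipIdx.filter (fun q => q.1 ≠ 0) = l'.zipIdx.filter (fun q => q.1 ≠ 0)) : l = l' := by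
  have hentry : ∀ (i : ℕ) (a : β), a ≠ 0 → (l[i]? = some a ↔ l'[i]? = some a) := fun i a ha => by
    have := congrArg (fun L : List (β × ℕ) => (a, i) ∈ L) h
    simpa [List.mem_filter, List.mk_mem_zipIdx_iff_getElem?, ha] using this
  refine List.ext_getElem hlen fun i hi hi' => ?_
  have hi₁ := List.getElem?_eq_getElem hi
  have hi₂ := List.getElem?_eq_getElem hi'
  by_cases h0 : l[i] = 0
  · by_contra hne
    have := (hentry i l'[i] fun h' => hne (h0.trans h'.symm)).2 hi₂
    rw [hi₁] at this
    exact hne (Option.some.inj this)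
  · have := (hentry i l[i] h0).1 hi₁
    rw [hi₂] at this
    exact (Option.some.inj this).symm

end Counting

namespace DNN

variable {m n p : ℕ}

/-- The network with `r` applied to every weight and every shift. -/
def mapParams (r : ℝ → ℝ) : {n : ℕ} → DNN m n → DNN m n
  | _, output W b => output (W.map r) (fun i => r (b i))
  | _, layer p W b g => layer p (W.map r) (fun i => r (b i)) (g.mapParams r)

theorem hiddenWidths_mapParams (r : ℝ → ℝ) (g : DNN m n) :
    (g.mapParams r).hiddenWidths = g.hiddenWidths := by
  induction g with
  | output W b => rfl
  | layer p W b g ih => simp [mapParams, hiddenWidths, ih]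

theorem vec_map (r : ℝ → ℝ) (W : Matrix (Fin p) (Fin n) ℝ) :
    vec (W.map r) = (vec W).map r := by
  simp [vec, List.map_flatMap, Function.comp_def]

theorem theta_mapParams (r : ℝ → ℝ) (g : DNN m n) : (g.mapParams r).theta = g.theta.map r := by
  induction g with
  | output W b => simp [mapParams, theta, vec_map, Function.comp_def]
  | layer p W b g ih => simp [mapParams, theta, vec_map, Function.comp_def, ih]

theorem mem_vec (W : Matrix (Fin p) (Fin n) ℝ) (i : Fin p) (j : Fin n) : W i j ∈ vec W :=
  List.mem_flatMap.2 ⟨j, List.mem_finRange j, List.mem_ofFn.2 ⟨i, rfl⟩⟩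

theorem length_vec (W : Matrix (Fin p) (Fin n) ℝ) : (vec W).length = n * p := by
  simp [vec, List.length_flatMap]

theorem vec_injective : Function.Injective (vec : Matrix (Fin p) (Fin n) ℝ → List ℝ) := by
  intro W W' h
  simp only [vec, List.flatMap_def] at h
  have hcols := List.eq_iff_flatten_eq.2 ⟨h, by simp⟩
  ext i j
  have hcol := List.map_eq_map_iff.1 hcols j (List.mem_finRange j)
  exact congrFun (List.ofFn_injective hcol) i

theorem length_theta_eq_of_hiddenWidths_eq {g g' : DNN m n}
    (h : g.hiddenWidths = g'.hiddenWidths) : g.theta.length = g'.theta.length := by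
  induction g with
  | output W b =>
    cases g' with
    | output W' b' => simp [theta, length_vec]
    | layer p' W' b' g' => simp [hiddenWidths] at h
  | layer p W b g ih =>
    cases g' with
    | output W' b' => simp [hiddenWidths] at h
    | layer p' W' b' g' =>
      obtain ⟨rfl, h⟩ := List.cons.inj h
      simp [theta, length_vec, ih h]

theorem eq_of_hiddenWidths_eq_of_theta_eq {g g' : DNN m n}
    (h : g.hiddenWidths = g'.hiddenWidths) (hθ : g.theta = g'.theta) : g = g' := by
  induction g with
  | output W b =>
    cases g' with
    | output W' b' =>
      obtain ⟨hW, hb⟩ := List.append_inj hθ (by simp [length_vec])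
      rw [vec_injective hW, List.ofFn_injective hb]
    | layer p' W' b' g' => simp [hiddenWidths] at h
  | layer p W b g ih =>
    cases g' with
    | output W' b' => simp [hiddenWidths] at h
    | layer p' W' b' g' =>
      obtain ⟨rfl, h⟩ := List.cons.inj h
      obtain ⟨hWb, hg⟩ := List.append_inj hθ (by simp [length_vec])
      obtain ⟨hW, hb⟩ := List.append_inj hWb (by simp [length_vec])
      rw [vec_injective hW, List.ofFn_injective hb, ih h hg]

theorem length_theta_le {D : ℕ} (hm : m ≤ D) (g : DNN m n) (hn : n ≤ D)
    (hw : ∀ p ∈ g.hiddenWidths, p ≤ D) : g.theta.length ≤ (g.depth + 1) * (D * (D + 1)) := by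
  induction g with
  | output W b =>
    have hW : _ * m ≤ D * D := Nat.mul_le_mul hn hm
    simp only [theta, List.length_append, length_vec, List.length_ofFn, depth, hiddenWidths,
      List.length_nil]
    linarith
  | @layer n p W b g ih =>
    obtain ⟨hp, hw⟩ := List.forall_mem_cons.1 hw
    have hg := ih hp hw
    have hW : n * p ≤ D * D := Nat.mul_le_mul hn hp
    simp only [theta, List.length_append, length_vec, List.length_ofFn, depth, hiddenWidths,
      List.length_cons] at hg ⊢
    linarith

theorem continuous_eval {σ : ℝ → ℝ} (hσ : Continuous σ) (g : DNN m n) :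
    Continuous (g.eval σ) := by
  induction g with
  | output W b =>
    exact (continuous_const.matrix_mulVec continuous_id).add continuous_const
  | layer p W b g ih =>
    refine ih.comp (continuous_pi fun i => hσ.comp ((continuous_apply i).comp ?_))
    exact (continuous_const.matrix_mulVec continuous_id).add continuous_const

theorem eval_eq_zero {σ : ℝ → ℝ} {g : DNN m n} (h : ∀ a ∈ g.theta, a = 0) (x : Fin n → ℝ) :
    g.eval σ x = 0 := by
  induction g with
  | output W b =>
    obtain ⟨hvec, hofFn⟩ := List.forall_mem_append.1 h
    have hW : W = 0 := Matrix.ext fun i j => hvec _ (mem_vec W i j)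
    have hb : b = 0 := funext fun i => hofFn _ (List.mem_ofFn.2 ⟨i, rfl⟩)
    simp [eval, hW, hb]
  | layer p W b g ih => exact ih (List.forall_mem_append.1 h).2 _

end DNN

section Perturbation

variable {n p : ℕ} {B ε : ℝ}

theorem norm_mulVec_le_of_forall_abs_le (hB : 0 ≤ B) {W : Matrix (Fin p) (Fin n) ℝ}
    (hW : ∀ i j, |W i j| ≤ B) (x : Fin n → ℝ) : ‖W.mulVec x‖ ≤ n * B * ‖x‖ := by
  refine (pi_norm_le_iff_of_nonneg (by positivity)).2 fun i => ?_
  calc ‖∑ j, W i j * x j‖ ≤ ∑ j, ‖W i j * x j‖ := norm_sum_le _ _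
    _ ≤ ∑ _j : Fin n, B * ‖x‖ := by
      gcongr with j
      rw [norm_mul]
      exact mul_le_mul (hW i j) (norm_le_pi_norm x j) (norm_nonneg _) hB
    _ = n * B * ‖x‖ := by simp [mul_assoc]

theorem norm_mulVec_add_le {D : ℕ} {R : ℝ} (hB : 0 ≤ B) (hR : 1 ≤ R) (hn : n ≤ D)
    {W : Matrix (Fin p) (Fin n) ℝ} {b : Fin p → ℝ} (hW : ∀ i j, |W i j| ≤ B)
    (hb : ∀ i, |b i| ≤ B) {x : Fin n → ℝ} (hx : ‖x‖ ≤ R) :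
    ‖W.mulVec x + b‖ ≤ (D + 1) * B * R := by
  have hb' : ‖b‖ ≤ B := (pi_norm_le_iff_of_nonneg hB).2 hb
  calc ‖W.mulVec x + b‖ ≤ n * B * ‖x‖ + B :=
        (norm_add_le _ _).trans (add_le_add (norm_mulVec_le_of_forall_abs_le hB hW x) hb')
    _ ≤ D * B * R + B * R := by
      gcongr
      exact le_mul_of_one_le_right hB hR
    _ = (D + 1) * B * R := by ring

theorem norm_mulVec_add_sub_map_le {D : ℕ} {R : ℝ} (hB : 1 ≤ B) (hR : 1 ≤ R) (hε : 0 ≤ ε)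
    (hε1 : ε ≤ 1) (hn : n ≤ D) {W : Matrix (Fin p) (Fin n) ℝ} {b : Fin p → ℝ}
    (hW : ∀ i j, |W i j| ≤ B) {r : ℝ → ℝ} (hr : ∀ a, |a - r a| ≤ ε) {x : Fin n → ℝ}
    (hx : ‖x‖ ≤ R) (x' : Fin n → ℝ) :
    ‖W.mulVec x + b - ((W.map r).mulVec x' + fun i => r (b i))‖ ≤
      2 * (D + 1) * B * (‖x - x'‖ + ε * R) := by
  have hrW : ∀ i j, |W.map r i j| ≤ 2 * B := fun i j => by
    have h := abs_sub_abs_le_abs_sub (r (W i j)) (W i j)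
    rw [abs_sub_comm] at h
    rw [Matrix.map_apply]
    linarith [hr (W i j), hW i j]
  have hsplit : W.mulVec x + b - ((W.map r).mulVec x' + fun i => r (b i)) =
      (W - W.map r).mulVec x + (W.map r).mulVec (x - x') + (b - fun i => r (b i)) := by
    rw [Matrix.sub_mulVec, Matrix.mulVec_sub]
    abel
  have hb : ‖b - fun i => r (b i)‖ ≤ ε := (pi_norm_le_iff_of_nonneg hε).2 fun i => hr (b i)
  have hweights := norm_mulVec_le_of_forall_abs_le hε (W := W - W.map r) (fun i j => hr (W i j)) x
  have hinput := norm_mulVec_le_of_forall_abs_le (by linarith) hrW (x - x')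
  have he := norm_nonneg (x - x')
  have hεR : ε ≤ ε * R := le_mul_of_one_le_right hε hR
  calc _ ≤ n * ε * ‖x‖ + n * (2 * B) * ‖x - x'‖ + ε := by
        rw [hsplit]
        exact norm_add₃_le.trans (by gcongr)
    _ ≤ D * ε * R + D * (2 * B) * ‖x - x'‖ + ε * R := by gcongr
    _ = D * (2 * B * ‖x - x'‖ + 1 * (ε * R)) + 1 * (ε * R) := by ring
    _ ≤ D * (2 * B * ‖x - x'‖ + 2 * B * (ε * R)) + 2 * B * (‖x - x'‖ + ε * R) := by
      gcongr
      · linarith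
      · linarith
      · linarith
    _ = 2 * (D + 1) * B * (‖x - x'‖ + ε * R) := by ring

theorem norm_comp_le_of_lipschitzWith {σ : ℝ → ℝ} {Cσ s₀ : ℝ≥0} (hσ : LipschitzWith Cσ σ)
    (h0 : |σ 0| ≤ s₀) (y : Fin n → ℝ) : ‖fun i => σ (y i)‖ ≤ Cσ * ‖y‖ + s₀ := by
  refine (pi_norm_le_iff_of_nonneg (by positivity)).2 fun i => ?_
  calc ‖σ (y i)‖ ≤ ‖σ (y i) - σ 0‖ + ‖σ 0‖ := norm_le_norm_sub_add _ _
    _ ≤ Cσ * ‖y i - 0‖ + s₀ := add_le_add (hσ.norm_sub_le _ _) h0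
    _ ≤ Cσ * ‖y‖ + s₀ := by
      rw [sub_zero]
      gcongr
      exact norm_le_pi_norm y i

theorem norm_comp_sub_comp_le_of_lipschitzWith {σ : ℝ → ℝ} {Cσ : ℝ≥0} (hσ : LipschitzWith Cσ σ)
    (y y' : Fin n → ℝ) : ‖(fun i => σ (y i)) - fun i => σ (y' i)‖ ≤ Cσ * ‖y - y'‖ := by
  refine (pi_norm_le_iff_of_nonneg (by positivity)).2 fun i => ?_
  exact (hσ.norm_sub_le _ _).trans (by gcongr; exact norm_le_pi_norm (y - y') i)

section Layer

variable {σ : ℝ → ℝ} {Cσ s₀ : ℝ≥0} {D : ℕ} {G R : ℝ} {W : Matrix (Fin p) (Fin n) ℝ}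
  {b : Fin p → ℝ} {x : Fin n → ℝ}

theorem norm_comp_mulVec_add_le (hσ : LipschitzWith Cσ σ) (h0 : |σ 0| ≤ s₀) (hB : 1 ≤ B)
    (hG : 2 * (Cσ + s₀ + 1) * (D + 1) * B ≤ G) (hR : 1 ≤ R) (hn : n ≤ D)
    (hW : ∀ i j, |W i j| ≤ B) (hb : ∀ i, |b i| ≤ B) (hx : ‖x‖ ≤ R) :
    ‖fun i => σ ((W.mulVec x + b) i)‖ ≤ G * R := by
  have hCσ : 0 ≤ (Cσ : ℝ) := Cσ.2
  have hs₀ : 0 ≤ (s₀ : ℝ) := s₀.2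
  have hDBR : 1 ≤ (D + 1) * B * R :=
    one_le_mul_of_one_le_of_one_le (one_le_mul_of_one_le_of_one_le (by simp) hB) hR
  calc ‖fun i => σ ((W.mulVec x + b) i)‖ ≤ Cσ * ((D + 1) * B * R) + s₀ * 1 := by
        refine (norm_comp_le_of_lipschitzWith hσ h0 _).trans ?_
        rw [mul_one]
        gcongr
        exact norm_mulVec_add_le (by linarith) hR hn hW hb hx
    _ ≤ 2 * (Cσ + s₀ + 1) * ((D + 1) * B * R) := by
      nlinarith [mul_le_mul_of_nonneg_left hDBR hs₀, mul_nonneg hCσ (zero_le_one.trans hDBR)]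
    _ = 2 * (Cσ + s₀ + 1) * (D + 1) * B * R := by ring
    _ ≤ G * R := by gcongr

theorem norm_comp_mulVec_add_sub_map_le (hσ : LipschitzWith Cσ σ) (hB : 1 ≤ B)
    (hG : 2 * (Cσ + s₀ + 1) * (D + 1) * B ≤ G) (hε : 0 ≤ ε) (hε1 : ε ≤ 1) {r : ℝ → ℝ}
    (hr : ∀ a, |a - r a| ≤ ε) (hR : 1 ≤ R) (hn : n ≤ D) (hW : ∀ i j, |W i j| ≤ B)
    (hx : ‖x‖ ≤ R) (x' : Fin n → ℝ) :
    ‖(fun i => σ ((W.mulVec x + b) i)) -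
        fun i => σ (((W.map r).mulVec x' + fun i => r (b i)) i)‖ ≤
      G * (‖x - x'‖ + ε * R) := by
  calc _ ≤ (Cσ : ℝ) * ‖W.mulVec x + b - ((W.map r).mulVec x' + fun i => r (b i))‖ :=
        norm_comp_sub_comp_le_of_lipschitzWith hσ _ _
    _ ≤ (Cσ + s₀ + 1) * (2 * (D + 1) * B * (‖x - x'‖ + ε * R)) := by
      gcongr
      · linarith [s₀.2]
      · exact norm_mulVec_add_sub_map_le hB hR hε hε1 hn hW hr hx x'
    _ = 2 * (Cσ + s₀ + 1) * (D + 1) * B * (‖x - x'‖ + ε * R) := by ring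
    _ ≤ G * (‖x - x'‖ + ε * R) := by gcongr

end Layer

/-- Each layer multiplies both the size of the input and the accumulated error by at most `G`,
and its own rounding adds `ε` times the size of its input. -/
theorem DNN.norm_eval_sub_eval_mapParams_le {m : ℕ} {σ : ℝ → ℝ} {Cσ s₀ : ℝ≥0}
    (hσ : LipschitzWith Cσ σ) (h0 : |σ 0| ≤ s₀) {D : ℕ} {G : ℝ} (hB : 1 ≤ B)
    (hG : 2 * (Cσ + s₀ + 1) * (D + 1) * B ≤ G) (hε : 0 ≤ ε) (hε1 : ε ≤ 1)
    {r : ℝ → ℝ} (hr : ∀ a, |a - r a| ≤ ε) (g : DNN m n) (hn : n ≤ D)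
    (hw : ∀ p ∈ g.hiddenWidths, p ≤ D) (hθ : ∀ a ∈ g.theta, |a| ≤ B)
    {x : Fin n → ℝ} (x' : Fin n → ℝ) {R : ℝ} (hR : 1 ≤ R) (hx : ‖x‖ ≤ R) :
    ‖g.eval σ x - (g.mapParams r).eval σ x'‖ ≤
      G ^ (g.depth + 1) * (‖x - x'‖ + (g.depth + 1) * ε * R) := by
  have hCσ : 0 ≤ (Cσ : ℝ) := Cσ.2
  have hs₀ : 0 ≤ (s₀ : ℝ) := s₀.2
  have hDB : 1 ≤ ((D : ℝ) + 1) * B :=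
    one_le_mul_of_one_le_of_one_le (by linarith [(Nat.cast_nonneg D : (0 : ℝ) ≤ D)]) hB
  have hstep : 2 * (D + 1) * B ≤ G := hG.trans' (by
    linarith [mul_nonneg (add_nonneg hCσ hs₀) (zero_le_one.trans hDB)])
  have hG1 : 1 ≤ G := hstep.trans' (by linarith)
  induction g generalizing R with
  | output W b =>
    have hW : ∀ i j, |W i j| ≤ B := fun i j => hθ _ (List.mem_append_left _ (mem_vec W i j))
    have := norm_mulVec_add_sub_map_le (b := b) hB hR hε hε1 hn hW hr hx x'
    simp only [depth, hiddenWidths, List.length_nil, zero_add, pow_one, Nat.cast_zero, one_mul]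
    exact this.trans (by gcongr)
  | layer p W b g ih =>
    obtain ⟨hp, hw⟩ := List.forall_mem_cons.1 hw
    obtain ⟨hWb, hg⟩ := List.forall_mem_append.1 hθ
    obtain ⟨hvec, hofFn⟩ := List.forall_mem_append.1 hWb
    have hW : ∀ i j, |W i j| ≤ B := fun i j => hvec _ (mem_vec W i j)
    have hb : ∀ i, |b i| ≤ B := fun i => hofFn _ (List.mem_ofFn.2 ⟨i, rfl⟩)
    calc _ ≤ G ^ (g.depth + 1) * (‖(fun i => σ ((W.mulVec x + b) i)) -
          fun i => σ (((W.map r).mulVec x' + fun i => r (b i)) i)‖ +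
          (g.depth + 1) * ε * (G * R)) :=
        ih hp hw hg _ (one_le_mul_of_one_le_of_one_le hG1 hR)
          (norm_comp_mulVec_add_le hσ h0 hB hG hR hn hW hb hx)
      _ ≤ G ^ (g.depth + 1) * (G * (‖x - x'‖ + ε * R) + (g.depth + 1) * ε * (G * R)) := by
        gcongr
        exact norm_comp_mulVec_add_sub_map_le hσ hB hG hε hε1 hr hR hn hW hx x'
      _ = G ^ ((layer p W b g).depth + 1) *
          (‖x - x'‖ + ((layer p W b g).depth + 1) * ε * R) := by
        simp only [depth, hiddenWidths, List.length_cons, Nat.cast_add, Nat.cast_one]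
        ring

end Perturbation

section CoveringNumbers

/-- `A` is a finite `δ`-net of the class `𝓕` for the supremum distance, made of members of `𝓕`. -/
def IsSupNet {α : Type*} (δ : ℝ) (𝓕 : Set (α → ℝ)) (A : Finset (α → ℝ)) : Prop :=
  ↑A ⊆ 𝓕 ∧ ∀ f ∈ 𝓕, ∃ f' ∈ A, ∀ x, |f x - f' x| ≤ δ

theorem IsSupNet.mono {α : Type*} {δ δ' : ℝ} {𝓕 : Set (α → ℝ)} {A : Finset (α → ℝ)}
    (hA : IsSupNet δ 𝓕 A) (h : δ ≤ δ') : IsSupNet δ' 𝓕 A :=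
  ⟨hA.1, fun f hf =>
    have ⟨f', hf', hle⟩ := hA.2 f hf
    ⟨f', hf', fun x => (hle x).trans h⟩⟩

theorem abs_sub_mul_floor_div_le {ε : ℝ} (hε : 0 < ε) (a : ℝ) : |a - ε * ⌊a / ε⌋| ≤ ε := by
  have h : a - ε * ⌊a / ε⌋ = ε * Int.fract (a / ε) := by
    rw [Int.fract, mul_sub, mul_div_cancel₀ _ hε.ne']
  rw [h, abs_mul, abs_of_pos hε, Int.abs_fract]
  exact mul_le_of_le_one_right hε.le (Int.fract_lt_one _).le

namespace DNN

variable {m n : ℕ}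

/-- The hidden widths of a network, and the non-zero parameters, rounded down to multiples of `ε`
and listed with their positions. This determines the rounded network. -/
noncomputable def gridCode (ε : ℝ) (g : DNN m n) : List ℕ × List (ℤ × ℕ) :=
  (g.hiddenWidths, (g.theta.map fun a => ⌊a / ε⌋).zipIdx.filter fun q => q.1 ≠ 0)

theorem mapParams_eq_of_gridCode_eq {ε : ℝ} {g g' : DNN m n}
    (h : g.gridCode ε = g'.gridCode ε) :
    g.mapParams (fun a => ε * ⌊a / ε⌋) = g'.mapParams (fun a => ε * ⌊a / ε⌋) := by
  obtain ⟨hwidths, hentries⟩ := Prod.mk.inj h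
  have hfloor : (g.theta.map fun a => ⌊a / ε⌋) = g'.theta.map fun a => ⌊a / ε⌋ :=
    eq_of_filter_zipIdx_eq
      (by simp only [List.length_map, length_theta_eq_of_hiddenWidths_eq hwidths]) hentries
  refine eq_of_hiddenWidths_eq_of_theta_eq (by simpa only [hiddenWidths_mapParams]) ?_
  simpa only [theta_mapParams, List.map_map, Function.comp_def] using
    congrArg (List.map fun k : ℤ => ε * k) hfloor

theorem length_gridCode_snd_le (ε : ℝ) (g : DNN m n) : (g.gridCode ε).2.length ≤ g.sparsity := by
  have hfst : ∀ l : List ℤ,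
      (l.zipIdx.filter fun q => q.1 ≠ 0).length = (l.filter fun k => k ≠ 0).length := fun l => by
    conv_rhs => rw [← List.zipIdx_map_fst 0 l, List.filter_map, List.length_map]
    rfl
  rw [gridCode, hfst, List.filter_map, List.length_map, sparsity, ← List.countP_eq_length_filter,
    ← List.countP_eq_length_filter]
  refine List.countP_mono_left fun a _ ha => ?_
  simp only [Function.comp_apply, decide_eq_true_eq] at ha ⊢
  rintro rfl
  simp at ha

theorem exists_finset_gridCode_mem {B ε : ℝ} (hε : 0 < ε) (l s D : ℕ) {Q : ℕ} (hQ : B / ε ≤ Q) :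
    ∃ K : Finset (List ℕ × List (ℤ × ℕ)),
      K.card ≤ (D + 2) ^ l * ((2 * Q + 1) * ((l + 1) * (D * (D + 1))) + 1) ^ s ∧
      ∀ g : DNN m n, m ≤ D → n ≤ D → (∀ p ∈ g.hiddenWidths, p ≤ D) → g.depth ≤ l →
        (∀ a ∈ g.theta, |a| ≤ B) → g.sparsity ≤ s → g.gridCode ε ∈ K := by
  obtain ⟨𝓦, h𝓦card, h𝓦⟩ := exists_finset_lists_of_length_le (Finset.range (D + 1)) l
  obtain ⟨𝓔, h𝓔card, h𝓔⟩ := exists_finset_lists_of_length_le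
    (Finset.Icc (-Q : ℤ) Q ×ˢ Finset.range ((l + 1) * (D * (D + 1)))) s
  refine ⟨𝓦 ×ˢ 𝓔, ?_, fun g hm hn hw hl hB hs => Finset.mem_product.2 ⟨?_, ?_⟩⟩
  · have hIcc : ((Q : ℤ) + 1 - -Q).toNat = 2 * Q + 1 := by omega
    rw [Finset.card_range] at h𝓦card
    rw [Finset.card_product, Int.card_Icc, Finset.card_range, hIcc] at h𝓔card
    rw [Finset.card_product]
    exact Nat.mul_le_mul h𝓦card h𝓔card
  · exact h𝓦 _ hl fun p hp => Finset.mem_range.2 (Nat.lt_succ_of_le (hw p hp))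
  · refine h𝓔 _ ((g.length_gridCode_snd_le ε).trans hs) fun q hq => ?_
    obtain ⟨hk, hi⟩ := List.mem_zipIdx' (List.mem_of_mem_filter hq)
    rw [List.length_map] at hk
    rw [List.getElem_map] at hi
    refine Finset.mem_product.2 ⟨?_, Finset.mem_range.2 (hk.trans_le ?_)⟩
    · have ha := hB _ (List.getElem_mem hk)
      obtain ⟨hlow, hupp⟩ := abs_le.1 (show |g.theta[q.2] / ε| ≤ Q by
        rw [abs_div, abs_of_pos hε]
        exact (div_le_div_of_nonneg_right ha hε.le).trans hQ)
      rw [hi, Finset.mem_Icc]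
      exact ⟨Int.le_floor.2 (by exact_mod_cast hlow), by exact_mod_cast (Int.floor_le _).trans hupp⟩
    · exact (length_theta_le hm g hn hw).trans (by gcongr)

end DNN

/-- The parameters of the networks that realise the members of `sparseDNNClass`. -/
def sparseDNNParams (d : ℕ) (σ : ℝ → ℝ) (L N B F S : ℝ) : Set (DNN 1 d) :=
  {g | 1 ≤ g.depth ∧ (g.depth : ℝ) ≤ L ∧
    (∀ p ∈ g.hiddenWidths, 1 ≤ p ∧ (p : ℝ) ≤ N) ∧
    (∀ a ∈ g.theta, |a| ≤ B) ∧
    (g.sparsity : ℝ) ≤ S ∧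
    (∀ x ∈ unitCube d, |g.eval σ x 0| ≤ F)}

/-- The function realised by a network, cut off outside the unit cube. -/
noncomputable def DNN.realize {d : ℕ} (σ : ℝ → ℝ) (g : DNN 1 d) : (Fin d → ℝ) → ℝ :=
  (unitCube d).indicator fun x => g.eval σ x 0

variable {d : ℕ} {σ : ℝ → ℝ} {L N B F S : ℝ}

theorem sparseDNNClass_eq_image :
    sparseDNNClass d σ L N B F S = DNN.realize σ '' sparseDNNParams d σ L N B F S := by
  ext h
  simp only [sparseDNNClass, sparseDNNParams, DNN.realize, Set.mem_image, Set.mem_ofPred_eq,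
    and_assoc, eq_comm]

theorem norm_le_one_of_mem_unitCube {x : Fin d → ℝ} (hx : x ∈ unitCube d) : ‖x‖ ≤ 1 :=
  (pi_norm_le_iff_of_nonneg zero_le_one).2 fun i =>
    abs_le.2 ⟨neg_one_lt_zero.le.trans (hx.1 i), hx.2 i⟩

variable {Cσ s₀ : ℝ≥0}

theorem DNN.abs_realize_sub_realize_mapParams_le (hσ : LipschitzWith Cσ σ) (h0 : |σ 0| ≤ s₀)
    {D l : ℕ} {G ε : ℝ} (hB : 1 ≤ B) (hG : 2 * (Cσ + s₀ + 1) * (D + 1) * B ≤ G) (hG1 : 1 ≤ G)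
    (hε : 0 ≤ ε) (hε1 : ε ≤ 1) {r : ℝ → ℝ} (hr : ∀ a, |a - r a| ≤ ε) (hd : d ≤ D) {g : DNN 1 d}
    (hw : ∀ p ∈ g.hiddenWidths, p ≤ D) (hl : g.depth ≤ l) (hθ : ∀ a ∈ g.theta, |a| ≤ B)
    (x : Fin d → ℝ) :
    |g.realize σ x - (g.mapParams r).realize σ x| ≤ G ^ (l + 1) * ((l + 1) * ε) := by
  by_cases hx : x ∈ unitCube d
  · have h := g.norm_eval_sub_eval_mapParams_le hσ h0 hB hG hε hε1 hr hd hw hθ x le_rfl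
      (norm_le_one_of_mem_unitCube hx)
    rw [sub_self, norm_zero, zero_add, mul_one] at h
    rw [realize, realize, Set.indicator_of_mem hx, Set.indicator_of_mem hx]
    exact (norm_le_pi_norm _ 0).trans (h.trans (by gcongr))
  · rw [realize, realize, Set.indicator_of_notMem hx, Set.indicator_of_notMem hx, sub_self,
      abs_zero]
    positivity

theorem exists_isSupNet_sparseDNNClass (hσ : LipschitzWith Cσ σ) (h0 : |σ 0| ≤ s₀) {D Q : ℕ}
    {G ε : ℝ} (hB : 1 ≤ B) (hD : ⌊N⌋₊ + d + 1 ≤ D)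
    (hG : 2 * (Cσ + s₀ + 1) * (D + 1) * B ≤ G) (hG1 : 1 ≤ G) (hε : 0 < ε) (hε1 : ε ≤ 1)
    (hQ : B / ε ≤ Q) :
    ∃ A : Finset ((Fin d → ℝ) → ℝ),
      IsSupNet (2 * (G ^ (⌊L⌋₊ + 1) * ((⌊L⌋₊ + 1) * ε))) (sparseDNNClass d σ L N B F S) A ∧
      A.card ≤
        (D + 2) ^ ⌊L⌋₊ * ((2 * Q + 1) * ((⌊L⌋₊ + 1) * (D * (D + 1))) + 1) ^ ⌊S⌋₊ := by
  classical
  obtain ⟨K, hKcard, hK⟩ :=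
    DNN.exists_finset_gridCode_mem (m := 1) (n := d) hε ⌊L⌋₊ ⌊S⌋₊ D hQ
  have hw : ∀ g ∈ sparseDNNParams d σ L N B F S, ∀ p ∈ g.hiddenWidths, p ≤ D :=
    fun g hg p hp => (Nat.le_floor (hg.2.2.1 p hp).2).trans (by omega)
  obtain ⟨R, hR, hRcard, hRcode⟩ := exists_finset_representatives
    (sparseDNNParams d σ L N B F S) (DNN.gridCode ε) K fun g hg =>
      hK g (by omega) (by omega) (hw g hg) (Nat.le_floor hg.2.1) hg.2.2.2.1
        (Nat.le_floor hg.2.2.2.2.1)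
  refine ⟨R.image (DNN.realize σ), ⟨?_, ?_⟩, Finset.card_image_le.trans (hRcard.trans hKcard)⟩
  · rw [sparseDNNClass_eq_image, Finset.coe_image]
    exact Set.image_mono hR
  · rw [sparseDNNClass_eq_image]
    rintro _ ⟨g, hg, rfl⟩
    obtain ⟨g', hg', hcode⟩ := hRcode g hg
    have hround := fun f (hf : f ∈ sparseDNNParams d σ L N B F S) =>
      f.abs_realize_sub_realize_mapParams_le hσ h0 hB hG hG1 hε.le hε1
        (abs_sub_mul_floor_div_le hε) (by omega) (hw f hf) (Nat.le_floor hf.2.1) hf.2.2.2.1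
    refine ⟨_, Finset.mem_image_of_mem _ hg', fun x => ?_⟩
    have hg'x := hround g' (hR hg') x
    rw [DNN.mapParams_eq_of_gridCode_eq hcode, abs_sub_comm] at hg'x
    rw [two_mul]
    exact (abs_sub_le _ _ _).trans (add_le_add (hround g hg x) hg'x)

end CoveringNumbers

section MetricEntropy

variable {d : ℕ} {σ : ℝ → ℝ} {Cσ s₀ : ℝ≥0} {L N B F S δ V : ℝ}

theorem grid_entry_count_le_pow {l D : ℕ} (hB : 1 ≤ B) (hδ : 0 < δ) (hδ1 : δ ≤ 1) (hV : 18 ≤ V)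
    (hD : (D : ℝ) + 1 ≤ V) (hl : ((l : ℝ) + 1) * B / δ ≤ V) :
    (2 * (⌈B / (δ / (2 * (V ^ (l + 1) * (l + 1))))⌉₊ : ℝ) + 1) * ((l + 1) * (D * (D + 1))) + 1 ≤
      V ^ (l + 7) := by
  have hBδ : 1 ≤ (l + 1) * B / δ :=
    (one_le_div hδ).2 (hδ1.trans (one_le_mul_of_one_le_of_one_le (by simp) hB))
  have hlV : (l : ℝ) + 1 ≤ V := hl.trans' (by
    rw [mul_div_assoc]
    exact le_mul_of_one_le_right (by positivity) ((one_le_div hδ).2 (hδ1.trans hB)))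
  have hceil : 2 * (⌈B / (δ / (2 * (V ^ (l + 1) * (l + 1))))⌉₊ : ℝ) + 1 ≤
      10 * (V ^ (l + 1) * ((l + 1) * B / δ)) := by
    have hquot : B / (δ / (2 * (V ^ (l + 1) * (l + 1)))) =
        2 * (V ^ (l + 1) * ((l + 1) * B / δ)) := by
      field_simp
    have hone : 1 ≤ V ^ (l + 1) * ((l + 1) * B / δ) :=
      one_le_mul_of_one_le_of_one_le (one_le_pow₀ (by linarith)) hBδ
    rw [hquot]
    linarith [Nat.ceil_lt_add_one (by linarith : 0 ≤ 2 * (V ^ (l + 1) * ((l + 1) * B / δ)))]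
  have : 0 ≤ V := by linarith
  calc _ ≤ 10 * (V ^ (l + 1) * V) * (V * (V * V)) + V ^ (l + 5) := by
        gcongr
        · exact hceil.trans (by gcongr)
        · linarith
        · exact one_le_pow₀ (by linarith)
    _ = 11 * V ^ (l + 5) := by ring
    _ ≤ V * V * V ^ (l + 5) := by gcongr; nlinarith
    _ = V ^ (l + 7) := by ring

theorem exists_isSupNet_sparseDNNClass_card_le_pow (hσ : LipschitzWith Cσ σ) (h0 : |σ 0| ≤ s₀)
    (hL : 0 ≤ L) (hN : 0 ≤ N) (hB : 1 ≤ B) (hδ : 0 < δ) (hδ1 : δ ≤ 1)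
    (hV : 18 ≤ V) (hVN : 2 * (Cσ + s₀ + 1) * (N + d + 3) * B ≤ V) (hVL : (L + 1) * B / δ ≤ V) :
    ∃ A : Finset ((Fin d → ℝ) → ℝ), IsSupNet δ (sparseDNNClass d σ L N B F S) A ∧
      (A.card : ℝ) ≤ V ^ (⌊L⌋₊ + (⌊L⌋₊ + 7) * ⌊S⌋₊) := by
  have hDN : ((⌊N⌋₊ + d + 1 : ℕ) : ℝ) + 2 ≤ N + d + 3 := by
    push_cast
    linarith [Nat.floor_le hN]
  have hDV : ((⌊N⌋₊ + d + 1 : ℕ) : ℝ) + 2 ≤ V := by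
    have hCB : (1 : ℝ) ≤ 2 * (Cσ + s₀ + 1) * B :=
      one_le_mul_of_one_le_of_one_le (by linarith [Cσ.2, s₀.2]) hB
    nlinarith [mul_le_mul_of_nonneg_right hCB (show (0 : ℝ) ≤ N + d + 3 by positivity)]
  have hVl : 1 ≤ V ^ (⌊L⌋₊ + 1) * (⌊L⌋₊ + 1) :=
    one_le_mul_of_one_le_of_one_le (one_le_pow₀ (by linarith)) (by simp)
  have hε0 : 0 < δ / (2 * (V ^ (⌊L⌋₊ + 1) * (⌊L⌋₊ + 1))) := by positivity
  obtain ⟨A, hA, hcard⟩ := exists_isSupNet_sparseDNNClass (d := d) (L := L) (N := N) (F := F)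
    (S := S) hσ h0 hB le_rfl (G := V) (hVN.trans' (by gcongr 2 * (Cσ + s₀ + 1) * ?_ * B; linarith))
    (by linarith) hε0 (div_le_one_of_le₀ (by linarith) (by positivity)) (Nat.le_ceil _)
  refine ⟨A, ?_, ?_⟩
  · convert hA using 1
    field_simp
  · have : 0 ≤ V := by linarith
    calc (A.card : ℝ) ≤ _ := Nat.cast_le.2 hcard
      _ ≤ V ^ ⌊L⌋₊ * (V ^ (⌊L⌋₊ + 7)) ^ ⌊S⌋₊ := by
        rw [Nat.cast_mul, Nat.cast_pow, Nat.cast_pow]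
        gcongr
        · exact_mod_cast hDV
        · exact_mod_cast grid_entry_count_le_pow hB hδ hδ1 hV (by linarith)
            (hVL.trans' (by gcongr; exact Nat.floor_le hL))
      _ = V ^ (⌊L⌋₊ + (⌊L⌋₊ + 7) * ⌊S⌋₊) := by rw [← pow_mul, ← pow_add]

theorem log_one_add_le_of_le_pow {c : ℝ} {k : ℕ} (hc : 0 ≤ c) (hV : 2 ≤ V) (h : c ≤ V ^ k) :
    Real.log (1 + c) ≤ (k + 1) * Real.log V := by
  have hpow : 1 + c ≤ V ^ (k + 1) := by
    nlinarith [one_le_pow₀ (n := k) (show 1 ≤ V by linarith), pow_succ V k]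
  calc Real.log (1 + c) ≤ Real.log (V ^ (k + 1)) := Real.log_le_log (by linarith) hpow
    _ = (k + 1) * Real.log V := by rw [Real.log_pow, Nat.cast_succ]

theorem natFloor_add_mul_natFloor_add_one_le (hL : 0 ≤ L) (hS : 1 ≤ S) :
    ((⌊L⌋₊ + (⌊L⌋₊ + 7) * ⌊S⌋₊ : ℕ) : ℝ) + 1 ≤ 8 * (S * (L + 1)) := by
  have hl := Nat.floor_le hL
  calc _ = (⌊L⌋₊ + 1) + (⌊L⌋₊ + 7) * (⌊S⌋₊ : ℝ) := by push_cast; ring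
    _ ≤ (L + 1) + (L + 7) * S := by
      gcongr
      exact Nat.floor_le (by linarith)
    _ ≤ 8 * (S * (L + 1)) := by nlinarith [mul_nonneg hL (sub_nonneg.2 hS)]

theorem log_mul_le_log_add_one_mul_log {κ U : ℝ} (hκ : 1 ≤ κ) (hU : 3 ≤ U) :
    Real.log (κ * U) ≤ (Real.log κ + 1) * Real.log U := by
  have hlogU : 1 ≤ Real.log U :=
    (Real.le_log_iff_exp_le (by linarith)).2 (Real.exp_one_lt_d9.le.trans (by linarith))
  rw [Real.log_mul (by linarith) (by linarith), add_one_mul]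
  gcongr
  exact le_mul_of_one_le_right (Real.log_nonneg hκ) hlogU

theorem exists_isSupNet_sparseDNNClass_log_card_le (d : ℕ) (Cσ s₀ : ℝ≥0) :
    ∃ C : ℝ, 0 < C ∧ ∀ σ : ℝ → ℝ, LipschitzWith Cσ σ → |σ 0| ≤ s₀ → ∀ L N B F S δ : ℝ,
      0 ≤ L → 0 ≤ N → 1 ≤ B → 1 ≤ S → 0 < δ → δ ≤ 1 / 3 →
      ∃ A : Finset ((Fin d → ℝ) → ℝ), IsSupNet δ (sparseDNNClass d σ L N B F S) A ∧
        Real.log (1 + A.card) ≤ C * (S * (L + 1) * Real.log ((L + 1) * (N + 1) * B * δ⁻¹)) := by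
  set κ : ℝ := 2 * (Cσ + s₀ + 1) * (d + 3)
  have hκ : 6 ≤ κ := by
    nlinarith [show (1 : ℝ) ≤ Cσ + s₀ + 1 by linarith [Cσ.2, s₀.2],
      (Nat.cast_nonneg d : (0 : ℝ) ≤ d)]
  have hlogκ : 0 ≤ Real.log κ := Real.log_nonneg (by linarith)
  refine ⟨8 * (Real.log κ + 1), by positivity, fun σ hσ h0 L N B F S δ hL hN hB hS hδ hδ3 => ?_⟩
  set U := (L + 1) * (N + 1) * B * δ⁻¹
  have hLNB : 1 ≤ (L + 1) * (N + 1) * B := one_le_mul_of_one_le_of_one_le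
    (one_le_mul_of_one_le_of_one_le (by linarith) (by linarith)) hB
  have hδ' : 3 ≤ δ⁻¹ := (le_inv_comm₀ (by norm_num) hδ).2 (by linarith)
  have hU3 : 3 ≤ U := by nlinarith
  have hVN : 2 * (Cσ + s₀ + 1) * (N + d + 3) * B ≤ κ * U := by
    calc _ ≤ 2 * (Cσ + s₀ + 1) * ((d + 3) * (N + 1)) * B := by
          gcongr
          nlinarith [mul_nonneg hN (Nat.cast_nonneg d : (0 : ℝ) ≤ d)]
      _ = κ * (1 * (N + 1) * B * 1) := by ring
      _ ≤ κ * ((L + 1) * (N + 1) * B * δ⁻¹) := by gcongr <;> linarith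
  have hVL : (L + 1) * B / δ ≤ κ * U := by
    calc (L + 1) * B / δ = 1 * ((L + 1) * 1 * B * δ⁻¹) := by ring
      _ ≤ κ * ((L + 1) * (N + 1) * B * δ⁻¹) := by gcongr <;> linarith
  obtain ⟨A, hA, hcard⟩ := exists_isSupNet_sparseDNNClass_card_le_pow (F := F) (S := S) hσ h0 hL hN
    hB hδ (by linarith) (by nlinarith) hVN hVL
  refine ⟨A, hA, ?_⟩
  calc Real.log (1 + A.card) ≤ _ * Real.log (κ * U) :=
        log_one_add_le_of_le_pow (Nat.cast_nonneg _) (by nlinarith) hcard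
    _ ≤ 8 * (S * (L + 1)) * ((Real.log κ + 1) * Real.log U) :=
      mul_le_mul (natFloor_add_mul_natFloor_add_one_le hL hS)
        (log_mul_le_log_add_one_mul_log (by linarith) hU3)
        (Real.log_nonneg (by nlinarith)) (by positivity)
    _ = 8 * (Real.log κ + 1) * (S * (L + 1) * Real.log U) := by ring

end MetricEntropy

/-! ### Decoupling of β-mixing blocks -/

section BetaCoeff

variable {Ω : Type*} {𝒜 ℬ 𝒜' ℬ' : MeasurableSpace Ω} [mΩ : MeasurableSpace Ω] (P : Measure Ω)
  [IsProbabilityMeasure P]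

theorem sum_measureReal_inter_of_isFinPartition {n : ℕ} {A : Fin n → Set Ω}
    (hA : IsFinPartition 𝒜 A) (h𝒜 : 𝒜 ≤ mΩ) {s : Set Ω} (hs : MeasurableSet s) :
    ∑ i, P.real (s ∩ A i) = P.real s := by
  obtain ⟨hmeas, hdisj, hunion⟩ := hA
  rw [← measureReal_biUnion_finset
    (fun i _ j _ hij => (hdisj hij).mono Set.inter_subset_right Set.inter_subset_right)
    (fun i _ => hs.inter (h𝒜 _ (hmeas i)))]
  congr 1
  simp [← Set.inter_iUnion, hunion]

theorem sum_abs_measureReal_inter_sub_le_two {n k : ℕ} {A : Fin n → Set Ω} {B : Fin k → Set Ω}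
    (hA : IsFinPartition 𝒜 A) (hB : IsFinPartition ℬ B) (h𝒜 : 𝒜 ≤ mΩ) (hℬ : ℬ ≤ mΩ) :
    ∑ i, ∑ j, |P.real (A i ∩ B j) - P.real (A i) * P.real (B j)| ≤ 2 := by
  have sum_A := sum_measureReal_inter_of_isFinPartition P hA h𝒜 MeasurableSet.univ
  have sum_B := sum_measureReal_inter_of_isFinPartition P hB hℬ MeasurableSet.univ
  simp only [Set.univ_inter, probReal_univ] at sum_A sum_B
  calc ∑ i, ∑ j, |P.real (A i ∩ B j) - P.real (A i) * P.real (B j)|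
      ≤ ∑ i, ∑ j, (P.real (A i ∩ B j) + P.real (A i) * P.real (B j)) := by
        refine Finset.sum_le_sum fun i _ => Finset.sum_le_sum fun j _ => ?_
        refine (abs_sub _ _).trans_eq ?_
        rw [abs_of_nonneg measureReal_nonneg,
          abs_of_nonneg (mul_nonneg measureReal_nonneg measureReal_nonneg)]
    _ = ∑ i, (P.real (A i) + P.real (A i)) := by
        refine Finset.sum_congr rfl fun i _ => ?_
        rw [Finset.sum_add_distrib, ← Finset.mul_sum, sum_B, mul_one,
          sum_measureReal_inter_of_isFinPartition P hB hℬ (h𝒜 _ (hA.1 i))]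
    _ = 2 := by
        rw [Finset.sum_add_distrib, sum_A]
        norm_num

theorem sum_abs_measureReal_inter_sub_le_betaCoeff {n k : ℕ} {A : Fin n → Set Ω}
    {B : Fin k → Set Ω} (hA : IsFinPartition 𝒜 A) (hB : IsFinPartition ℬ B) (h𝒜 : 𝒜 ≤ mΩ)
    (hℬ : ℬ ≤ mΩ) :
    ∑ i, ∑ j, |P.real (A i ∩ B j) - P.real (A i) * P.real (B j)| ≤ 2 * betaCoeff P 𝒜 ℬ := by
  have bdd : BddAbove {s : ℝ | ∃ (n k : ℕ) (A : Fin n → Set Ω) (B : Fin k → Set Ω),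
      IsFinPartition 𝒜 A ∧ IsFinPartition ℬ B ∧
      s = ∑ i, ∑ j, |P.real (A i ∩ B j) - P.real (A i) * P.real (B j)|} := by
    refine ⟨2, ?_⟩
    rintro _ ⟨n, k, A, B, hA, hB, rfl⟩
    exact sum_abs_measureReal_inter_sub_le_two P hA hB h𝒜 hℬ
  have := le_csSup bdd ⟨n, k, A, B, hA, hB, rfl⟩
  rw [betaCoeff]
  linarith

theorem isFinPartition_const_univ {Ω : Type*} (𝒜 : MeasurableSpace Ω) :
    IsFinPartition 𝒜 (fun _ : Fin 1 => Set.univ) :=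
  ⟨fun _ => MeasurableSet.univ, fun i j hij => (hij (Subsingleton.elim i j)).elim,
    Set.iUnion_const _⟩

omit [IsProbabilityMeasure P] in
theorem betaCoeff_le {b : ℝ} (h : ∀ {n k : ℕ} {A : Fin n → Set Ω} {B : Fin k → Set Ω},
    IsFinPartition 𝒜 A → IsFinPartition ℬ B →
      ∑ i, ∑ j, |P.real (A i ∩ B j) - P.real (A i) * P.real (B j)| ≤ 2 * b) :
    betaCoeff P 𝒜 ℬ ≤ b := by
  have sSup_le : sSup {s : ℝ | ∃ (n k : ℕ) (A : Fin n → Set Ω) (B : Fin k → Set Ω),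
      IsFinPartition 𝒜 A ∧ IsFinPartition ℬ B ∧
      s = ∑ i, ∑ j, |P.real (A i ∩ B j) - P.real (A i) * P.real (B j)|} ≤ 2 * b := by
    refine csSup_le
      ⟨_, 1, 1, _, _, isFinPartition_const_univ 𝒜, isFinPartition_const_univ ℬ, rfl⟩ ?_
    rintro _ ⟨n, k, A, B, hA, hB, rfl⟩
    exact h hA hB
  rw [betaCoeff]
  linarith

theorem betaCoeff_mono (h𝒜 : 𝒜 ≤ 𝒜') (hℬ : ℬ ≤ ℬ') (h𝒜' : 𝒜' ≤ mΩ)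
    (hℬ' : ℬ' ≤ mΩ) : betaCoeff P 𝒜 ℬ ≤ betaCoeff P 𝒜' ℬ' :=
  betaCoeff_le P fun hA hB => sum_abs_measureReal_inter_sub_le_betaCoeff P
    ⟨fun i => h𝒜 _ (hA.1 i), hA.2⟩ ⟨fun j => hℬ _ (hB.1 j), hB.2⟩ h𝒜' hℬ'

theorem betaCoeff_nonpos_of_indep {P : Measure Ω} (h : Indep 𝒜 ℬ P) :
    betaCoeff P 𝒜 ℬ ≤ 0 := by
  refine betaCoeff_le P fun hA hB => le_of_eq ?_
  rw [mul_zero]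
  refine Finset.sum_eq_zero fun i _ => Finset.sum_eq_zero fun j _ => ?_
  have := (Indep_iff _ _ P).1 h _ _ (hA.1 i) (hB.1 j)
  simp [measureReal_def, this]

end BetaCoeff

section Decoupling

variable {Ω : Type*} {𝒜 ℬ : MeasurableSpace Ω} [mΩ : MeasurableSpace Ω] {E₁ E₂ : Type*}

theorem isFinPartition_preimage_singleton {Ω E : Type*} [Fintype E] [MeasurableSpace E]
    [MeasurableSingletonClass E] {𝒜 : MeasurableSpace Ω} {U : Ω → E} (hU : Measurable[𝒜] U) :
    IsFinPartition 𝒜 (fun i : Fin (Fintype.card E) => U ⁻¹' {(Fintype.equivFin E).symm i}) := by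
  refine ⟨fun i => hU (measurableSet_singleton _), fun i j hij => Disjoint.preimage _ ?_, ?_⟩
  · simpa using hij
  · ext ω
    simp only [Set.mem_iUnion, Set.mem_preimage, Set.mem_singleton_iff, Set.mem_univ, iff_true]
    exact ⟨Fintype.equivFin E (U ω), by simp⟩

theorem sum_abs_joint_sub_prod_le_betaCoeff [Fintype E₁] [Fintype E₂] [MeasurableSpace E₁]
    [MeasurableSpace E₂] [MeasurableSingletonClass E₁] [MeasurableSingletonClass E₂]
    (P : Measure Ω) [IsProbabilityMeasure P] (h𝒜 : 𝒜 ≤ mΩ) (hℬ : ℬ ≤ mΩ) {U : Ω → E₁}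
    {V : Ω → E₂} (hU : Measurable[𝒜] U) (hV : Measurable[ℬ] V) :
    ∑ a, ∑ c, |P.real (U ⁻¹' {a} ∩ V ⁻¹' {c}) - P.real (U ⁻¹' {a}) * P.real (V ⁻¹' {c})| ≤
      2 * betaCoeff P 𝒜 ℬ := by
  refine le_trans (le_of_eq ?_) (sum_abs_measureReal_inter_sub_le_betaCoeff P
    (isFinPartition_preimage_singleton hU) (isFinPartition_preimage_singleton hV) h𝒜 hℬ)
  refine (Equiv.sum_comp (Fintype.equivFin E₁).symm _).symm.trans ?_
  exact Finset.sum_congr rfl fun i _ => (Equiv.sum_comp (Fintype.equivFin E₂).symm _).symm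

theorem integral_comp_eq_sum_of_fintype {Ω E : Type*} [MeasurableSpace Ω] [Fintype E]
    [MeasurableSpace E] [MeasurableSingletonClass E] (P : Measure Ω) [IsProbabilityMeasure P]
    {U : Ω → E} (hU : Measurable U) (f : E → ℝ) :
    ∫ ω, f (U ω) ∂P = ∑ a, P.real (U ⁻¹' {a}) * f a := by
  have : IsProbabilityMeasure (P.map U) := Measure.isProbabilityMeasure_map hU.aemeasurable
  rw [← integral_map hU.aemeasurable (measurable_of_finite f).aestronglyMeasurable,
    integral_fintype Integrable.of_finite]
  refine Finset.sum_congr rfl fun a _ => ?_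
  rw [map_measureReal_apply hU (measurableSet_singleton a), smul_eq_mul]

theorem integral_le_integral_prod_add_betaCoeff_of_finite [Finite E₁] [Finite E₂]
    [MeasurableSpace E₁] [MeasurableSpace E₂] [MeasurableSingletonClass E₁]
    [MeasurableSingletonClass E₂] (P : Measure Ω) [IsProbabilityMeasure P] (h𝒜 : 𝒜 ≤ mΩ)
    (hℬ : ℬ ≤ mΩ) {U : Ω → E₁} {V : Ω → E₂} (hU : Measurable[𝒜] U) (hV : Measurable[ℬ] V)
    {f : E₁ × E₂ → ℝ} {M : ℝ} (hM : 0 ≤ M) (hf : ∀ z, |f z| ≤ M) :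
    ∫ ω, f (U ω, V ω) ∂P ≤
      ∫ p, f (U p.1, V p.2) ∂(P.prod P) + M * (2 * betaCoeff P 𝒜 ℬ) := by
  have := Fintype.ofFinite E₁
  have := Fintype.ofFinite E₂
  have hU' := hU.mono h𝒜 le_rfl
  have hV' := hV.mono hℬ le_rfl
  have joint : ∀ z : E₁ × E₂,
      (fun ω => (U ω, V ω)) ⁻¹' {z} = U ⁻¹' {z.1} ∩ V ⁻¹' {z.2} := fun z => by
    ext; simp [Prod.ext_iff]
  have prod : ∀ z : E₁ × E₂, (fun p : Ω × Ω => (U p.1, V p.2)) ⁻¹' {z} =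
      (U ⁻¹' {z.1}) ×ˢ (V ⁻¹' {z.2}) := fun z => by
    ext; simp [Prod.ext_iff]
  have hprod : Measurable fun p : Ω × Ω => (U p.1, V p.2) :=
    (hU'.comp measurable_fst).prodMk (hV'.comp measurable_snd)
  rw [integral_comp_eq_sum_of_fintype P (hU'.prodMk hV') f,
    integral_comp_eq_sum_of_fintype (P.prod P) hprod f]
  simp only [joint, prod, measureReal_prod_prod]
  refine le_trans ?_ (add_le_add_right (mul_le_mul_of_nonneg_left
    (sum_abs_joint_sub_prod_le_betaCoeff P h𝒜 hℬ hU hV) hM) _)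
  rw [← Fintype.sum_prod_type', Finset.mul_sum, ← Finset.sum_add_distrib]
  refine Finset.sum_le_sum fun z _ => sub_le_iff_le_add'.1 ?_
  rw [← sub_mul, mul_comm M]
  refine (le_abs_self _).trans ?_
  rw [abs_mul]
  exact mul_le_mul_of_nonneg_left (hf z) (abs_nonneg _)

/-- The finite case applies to simple functions, seen as maps into their finite range, and these
approximate `U` and `V` pointwise. -/
theorem integral_le_integral_prod_add_betaCoeff [TopologicalSpace E₁] [TopologicalSpace E₂]
    (P : Measure Ω) [IsProbabilityMeasure P] (h𝒜 : 𝒜 ≤ mΩ) (hℬ : ℬ ≤ mΩ) {U : Ω → E₁}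
    {V : Ω → E₂} (hU : StronglyMeasurable[𝒜] U) (hV : StronglyMeasurable[ℬ] V)
    {f : E₁ × E₂ → ℝ} (hfc : Continuous f) {M : ℝ} (hM : 0 ≤ M) (hf : ∀ z, |f z| ≤ M) :
    ∫ ω, f (U ω, V ω) ∂P ≤
      ∫ p, f (U p.1, V p.2) ∂(P.prod P) + M * (2 * betaCoeff P 𝒜 ℬ) := by
  have hbound : ∀ n, ∫ ω, f (hU.approx n ω, hV.approx n ω) ∂P ≤
      ∫ p, f (hU.approx n p.1, hV.approx n p.2) ∂(P.prod P) + M * (2 * betaCoeff P 𝒜 ℬ) :=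
    fun n => by
      let _ : MeasurableSpace E₁ := ⊤
      let _ : MeasurableSpace E₂ := ⊤
      have := (@SimpleFunc.finite_range _ _ 𝒜 (hU.approx n)).to_subtype
      have := (@SimpleFunc.finite_range _ _ ℬ (hV.approx n)).to_subtype
      exact integral_le_integral_prod_add_betaCoeff_of_finite P h𝒜 hℬ
        (@SimpleFunc.measurable _ _ 𝒜 _ (hU.approx n)).rangeFactorization
        (@SimpleFunc.measurable _ _ ℬ _ (hV.approx n)).rangeFactorization
        (f := fun z => f (z.1, z.2)) hM fun z => hf _
  have hmeasU : ∀ n, StronglyMeasurable (hU.approx n) := fun n =>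
    (SimpleFunc.stronglyMeasurable _).mono h𝒜
  have hmeasV : ∀ n, StronglyMeasurable (hV.approx n) := fun n =>
    (SimpleFunc.stronglyMeasurable _).mono hℬ
  refine le_of_tendsto_of_tendsto'
    (tendsto_integral_of_dominated_convergence (fun _ => M) (fun n => ?_) (integrable_const M)
      (fun n => .of_forall fun ω => hf _) (.of_forall fun ω => ?_))
    ((tendsto_integral_of_dominated_convergence (fun _ => M) (fun n => ?_) (integrable_const M)
      (fun n => .of_forall fun p => hf _) (.of_forall fun p => ?_)).add_const _) hbound
  · exact (hfc.comp_stronglyMeasurable ((hmeasU n).prodMk (hmeasV n))).aestronglyMeasurable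
  · exact (hfc.tendsto _).comp
      ((hU.tendsto_approx ω).prodMk_nhds (hV.tendsto_approx ω))
  · exact (hfc.comp_stronglyMeasurable (((hmeasU n).comp_measurable measurable_fst).prodMk
      ((hmeasV n).comp_measurable measurable_snd))).aestronglyMeasurable
  · exact (hfc.tendsto _).comp
      ((hU.tendsto_approx p.1).prodMk_nhds (hV.tendsto_approx p.2))

end Decoupling

section LogSumExp

variable {ι : Type*} [Fintype ι]

/-- The logarithm of `1 + ∑ j, exp (z j)`, a smooth upper bound for the maximum of `0` and the
`z j`. -/
noncomputable def logSumExp (z : ι → ℝ) : ℝ := Real.log (1 + ∑ j, Real.exp (z j))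

theorem le_logSumExp (z : ι → ℝ) (j : ι) : z j ≤ logSumExp z := by
  rw [logSumExp, Real.le_log_iff_exp_le (by positivity)]
  exact (Finset.single_le_sum (fun i _ => (Real.exp_pos (z i)).le) (Finset.mem_univ j)).trans
    (le_add_of_nonneg_left zero_le_one)

theorem logSumExp_nonneg (z : ι → ℝ) : 0 ≤ logSumExp z :=
  Real.log_nonneg (le_add_of_nonneg_right (by positivity))

theorem logSumExp_zero : logSumExp (0 : ι → ℝ) = Real.log (1 + Fintype.card ι) := by
  simp [logSumExp]

theorem logSumExp_le (z : ι → ℝ) {c : ℝ} (hc : 0 ≤ c) (hz : ∀ j, z j ≤ c) :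
    logSumExp z ≤ Real.log (1 + Fintype.card ι) + c := by
  have one_le_exp : 1 ≤ Real.exp c := Real.one_le_exp hc
  have sum_le : ∑ j, Real.exp (z j) ≤ Fintype.card ι * Real.exp c := by
    simpa using Finset.sum_le_sum fun j (_ : j ∈ Finset.univ) => Real.exp_le_exp.2 (hz j)
  calc logSumExp z ≤ Real.log ((1 + Fintype.card ι) * Real.exp c) :=
        Real.log_le_log (by positivity) (by linarith)
    _ = _ := by rw [Real.log_mul (by positivity) (by positivity), Real.log_exp]

theorem continuous_logSumExp : Continuous (logSumExp : (ι → ℝ) → ℝ) :=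
  (by fun_prop : Continuous fun z : ι → ℝ => 1 + ∑ j, Real.exp (z j)).log fun _ => by positivity

theorem logSumExp_add_le (u v : ι → ℝ) :
    logSumExp (u + v) ≤
      logSumExp u + (∑ j, Real.exp (u j) * (Real.exp (v j) - 1)) / (1 + ∑ j, Real.exp (u j)) := by
  have hu : 0 < 1 + ∑ j, Real.exp (u j) := by positivity
  have huv : 0 < 1 + ∑ j, Real.exp ((u + v) j) := by positivity
  have tangent := Real.log_le_sub_one_of_pos (div_pos huv hu)
  rw [Real.log_div huv.ne' hu.ne', div_sub_one hu.ne'] at tangent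
  simp only [Pi.add_apply, Real.exp_add] at tangent
  rw [logSumExp, logSumExp]
  simp only [mul_sub, mul_one, Finset.sum_sub_distrib, Pi.add_apply, Real.exp_add]
  rw [add_sub_add_left_eq_sub] at tangent
  linarith

section Integral

variable {Ω : Type*} [MeasurableSpace Ω] {P : Measure Ω} [IsProbabilityMeasure P]
  {V : Ω → ι → ℝ}

omit [IsProbabilityMeasure P] in
theorem integrable_logSumExp_add (u : ι → ℝ)
    (hV : ∀ j, Integrable (fun ω => Real.exp (V ω j)) P) :
    Integrable (fun ω => logSumExp (u + V ω)) P := by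
  have integrable_sum : Integrable (fun ω => ∑ j, Real.exp ((u + V ω) j)) P := by
    simp only [Pi.add_apply, Real.exp_add]
    exact integrable_finsetSum _ fun j _ => (hV j).const_mul _
  refine integrable_sum.mono'
    (Real.measurable_log.comp_aemeasurable
      (integrable_sum.aemeasurable.const_add 1)).aestronglyMeasurable (.of_forall fun ω => ?_)
  rw [Real.norm_of_nonneg (logSumExp_nonneg _)]
  have : 0 < 1 + ∑ j, Real.exp ((u + V ω) j) := by positivity
  exact (Real.log_le_sub_one_of_pos this).trans_eq (add_sub_cancel_left _ _)

theorem integral_logSumExp_add_le (u : ι → ℝ)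
    (hV : ∀ j, Integrable (fun ω => Real.exp (V ω j)) P)
    (hV1 : ∀ j, ∫ ω, Real.exp (V ω j) ∂P ≤ 1) :
    ∫ ω, logSumExp (u + V ω) ∂P ≤ logSumExp u := by
  have integrable_summand : ∀ j,
      Integrable (fun ω => Real.exp (u j) * (Real.exp (V ω j) - 1)) P :=
    fun j => ((hV j).sub (integrable_const 1)).const_mul _
  have integrable_sum :=
    (integrable_finsetSum Finset.univ fun j _ => integrable_summand j).div_const
      (1 + ∑ j, Real.exp (u j))
  refine (integral_mono (integrable_logSumExp_add u hV) ((integrable_const _).add integrable_sum)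
    fun ω => logSumExp_add_le u (V ω)).trans ?_
  have : ∑ j, Real.exp (u j) * (∫ ω, Real.exp (V ω j) ∂P - 1) ≤ 0 :=
    Finset.sum_nonpos fun j _ => mul_nonpos_of_nonneg_of_nonpos (Real.exp_pos _).le
      (sub_nonpos.2 (hV1 j))
  simp_rw [Pi.add_apply]
  rw [integral_add (integrable_const _) integrable_sum, integral_div,
    integral_finsetSum _ fun j _ => integrable_summand j]
  simp only [integral_const_mul, integral_sub (hV _) (integrable_const (1 : ℝ)), integral_const,
    probReal_univ, one_smul]
  exact add_le_of_nonpos_right (div_nonpos_of_nonpos_of_nonneg this (by positivity))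

omit [IsProbabilityMeasure P] in
theorem integrable_logSumExp (hV : ∀ j, Integrable (fun ω => Real.exp (V ω j)) P) :
    Integrable (fun ω => logSumExp (V ω)) P := by
  simpa using integrable_logSumExp_add 0 hV

theorem integral_logSumExp_le (hV : ∀ j, Integrable (fun ω => Real.exp (V ω j)) P)
    (hV1 : ∀ j, ∫ ω, Real.exp (V ω j) ∂P ≤ 1) :
    ∫ ω, logSumExp (V ω) ∂P ≤ Real.log (1 + Fintype.card ι) := by
  simpa [logSumExp_zero] using integral_logSumExp_add_le 0 hV hV1

theorem integrable_exp_of_le {f : Ω → ℝ} (hf : Measurable f) {c : ℝ} (hfc : ∀ ω, f ω ≤ c) :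
    Integrable (fun ω => Real.exp (f ω)) P :=
  .of_bound hf.exp.aestronglyMeasurable (Real.exp c) (.of_forall fun ω => by
    rw [Real.norm_of_nonneg (Real.exp_pos _).le]
    exact Real.exp_le_exp.2 (hfc ω))

end Integral

section Mixing

variable {Ω : Type*} {𝒜 ℬ : MeasurableSpace Ω} [mΩ : MeasurableSpace Ω]

theorem integral_logSumExp_add_le_of_betaCoeff (P : Measure Ω) [IsProbabilityMeasure P]
    (h𝒜 : 𝒜 ≤ mΩ) (hℬ : ℬ ≤ mΩ) {U V : Ω → ι → ℝ} (hU : Measurable[𝒜] U) (hV : Measurable[ℬ] V)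
    {a b : ℝ} (ha : 0 ≤ a) (hb : 0 ≤ b) (hUa : ∀ ω j, U ω j ≤ a) (hVb : ∀ ω j, V ω j ≤ b)
    (hV1 : ∀ j, ∫ ω, Real.exp (V ω j) ∂P ≤ 1) :
    ∫ ω, logSumExp (U ω + V ω) ∂P ≤ ∫ ω, logSumExp (U ω) ∂P +
      (Real.log (1 + Fintype.card ι) + (a + b)) * (2 * betaCoeff P 𝒜 ℬ) := by
  set M := Real.log (1 + Fintype.card ι) + (a + b)
  have hU' := hU.mono h𝒜 le_rfl
  have hV' := hV.mono hℬ le_rfl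
  have le_M : ∀ ω ω', logSumExp (U ω + V ω') ≤ M := fun ω ω' =>
    logSumExp_le _ (add_nonneg ha hb) fun j => add_le_add (hUa ω j) (hVb ω' j)
  have hM : 0 ≤ M := add_nonneg (Real.log_nonneg (by simp)) (add_nonneg ha hb)
  have integrable_expV : ∀ j, Integrable (fun ω => Real.exp (V ω j)) P := fun j =>
    integrable_exp_of_le (hV'.eval (a := j)) fun ω => hVb ω j
  have integrable_U : Integrable (fun ω => logSumExp (U ω)) P :=
    integrable_logSumExp fun j => integrable_exp_of_le (hU'.eval (a := j)) fun ω => hUa ω j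
  have decoupled := integral_le_integral_prod_add_betaCoeff P h𝒜 hℬ hU.stronglyMeasurable
    hV.stronglyMeasurable (f := fun z => min (logSumExp (z.1 + z.2)) M)
    ((continuous_logSumExp.comp continuous_add).min continuous_const) hM fun z => by
      rw [abs_of_nonneg (le_min (logSumExp_nonneg _) hM)]
      exact min_le_right _ _
  simp only [min_eq_left (le_M _ _)] at decoupled
  refine decoupled.trans (add_le_add_left ?_ _)
  have integrable_prod : Integrable (fun p : Ω × Ω => logSumExp (U p.1 + V p.2)) (P.prod P) :=
    integrable_logSumExp fun j => integrable_exp_of_le (c := a + b)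
      (((hU'.eval (a := j)).comp measurable_fst).add ((hV'.eval (a := j)).comp measurable_snd))
      fun p => add_le_add (hUa p.1 j) (hVb p.2 j)
  rw [integral_prod _ integrable_prod]
  exact integral_mono integrable_prod.integral_prod_left integrable_U fun ω =>
    integral_logSumExp_add_le (U ω) integrable_expV hV1

theorem integral_logSumExp_sum_le_of_betaCoeff (P : Measure Ω) [IsProbabilityMeasure P]
    {𝓑 : ℕ → MeasurableSpace Ω} (h𝓑 : ∀ k, 𝓑 k ≤ mΩ) {g : ℕ → Ω → ι → ℝ} {n : ℕ} {β : ℝ}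
    (hβ0 : 0 ≤ β) (hβ : ∀ i < n, betaCoeff P (⨆ k ∈ Set.Iio i, 𝓑 k) (𝓑 i) ≤ β)
    (hg : ∀ k, Measurable[𝓑 k] (g k)) (hg1 : ∀ k ω j, g k ω j ≤ 1)
    (hexp : ∀ k j, ∫ ω, Real.exp (g k ω j) ∂P ≤ 1) :
    ∫ ω, logSumExp (∑ k ∈ Finset.range n, g k ω) ∂P ≤ Real.log (1 + Fintype.card ι) +
      n * ((Real.log (1 + Fintype.card ι) + n) * (2 * β)) := by
  set ℓ := Real.log (1 + Fintype.card ι)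
  suffices ∀ i ≤ n, ∫ ω, logSumExp (∑ k ∈ Finset.range i, g k ω) ∂P ≤
      ℓ + i * ((ℓ + n) * (2 * β)) from this n le_rfl
  intro i hi
  induction i with
  | zero => simp [logSumExp_zero, ℓ]
  | succ i ih =>
    have past_measurable :
        Measurable[⨆ k ∈ Set.Iio i, 𝓑 k] fun ω => ∑ k ∈ Finset.range i, g k ω :=
      Finset.measurable_fun_sum _ fun k hk => (hg k).mono
        (le_biSup 𝓑 (Set.mem_Iio.2 (Finset.mem_range.1 hk))) le_rfl
    have past_le_i : ∀ ω j, (∑ k ∈ Finset.range i, g k ω) j ≤ i := fun ω j => by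
      rw [Finset.sum_apply]
      simpa using Finset.sum_le_sum fun k (_ : k ∈ Finset.range i) => hg1 k ω j
    have one_step := integral_logSumExp_add_le_of_betaCoeff P (iSup₂_le fun k _ => h𝓑 k) (h𝓑 i)
      past_measurable (hg i) i.cast_nonneg zero_le_one past_le_i (hg1 i)
      (hexp i)
    have hin : (i : ℝ) + 1 ≤ n := by exact_mod_cast hi
    simp only [Finset.sum_range_succ]
    have : 0 ≤ ℓ := Real.log_nonneg (by simp)
    calc _ ≤ _ := one_step
      _ ≤ ℓ + i * ((ℓ + n) * (2 * β)) + (ℓ + (i + 1)) * (2 * β) := by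
        gcongr
        exacts [ih (by omega), hβ i hi]
      _ ≤ ℓ + i * ((ℓ + n) * (2 * β)) + (ℓ + n) * (2 * β) := by gcongr
      _ = _ := by push_cast; ring

end Mixing

end LogSumExp

section TimeBlocks

/-- The times `1, …, T` are cut into consecutive blocks of length `b`, which are numbered from `0`;
`timeBlock T b p i` is the block with number `2 * i + p`, so that `p = 0` and `p = 1` give the even
and the odd blocks. -/
def timeBlock (T b p i : ℕ) : Finset ℕ :=
  (Finset.Icc 1 T).filter fun t => (t - 1) / b = 2 * i + p

theorem mem_timeBlock {T b p i t : ℕ} (hb : 1 ≤ b) :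
    t ∈ timeBlock T b p i ↔
      t ≤ T ∧ (2 * i + p) * b + 1 ≤ t ∧ t ≤ (2 * i + p) * b + b := by
  simp only [timeBlock, Finset.mem_filter, Finset.mem_Icc]
  constructor
  · rintro ⟨⟨h1, h2⟩, h3⟩
    rw [Nat.div_eq_iff (by omega)] at h3
    refine ⟨h2, ?_, ?_⟩ <;> omega
  · rintro ⟨h1, h2, h3⟩
    refine ⟨⟨by omega, h1⟩, ?_⟩
    rw [Nat.div_eq_iff (by omega)]
    omega

theorem timeBlock_subset (T b p i : ℕ) : timeBlock T b p i ⊆ Finset.Icc 1 T :=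
  Finset.filter_subset _ _

theorem card_timeBlock_le {T b p i : ℕ} (hb : 1 ≤ b) : (timeBlock T b p i).card ≤ b := by
  calc (timeBlock T b p i).card
      ≤ (Finset.Icc ((2 * i + p) * b + 1) ((2 * i + p) * b + b)).card :=
        Finset.card_le_card fun t ht => Finset.mem_Icc.2 ((mem_timeBlock hb).1 ht).2
    _ = b := by rw [Nat.card_Icc]; omega

theorem sum_range_two_mul {E : Type*} [AddCommMonoid E] (g : ℕ → E) (n : ℕ) :
    ∑ k ∈ Finset.range (2 * n), g k =
      ∑ i ∈ Finset.range n, g (2 * i) + ∑ i ∈ Finset.range n, g (2 * i + 1) := by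
  induction n with
  | zero => simp
  | succ n ih =>
    rw [mul_add, mul_one, Finset.sum_range_succ, Finset.sum_range_succ, ih,
      Finset.sum_range_succ, Finset.sum_range_succ]
    abel

theorem sum_Icc_eq_sum_timeBlock {E : Type*} [AddCommMonoid E] (T b : ℕ) (f : ℕ → E) :
    ∑ t ∈ Finset.Icc 1 T, f t = ∑ i ∈ Finset.range T, ∑ t ∈ timeBlock T b 0 i, f t +
      ∑ i ∈ Finset.range T, ∑ t ∈ timeBlock T b 1 i, f t := by
  rw [← Finset.sum_fiberwise_of_maps_to (t := Finset.range (2 * T)) (g := fun t => (t - 1) / b),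
    sum_range_two_mul]
  · rfl
  · intro t ht
    rw [Finset.mem_Icc] at ht
    rw [Finset.mem_range]
    have := Nat.div_le_self (t - 1) b
    omega

end TimeBlocks

section BetaMixing

variable {Ω : Type*} [mΩ : MeasurableSpace Ω] {α : Type*} [MeasurableSpace α] (P : Measure Ω)
  {X : ℕ → Ω → α} {T b : ℕ} {β : ℝ}

theorem sigmaBetween_le {a c : ℕ} (hX : ∀ t ∈ Set.Icc a c, Measurable (X t)) :
    sigmaBetween X a c ≤ mΩ :=
  iSup₂_le fun t ht => (hX t ht).comap_le

theorem betaCoeff_le_betaMixing (X : ℕ → Ω → α) {t k : ℕ} (hk : 1 ≤ k) (hkt : k + t ≤ T) :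
    betaCoeff P (sigmaBetween X 1 k) (sigmaBetween X (k + t) T) ≤ betaMixing P T X t := by
  refine le_csSup (Set.Finite.bddAbove ?_) ⟨k, hk, hkt, rfl⟩
  refine ((Set.finite_Icc 1 T).image fun k =>
    betaCoeff P (sigmaBetween X 1 k) (sigmaBetween X (k + t) T)).subset ?_
  rintro _ ⟨k, h1, h2, rfl⟩
  exact ⟨k, ⟨h1, by omega⟩, rfl⟩

variable [IsProbabilityMeasure P]

/-- Two blocks of the same parity are separated by a block of length `b`. -/
theorem betaCoeff_timeBlock_le (hb : 1 ≤ b) (hX : ∀ t ∈ Set.Icc 1 T, Measurable (X t))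
    (hβ0 : 0 ≤ β) (hβ : betaMixing P T X (b + 1) ≤ β) (p i : ℕ) :
    betaCoeff P
      (⨆ k ∈ Set.Iio i, ⨆ t ∈ timeBlock T b p k, MeasurableSpace.comap (X t) inferInstance)
      (⨆ t ∈ timeBlock T b p i, MeasurableSpace.comap (X t) inferInstance) ≤ β := by
  rcases (timeBlock T b p i).eq_empty_or_nonempty with he | ⟨t₀, ht₀⟩
  · simpa [he] using (betaCoeff_nonpos_of_indep (indep_bot_right _)).trans hβ0
  rcases Nat.eq_zero_or_pos i with rfl | hi
  · simpa using (betaCoeff_nonpos_of_indep (indep_bot_left _)).trans hβ0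
  have ht₀_mem := (mem_timeBlock hb).1 ht₀
  obtain ⟨k, hk⟩ : ∃ k, k = (2 * i + p - 1) * b := ⟨_, rfl⟩
  have hkb : k + b = (2 * i + p) * b := by
    rw [hk, ← Nat.succ_mul]
    congr 1
    omega
  have hk1 : 1 ≤ k := hk ▸ Nat.one_le_iff_ne_zero.2 (Nat.mul_ne_zero (by omega) (by omega))
  refine (betaCoeff_mono P (iSup₂_le fun l hl => biSup_mono fun t ht => ?_)
    (biSup_mono fun t ht => ?_) (sigmaBetween_le fun t ht => hX t ⟨ht.1, ht.2.trans (by omega)⟩)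
    (sigmaBetween_le fun t ht => hX t ⟨le_trans (by omega) ht.1, ht.2⟩)).trans
    ((betaCoeff_le_betaMixing P X hk1 (by omega : k + (b + 1) ≤ T)).trans hβ)
  · have ht_mem := (mem_timeBlock hb).1 ht
    refine ⟨by omega, ht_mem.2.2.trans ?_⟩
    calc (2 * l + p) * b + b = (2 * l + p + 1) * b := by ring
      _ ≤ k := hk ▸ Nat.mul_le_mul_right b (by have := Set.mem_Iio.1 hl; omega)
  · have ht_mem := (mem_timeBlock hb).1 ht
    exact ⟨by omega, ht_mem.1⟩

end BetaMixing

section LowerTail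

theorem exp_neg_le_one_sub_mul {x y : ℝ} (hy : 0 ≤ y) (hyx : y ≤ x) :
    Real.exp (-y) ≤ 1 - (1 - x) * y := by
  calc Real.exp (-y) ≤ 1 / (1 + y) := by
        rw [Real.exp_neg, ← one_div]
        exact one_div_le_one_div_of_le (by linarith) (by linarith [Real.add_one_le_exp y])
    _ ≤ 1 - y + y * y := by
        rw [div_le_iff₀ (by linarith)]
        linarith [show 0 ≤ y * y * y by positivity]
    _ ≤ 1 - (1 - x) * y := by linarith [mul_le_mul_of_nonneg_right hyx hy]

variable {Ω : Type*} [mΩ : MeasurableSpace Ω] {ι : Type*} [Fintype ι] {x : ℝ}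

theorem integral_exp_mean_sub_le_one {P : Measure Ω} [IsProbabilityMeasure P] {Y : Ω → ℝ}
    (hY : Measurable Y) (hY0 : ∀ ω, 0 ≤ Y ω) (hYx : ∀ ω, Y ω ≤ x) :
    ∫ ω, Real.exp ((1 - x) * (∫ ω', Y ω' ∂P) - Y ω) ∂P ≤ 1 := by
  have integrable_Y : Integrable Y P := .of_bound hY.aestronglyMeasurable x
    (.of_forall fun ω => (Real.norm_of_nonneg (hY0 ω)).trans_le (hYx ω))
  set μ := ∫ ω, Y ω ∂P
  calc ∫ ω, Real.exp ((1 - x) * μ - Y ω) ∂P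
      = Real.exp ((1 - x) * μ) * ∫ ω, Real.exp (-Y ω) ∂P := by
        simp_rw [sub_eq_add_neg ((1 - x) * μ), Real.exp_add]
        exact integral_const_mul _ _
    _ ≤ Real.exp ((1 - x) * μ) * ∫ ω, (1 - (1 - x) * Y ω) ∂P :=
        mul_le_mul_of_nonneg_left (integral_mono
          (integrable_exp_of_le hY.neg fun ω => neg_nonpos.2 (hY0 ω))
          ((integrable_const 1).sub (integrable_Y.const_mul _))
          fun ω => exp_neg_le_one_sub_mul (hY0 ω) (hYx ω)) (Real.exp_pos _).le
    _ = Real.exp ((1 - x) * μ) * (-((1 - x) * μ) + 1) := by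
        rw [integral_sub (integrable_const 1) (integrable_Y.const_mul _), integral_const_mul]
        simp [μ, neg_add_eq_sub]
    _ ≤ Real.exp ((1 - x) * μ) * Real.exp (-((1 - x) * μ)) :=
        mul_le_mul_of_nonneg_left (Real.add_one_le_exp _) (Real.exp_pos _).le
    _ = 1 := by rw [← Real.exp_add, add_neg_cancel, Real.exp_zero]

theorem exists_integral_le_of_betaCoeff (P : Measure Ω) [IsProbabilityMeasure P]
    {𝓑 : ℕ → MeasurableSpace Ω} (h𝓑 : ∀ k, 𝓑 k ≤ mΩ) {Y : ℕ → Ω → ι → ℝ} {n : ℕ} {β : ℝ}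
    (hβ0 : 0 ≤ β) (hβ : ∀ i < n, betaCoeff P (⨆ k ∈ Set.Iio i, 𝓑 k) (𝓑 i) ≤ β)
    (hY : ∀ k, Measurable[𝓑 k] (Y k)) (hY0 : ∀ k ω j, 0 ≤ Y k ω j)
    (hYx : ∀ k ω j, Y k ω j ≤ x) :
    ∃ Z : Ω → ℝ, Integrable Z P ∧
      ∫ ω, Z ω ∂P ≤ Real.log (1 + Fintype.card ι) +
        n * ((Real.log (1 + Fintype.card ι) + n) * (2 * β)) ∧
      ∀ j ω, (1 - x) * ∑ k ∈ Finset.range n, ∫ ω', Y k ω' j ∂P -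
        ∑ k ∈ Finset.range n, Y k ω j ≤ Z ω := by
  have hY_eval : ∀ k j, Measurable fun ω => Y k ω j := fun k j =>
    ((hY k).mono (h𝓑 k) le_rfl).eval
  set g : ℕ → Ω → ι → ℝ := fun k ω j => (1 - x) * (∫ ω', Y k ω' j ∂P) - Y k ω j with hg
  have g_measurable : ∀ k, Measurable[𝓑 k] (g k) := fun k => by
    refine @measurable_pi_lambda _ _ _ (_) _ _ fun j => measurable_const.sub ?_
    exact (measurable_pi_apply j).comp (hY k)
  have g_le_one : ∀ k ω j, g k ω j ≤ 1 := fun k ω j => by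
    have mean_nonneg : 0 ≤ ∫ ω', Y k ω' j ∂P := integral_nonneg fun ω' => hY0 k ω' j
    have mean_le : ∫ ω', Y k ω' j ∂P ≤ x := by
      simpa using integral_mono_of_nonneg (.of_forall fun ω' => hY0 k ω' j)
        (integrable_const (μ := P) x) (.of_forall fun ω' => hYx k ω' j)
    simp only [hg]
    nlinarith [hY0 k ω j, mul_le_mul_of_nonneg_right mean_le mean_nonneg,
      sq_nonneg (∫ ω', Y k ω' j ∂P - 1)]
  have sum_g_measurable : Measurable fun ω => ∑ k ∈ Finset.range n, g k ω :=
    Finset.measurable_fun_sum _ fun k _ => (g_measurable k).mono (h𝓑 k) le_rfl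
  refine ⟨fun ω => logSumExp (∑ k ∈ Finset.range n, g k ω), integrable_logSumExp fun j =>
    integrable_exp_of_le (c := n) sum_g_measurable.eval fun ω => ?_,
    integral_logSumExp_sum_le_of_betaCoeff P h𝓑 hβ0 hβ g_measurable g_le_one fun k j =>
      integral_exp_mean_sub_le_one (hY_eval k j) (fun ω => hY0 k ω j) fun ω => hYx k ω j,
    fun j ω => le_of_eq_of_le ?_ (le_logSumExp _ j)⟩
  · rw [Finset.sum_apply]
    simpa using Finset.sum_le_sum fun k (_ : k ∈ Finset.range n) => g_le_one k ω j
  · rw [Finset.sum_apply, Finset.sum_sub_distrib, Finset.mul_sum]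

variable {α : Type*} [MeasurableSpace α]

/-- Scaling by `x / (M * b)` makes the sum over a block of length `b` lie between `0` and `x`. -/
theorem exists_integral_le_timeBlock (P : Measure Ω) [IsProbabilityMeasure P] {T b : ℕ}
    (hb : 1 ≤ b) {X : ℕ → Ω → α} (hX : ∀ t ∈ Set.Icc 1 T, Measurable (X t)) {β : ℝ}
    (hβ0 : 0 ≤ β) (hβ : betaMixing P T X (b + 1) ≤ β) {h : ι → α → ℝ}
    (hm : ∀ j, Measurable (h j)) (h0 : ∀ j a, 0 ≤ h j a) {M : ℝ} (hM : 0 < M)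
    (hhM : ∀ j a, h j a ≤ M) (hx : 0 < x) (p : ℕ) :
    ∃ Z : Ω → ℝ, Integrable Z P ∧
      ∫ ω, Z ω ∂P ≤ M * b / x * (Real.log (1 + Fintype.card ι) +
        T * ((Real.log (1 + Fintype.card ι) + T) * (2 * β))) ∧
      ∀ j ω, (1 - x) * ∑ i ∈ Finset.range T, ∑ t ∈ timeBlock T b p i, ∫ ω', h j (X t ω') ∂P ≤
        ∑ i ∈ Finset.range T, ∑ t ∈ timeBlock T b p i, h j (X t ω) + Z ω := by
  set r : ℝ := x / (M * b) with hr_def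
  have : (0 : ℝ) < b := by exact_mod_cast hb
  have hr : 0 < r := by positivity
  have hX_block : ∀ i, ∀ t ∈ timeBlock T b p i, Measurable (X t) := fun i t ht =>
    hX t (Finset.mem_Icc.1 (timeBlock_subset T b p i ht))
  have h_integrable : ∀ j i, ∀ t ∈ timeBlock T b p i, Integrable (fun ω => h j (X t ω)) P :=
    fun j i t ht => .of_bound ((hm j).comp (hX_block i t ht)).aestronglyMeasurable M
      (.of_forall fun ω => (Real.norm_of_nonneg (h0 j _)).trans_le (hhM j _))
  have block_measurable : ∀ k, Measurable[⨆ t ∈ timeBlock T b p k,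
      MeasurableSpace.comap (X t) inferInstance]
      fun ω j => r * ∑ t ∈ timeBlock T b p k, h j (X t ω) := fun k => by
    refine @measurable_pi_lambda _ _ _ (_) _ _ fun j => measurable_const.mul ?_
    exact Finset.measurable_fun_sum _ fun t ht => (hm j).comp ((comap_measurable (X t)).mono
      (le_biSup (fun t => MeasurableSpace.comap (X t) _) ht) le_rfl)
  have block_le : ∀ k ω j, r * ∑ t ∈ timeBlock T b p k, h j (X t ω) ≤ x := fun k ω j => by
    calc r * ∑ t ∈ timeBlock T b p k, h j (X t ω)
        ≤ r * ((timeBlock T b p k).card * M) := by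
          gcongr
          exact (Finset.sum_le_card_nsmul _ _ _ fun t _ => hhM j _).trans_eq (nsmul_eq_mul _ _)
      _ ≤ r * (b * M) := by gcongr; exact card_timeBlock_le hb
      _ = x := by rw [hr_def]; field_simp
  obtain ⟨Z, hZ, hZ_le, le_Z⟩ := exists_integral_le_of_betaCoeff P (n := T)
    (fun k => iSup₂_le fun t ht => (hX_block k t ht).comap_le) hβ0
    (fun i _ => betaCoeff_timeBlock_le P hb hX hβ0 hβ p i) block_measurable
    (fun k ω j => mul_nonneg hr.le (Finset.sum_nonneg fun t _ => h0 j _)) block_le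
  refine ⟨fun ω => Z ω / r, hZ.div_const r, ?_, fun j ω => ?_⟩
  · rw [integral_div, div_eq_inv_mul, hr_def, inv_div]
    exact mul_le_mul_of_nonneg_left hZ_le (by positivity)
  · have scaled := le_Z j ω
    simp only [integral_const_mul, integral_finsetSum _ (h_integrable j _),
      ← Finset.mul_sum] at scaled
    rw [← sub_le_iff_le_add', le_div_iff₀ hr]
    linarith

theorem exists_integral_le_of_betaMixing (P : Measure Ω) [IsProbabilityMeasure P] {T b : ℕ}
    (hb : 1 ≤ b) {X : ℕ → Ω → α} (hX : ∀ t ∈ Set.Icc 1 T, Measurable (X t)) {β : ℝ}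
    (hβ0 : 0 ≤ β) (hβ : betaMixing P T X (b + 1) ≤ β) {h : ι → α → ℝ}
    (hm : ∀ j, Measurable (h j)) (h0 : ∀ j a, 0 ≤ h j a) {M : ℝ} (hM : 0 < M)
    (hhM : ∀ j a, h j a ≤ M) (hx : 0 < x) :
    ∃ Z : Ω → ℝ, Integrable Z P ∧
      ∫ ω, Z ω ∂P ≤ 2 * (M * b / x) * (Real.log (1 + Fintype.card ι) +
        T * ((Real.log (1 + Fintype.card ι) + T) * (2 * β))) ∧
      ∀ j ω, (1 - x) * ∑ t ∈ Finset.Icc 1 T, ∫ ω', h j (X t ω') ∂P ≤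
        ∑ t ∈ Finset.Icc 1 T, h j (X t ω) + Z ω := by
  obtain ⟨Z₀, hZ₀, hZ₀_le, le_Z₀⟩ := exists_integral_le_timeBlock P hb hX hβ0 hβ hm h0 hM hhM hx 0
  obtain ⟨Z₁, hZ₁, hZ₁_le, le_Z₁⟩ := exists_integral_le_timeBlock P hb hX hβ0 hβ hm h0 hM hhM hx 1
  refine ⟨fun ω => Z₀ ω + Z₁ ω, hZ₀.add hZ₁, ?_, fun j ω => ?_⟩
  · rw [integral_add hZ₀ hZ₁]
    linarith
  · rw [sum_Icc_eq_sum_timeBlock T b, sum_Icc_eq_sum_timeBlock T b fun t => h j (X t ω)]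
    linarith [le_Z₀ j ω, le_Z₁ j ω]

end LowerTail

section SubGaussian

theorem exp_le_add_exp_sq (y : ℝ) : Real.exp y ≤ y + Real.exp (y ^ 2) := by
  have sq_bound := Real.add_one_le_exp (y ^ 2)
  rcases le_or_gt |y| 1 with small | large
  · linarith [(abs_le.1 (Real.abs_exp_sub_one_sub_id_le small)).2]
  rcases lt_abs.1 large with pos | neg
  · linarith [Real.exp_le_exp.2 (by nlinarith : y ≤ y ^ 2)]
  · nlinarith [Real.exp_le_one_iff.2 (by linarith : y ≤ 0)]

theorem sq_mul_sq_le_one {a κ : ℝ} (hκ : 0 ≤ κ) (ha : |a| * κ ≤ 1) : κ ^ 2 * a ^ 2 ≤ 1 := by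
  rw [← sq_abs a, ← mul_pow, mul_comm]
  exact pow_le_one₀ (by positivity) ha

theorem exp_mul_le_of_abs_mul_le_one {a κ : ℝ} (v : ℝ) (hκ : 0 < κ) (ha : |a| * κ ≤ 1) :
    Real.exp (a * v) ≤
      a * v + 1 + κ ^ 2 * a ^ 2 * (Real.exp (v ^ 2 / κ ^ 2) - 1) := by
  have convex := convexOn_exp.2 (Set.mem_univ (v ^ 2 / κ ^ 2)) (Set.mem_univ 0)
    (by positivity : 0 ≤ κ ^ 2 * a ^ 2) (sub_nonneg.2 (sq_mul_sq_le_one hκ.le ha))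
    (add_sub_cancel _ _)
  have : κ ^ 2 * a ^ 2 * (v ^ 2 / κ ^ 2) = (a * v) ^ 2 := by field_simp
  simp only [smul_eq_mul, mul_zero, add_zero, Real.exp_zero, mul_one, this] at convex
  linarith [exp_le_add_exp_sq (a * v)]

theorem abs_le_mul_exp_sq_div {κ : ℝ} (hκ : 0 < κ) (v : ℝ) :
    |v| ≤ κ * Real.exp (v ^ 2 / κ ^ 2) := by
  rw [← div_le_iff₀' hκ, ← sq_abs v, ← div_pow]
  nlinarith [sq_nonneg (|v| / κ - 1), sq_nonneg (|v| / κ), Real.add_one_le_exp ((|v| / κ) ^ 2)]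

variable {Ω : Type*} {m mΩ : MeasurableSpace Ω} {P : Measure Ω}

section CondExp

variable [IsFiniteMeasure P] (hm : m ≤ mΩ)

include hm

theorem trim_withDensity_le_smul_trim {φ : Ω → ℝ} (hφ0 : ∀ ω, 0 ≤ φ ω)
    (hφi : Integrable φ P) {c : ℝ} (hc : 0 ≤ c) (h : P[φ | m] ≤ᵐ[P] fun _ => c) :
    (P.withDensity fun ω => ENNReal.ofReal (φ ω)).trim hm ≤ ENNReal.ofReal c • P.trim hm := by
  refine Measure.le_iff.2 fun A hA => ?_
  rw [trim_measurableSet_eq hm hA, Measure.smul_apply, trim_measurableSet_eq hm hA,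
    withDensity_apply _ (hm A hA),
    ← ofReal_integral_eq_lintegral_ofReal hφi.integrableOn (ae_of_all _ hφ0),
    ← setIntegral_condExp hm hφi hA, smul_eq_mul, ← ofReal_measureReal, ← ENNReal.ofReal_mul hc]
  refine ENNReal.ofReal_le_ofReal ?_
  calc ∫ ω in A, (P[φ | m]) ω ∂P ≤ ∫ _ω in A, c ∂P :=
        integral_mono_ae integrable_condExp.integrableOn (integrable_const c)
          (ae_restrict_of_ae h)
    _ = c * P.real A := by rw [setIntegral_const, smul_eq_mul, mul_comm]

theorem lintegral_mul_le_of_condExp_le {φ : Ω → ℝ} (hφ : Measurable φ) (hφ0 : ∀ ω, 0 ≤ φ ω)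
    (hφi : Integrable φ P) {c : ℝ} (hc : 0 ≤ c) (h : P[φ | m] ≤ᵐ[P] fun _ => c)
    {u : Ω → ENNReal} (hu : Measurable[m] u) :
    ∫⁻ ω, ENNReal.ofReal (φ ω) * u ω ∂P ≤ ENNReal.ofReal c * ∫⁻ ω, u ω ∂P := by
  calc ∫⁻ ω, ENNReal.ofReal (φ ω) * u ω ∂P
      = ∫⁻ ω, u ω ∂(P.withDensity fun ω => ENNReal.ofReal (φ ω)) :=
        (lintegral_withDensity_eq_lintegral_mul _ hφ.ennreal_ofReal (hu.mono hm le_rfl)).symm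
    _ = ∫⁻ ω, u ω ∂((P.withDensity fun ω => ENNReal.ofReal (φ ω)).trim hm) :=
        (lintegral_trim hm hu).symm
    _ ≤ ∫⁻ ω, u ω ∂(ENNReal.ofReal c • P.trim hm) :=
        lintegral_mono' (trim_withDensity_le_smul_trim hm hφ0 hφi hc h) le_rfl
    _ = ENNReal.ofReal c * ∫⁻ ω, u ω ∂P := by
        rw [lintegral_smul_measure, lintegral_trim hm hu, smul_eq_mul]

theorem integrable_mul_of_condExp_le {φ : Ω → ℝ} (hφ : Measurable φ) (hφ0 : ∀ ω, 0 ≤ φ ω)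
    (hφi : Integrable φ P) {c : ℝ} (hc : 0 ≤ c) (h : P[φ | m] ≤ᵐ[P] fun _ => c)
    {u : Ω → ℝ} (hu : Measurable[m] u) (hu0 : ∀ ω, 0 ≤ u ω) (hui : Integrable u P) :
    Integrable (fun ω => u ω * φ ω) P ∧ ∫ ω, u ω * φ ω ∂P ≤ c * ∫ ω, u ω ∂P := by
  have prod_nonneg : ∀ ω, 0 ≤ u ω * φ ω := fun ω => mul_nonneg (hu0 ω) (hφ0 ω)
  have lintegral_le : ∫⁻ ω, ENNReal.ofReal (u ω * φ ω) ∂P ≤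
      ENNReal.ofReal (c * ∫ ω, u ω ∂P) := by
    rw [ENNReal.ofReal_mul hc, ofReal_integral_eq_lintegral_ofReal hui (ae_of_all _ hu0)]
    simpa only [mul_comm (u _), ENNReal.ofReal_mul (hφ0 _)] using
      lintegral_mul_le_of_condExp_le hm hφ hφ0 hφi hc h hu.ennreal_ofReal
  have integrable_prod : Integrable (fun ω => u ω * φ ω) P := by
    refine ⟨((hu.mono hm le_rfl).mul hφ).aestronglyMeasurable, ?_⟩
    rw [hasFiniteIntegral_iff_ofReal (ae_of_all _ prod_nonneg)]
    exact lintegral_le.trans_lt ENNReal.ofReal_lt_top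
  rw [← ofReal_integral_eq_lintegral_ofReal integrable_prod (ae_of_all _ prod_nonneg)]
    at lintegral_le
  exact ⟨integrable_prod,
    (ENNReal.ofReal_le_ofReal_iff (mul_nonneg hc (integral_nonneg hu0))).1 lintegral_le⟩

theorem integral_mul_eq_zero_of_condExp_eq_zero {u v : Ω → ℝ} (hu : Measurable[m] u)
    (huv : Integrable (fun ω => u ω * v ω) P) (hv : Integrable v P) (h : P[v | m] =ᵐ[P] 0) :
    ∫ ω, u ω * v ω ∂P = 0 := by
  rw [← integral_condExp hm]
  refine integral_eq_zero_of_ae ?_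
  filter_upwards [condExp_mul_of_stronglyMeasurable_left hu.stronglyMeasurable huv hv, h]
    with ω pull_out zero
  exact pull_out.trans (by rw [Pi.mul_apply, zero, Pi.zero_apply, mul_zero])

end CondExp

/-- Conditionally on `m`, the variable `v` is centred and sub-Gaussian with constant `κ`, in the
Orlicz form `E[exp (v² / κ²) | m] ≤ 2`. Integrability is a separate field because Mathlib's
conditional expectation of a non-integrable function is `0`. -/
structure IsCondSubGaussian (P : Measure[mΩ] Ω) (m : MeasurableSpace Ω) (v : Ω → ℝ) (κ : ℝ) :
    Prop where
  measurable : Measurable[mΩ] v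
  pos : 0 < κ
  centred : P[v | m] =ᵐ[P] 0
  integrable_exp_sq : Integrable (fun ω => Real.exp (v ω ^ 2 / κ ^ 2)) P
  condExp_exp_sq_le : P[fun ω => Real.exp (v ω ^ 2 / κ ^ 2) | m] ≤ᵐ[P] fun _ => 2

namespace IsCondSubGaussian

variable {v a w : Ω → ℝ} {κ : ℝ}

theorem integrable (h : IsCondSubGaussian P m v κ) : Integrable v P :=
  (h.integrable_exp_sq.const_mul κ).mono' h.measurable.aestronglyMeasurable
    (ae_of_all _ fun ω => abs_le_mul_exp_sq_div h.pos (v ω))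

variable [IsFiniteMeasure P]

theorem integrable_mul_exp_sq (h : IsCondSubGaussian P m v κ) (hm : m ≤ mΩ)
    (hw : Measurable[m] w) (hw0 : ∀ ω, 0 ≤ w ω) (hwi : Integrable w P) :
    Integrable (fun ω => w ω * Real.exp (v ω ^ 2 / κ ^ 2)) P ∧
      ∫ ω, w ω * Real.exp (v ω ^ 2 / κ ^ 2) ∂P ≤ 2 * ∫ ω, w ω ∂P :=
  integrable_mul_of_condExp_le hm ((h.measurable.pow_const 2).div_const _).exp
    (fun _ => (Real.exp_pos _).le) h.integrable_exp_sq zero_le_two h.condExp_exp_sq_le hw hw0 hwi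

theorem integrable_mul_mul (h : IsCondSubGaussian P m v κ) (hm : m ≤ mΩ) (hw : Measurable[m] w)
    (hw0 : ∀ ω, 0 ≤ w ω) (hwi : Integrable w P) (ha : Measurable[m] a) (haκ : ∀ ω, |a ω| * κ ≤ 1) :
    Integrable (fun ω => w ω * a ω * v ω) P := by
  refine (h.integrable_mul_exp_sq hm hw hw0 hwi).1.mono'
    (((hw.mul ha).mono hm le_rfl).mul h.measurable).aestronglyMeasurable (ae_of_all _ fun ω => ?_)
  have v_le := abs_le_mul_exp_sq_div h.pos (v ω)
  have w_nonneg := hw0 ω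
  rw [Real.norm_eq_abs, abs_mul, abs_mul, abs_of_nonneg w_nonneg]
  calc w ω * |a ω| * |v ω| ≤ w ω * |a ω| * (κ * Real.exp (v ω ^ 2 / κ ^ 2)) := by gcongr
    _ = |a ω| * κ * (w ω * Real.exp (v ω ^ 2 / κ ^ 2)) := by ring
    _ ≤ w ω * Real.exp (v ω ^ 2 / κ ^ 2) :=
        mul_le_of_le_one_left (mul_nonneg w_nonneg (Real.exp_pos _).le) (haκ ω)

theorem integral_mul_exp_mul_le (h : IsCondSubGaussian P m v κ) (hm : m ≤ mΩ)
    (hw : Measurable[m] w) (hw0 : ∀ ω, 0 ≤ w ω) (hwi : Integrable w P) (ha : Measurable[m] a)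
    (haκ : ∀ ω, |a ω| * κ ≤ 1) :
    Integrable (fun ω => w ω * Real.exp (a ω * v ω)) P ∧
      ∫ ω, w ω * Real.exp (a ω * v ω) ∂P ≤ ∫ ω, w ω * (κ ^ 2 * a ω ^ 2 + 1) ∂P := by
  set θ : Ω → ℝ := fun ω => w ω * (κ ^ 2 * a ω ^ 2)
  have θ_measurable : Measurable[m] θ := hw.mul ((ha.pow_const 2).const_mul _)
  have θ_nonneg : ∀ ω, 0 ≤ θ ω := fun ω => mul_nonneg (hw0 ω) (by positivity)
  have θ_integrable : Integrable θ P :=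
    hwi.mono' (θ_measurable.mono hm le_rfl).aestronglyMeasurable <| ae_of_all _ fun ω => by
      rw [Real.norm_of_nonneg (θ_nonneg ω)]
      exact mul_le_of_le_one_right (hw0 ω) (sq_mul_sq_le_one h.pos.le (haκ ω))
  have linear_integrable := h.integrable_mul_mul hm hw hw0 hwi ha haκ
  have linear_integral : ∫ ω, w ω * a ω * v ω ∂P = 0 :=
    integral_mul_eq_zero_of_condExp_eq_zero hm (hw.mul ha) linear_integrable h.integrable h.centred
  obtain ⟨quad_integrable, quad_integral⟩ :=
    h.integrable_mul_exp_sq hm θ_measurable θ_nonneg θ_integrable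
  have pointwise : ∀ ω, w ω * Real.exp (a ω * v ω) ≤
      w ω * a ω * v ω + w ω - θ ω + θ ω * Real.exp (v ω ^ 2 / κ ^ 2) := fun ω =>
    (mul_le_mul_of_nonneg_left (exp_mul_le_of_abs_mul_le_one (v ω) h.pos (haκ ω))
      (hw0 ω)).trans_eq (by ring)
  have bound_integrable := ((linear_integrable.add hwi).sub θ_integrable).add quad_integrable
  have exp_integrable : Integrable (fun ω => w ω * Real.exp (a ω * v ω)) P :=
    bound_integrable.mono' ((hw.mono hm le_rfl).mul
      ((ha.mono hm le_rfl).mul h.measurable).exp).aestronglyMeasurable <| ae_of_all _ fun ω => by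
        rw [Real.norm_of_nonneg (mul_nonneg (hw0 ω) (Real.exp_pos _).le)]
        exact pointwise ω
  refine ⟨exp_integrable, (integral_mono exp_integrable bound_integrable pointwise).trans ?_⟩
  simp only [mul_add_one]
  rw [integral_add' ((linear_integrable.add hwi).sub θ_integrable) quad_integrable,
    integral_sub' (linear_integrable.add hwi) θ_integrable, integral_add' linear_integrable hwi,
    integral_add θ_integrable hwi, linear_integral]
  linarith

theorem integral_mul_exp_sub_le (h : IsCondSubGaussian P m v κ) (hm : m ≤ mΩ)
    (hw : Measurable[m] w) (hw0 : ∀ ω, 0 ≤ w ω) (hwi : Integrable w P) (ha : Measurable[m] a)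
    (haκ : ∀ ω, |a ω| * κ ≤ 1) :
    Integrable (fun ω => w ω * Real.exp (a ω * v ω - κ ^ 2 * a ω ^ 2)) P ∧
      ∫ ω, w ω * Real.exp (a ω * v ω - κ ^ 2 * a ω ^ 2) ∂P ≤ ∫ ω, w ω ∂P := by
  set u : Ω → ℝ := fun ω => w ω * Real.exp (-(κ ^ 2 * a ω ^ 2)) with hu
  have u_measurable : Measurable[m] u :=
    hw.mul (Real.measurable_exp.comp ((ha.pow_const 2).const_mul _).neg)
  have u_nonneg : ∀ ω, 0 ≤ u ω := fun ω => mul_nonneg (hw0 ω) (Real.exp_pos _).le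
  have u_integrable : Integrable u P :=
    hwi.mono' (u_measurable.mono hm le_rfl).aestronglyMeasurable <| ae_of_all _ fun ω => by
      rw [Real.norm_of_nonneg (u_nonneg ω)]
      exact mul_le_of_le_one_right (hw0 ω) (Real.exp_le_one_iff.2 (neg_nonpos.2 (by positivity)))
  have compensate : ∀ ω, w ω * Real.exp (a ω * v ω - κ ^ 2 * a ω ^ 2) =
      u ω * Real.exp (a ω * v ω) := fun ω => by
    rw [sub_eq_neg_add, Real.exp_add, ← mul_assoc]
  simp only [compensate]
  refine (h.integral_mul_exp_mul_le hm u_measurable u_nonneg u_integrable ha haκ).imp_right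
    fun le => le.trans ?_
  refine integral_mono_of_nonneg (ae_of_all _ fun ω => mul_nonneg (u_nonneg ω) (by positivity))
    hwi (ae_of_all _ fun ω => ?_)
  calc u ω * (κ ^ 2 * a ω ^ 2 + 1) ≤ u ω * Real.exp (κ ^ 2 * a ω ^ 2) :=
        mul_le_mul_of_nonneg_left (Real.add_one_le_exp _) (u_nonneg ω)
    _ = w ω := by rw [hu, mul_assoc, ← Real.exp_add, neg_add_cancel, Real.exp_zero, mul_one]

end IsCondSubGaussian

section Martingale

variable [IsProbabilityMeasure P] (𝒢 : Filtration ℕ mΩ) {v : ℕ → Ω → ℝ} {κ : ℕ → ℝ} {n : ℕ}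

theorem integral_exp_sum_le_one_of_isCondSubGaussian {a : ℕ → Ω → ℝ}
    (h : ∀ t ∈ Set.Icc 1 n, IsCondSubGaussian P (𝒢 (t - 1)) (v t) (κ t))
    (hv : ∀ t ∈ Set.Icc 1 n, Measurable[𝒢 t] (v t))
    (ha : ∀ t ∈ Set.Icc 1 n, Measurable[𝒢 (t - 1)] (a t))
    (haκ : ∀ t ∈ Set.Icc 1 n, ∀ ω, |a t ω| * κ t ≤ 1) :
    Integrable (fun ω => Real.exp (∑ t ∈ Finset.Icc 1 n,
        (a t ω * v t ω - κ t ^ 2 * a t ω ^ 2))) P ∧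
      ∫ ω, Real.exp (∑ t ∈ Finset.Icc 1 n, (a t ω * v t ω - κ t ^ 2 * a t ω ^ 2)) ∂P ≤ 1 := by
  induction n with
  | zero => simp
  | succ n ih =>
    have extend : ∀ t ∈ Set.Icc 1 n, t ∈ Set.Icc 1 (n + 1) := fun t ht =>
      ⟨ht.1, ht.2.trans n.le_succ⟩
    have last : n + 1 ∈ Set.Icc 1 (n + 1) := ⟨n.succ_pos, le_rfl⟩
    obtain ⟨past_integrable, past_le⟩ := ih (fun t ht => h t (extend t ht))
      (fun t ht => hv t (extend t ht)) (fun t ht => ha t (extend t ht))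
      fun t ht => haκ t (extend t ht)
    have past_measurable : Measurable[𝒢 n] fun ω => Real.exp (∑ t ∈ Finset.Icc 1 n,
        (a t ω * v t ω - κ t ^ 2 * a t ω ^ 2)) := by
      refine Real.measurable_exp.comp (Finset.measurable_fun_sum _ fun t ht => ?_)
      have ht' := Finset.mem_Icc.1 ht
      have a_measurable : Measurable[𝒢 n] (a t) :=
        (ha t (extend t ht')).mono (𝒢.mono (by omega)) le_rfl
      have v_measurable : Measurable[𝒢 n] (v t) :=
        (hv t (extend t ht')).mono (𝒢.mono ht'.2) le_rfl
      exact (a_measurable.mul v_measurable).sub ((a_measurable.pow_const 2).const_mul _)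
    simp only [Finset.sum_Icc_succ_top n.succ_pos, Real.exp_add]
    exact ((h _ last).integral_mul_exp_sub_le (𝒢.le n) past_measurable
      (fun ω => (Real.exp_pos _).le) past_integrable (ha _ last) (haκ _ last)).imp_right
        fun le => le.trans past_le

theorem exists_integral_le_of_isCondSubGaussian {ι : Type*} [Fintype ι] {a : ι → ℕ → Ω → ℝ}
    (h : ∀ t ∈ Set.Icc 1 n, IsCondSubGaussian P (𝒢 (t - 1)) (v t) (κ t))
    (hv : ∀ t ∈ Set.Icc 1 n, Measurable[𝒢 t] (v t))
    (ha : ∀ j, ∀ t ∈ Set.Icc 1 n, Measurable[𝒢 (t - 1)] (a j t))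
    (haκ : ∀ j, ∀ t ∈ Set.Icc 1 n, ∀ ω, |a j t ω| * κ t ≤ 1) :
    ∃ Z : Ω → ℝ, Integrable Z P ∧ ∫ ω, Z ω ∂P ≤ Real.log (1 + Fintype.card ι) ∧
      ∀ j ω, ∑ t ∈ Finset.Icc 1 n, (a j t ω * v t ω - κ t ^ 2 * a j t ω ^ 2) ≤ Z ω := by
  have exp_sum := fun j => integral_exp_sum_le_one_of_isCondSubGaussian 𝒢 h hv (ha j) (haκ j)
  exact ⟨fun ω => logSumExp fun j =>
      ∑ t ∈ Finset.Icc 1 n, (a j t ω * v t ω - κ t ^ 2 * a j t ω ^ 2),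
    integrable_logSumExp fun j => (exp_sum j).1,
    integral_logSumExp_le (fun j => (exp_sum j).1) fun j => (exp_sum j).2,
    fun j ω => le_logSumExp
      (fun j => ∑ t ∈ Finset.Icc 1 n, (a j t ω * v t ω - κ t ^ 2 * a j t ω ^ 2)) j⟩

end Martingale

end SubGaussian

/-! ### Squares and martingale transforms along a path -/

section PathSums

variable {Ω E : Type*} {T : ℕ} {X : ℕ → Ω → E} {v : ℕ → Ω → ℝ} {M δ : ℝ}

/-- The sum of squares `∑_{t=1}^T g(X_t)²` along the path. Applied to `f - f₀` it is `T` times the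
in-sample squared error, and its mean over an independent path is `T` times the generalization
error. -/
noncomputable def sqSum (T : ℕ) (X : ℕ → Ω → E) (g : E → ℝ) (ω : Ω) : ℝ :=
  ∑ t ∈ Finset.Icc 1 T, g (X t ω) ^ 2

/-- The martingale transform `∑_{t=1}^T g(X_t) v_t` of the noise. -/
noncomputable def noiseSum (T : ℕ) (X : ℕ → Ω → E) (v : ℕ → Ω → ℝ) (g : E → ℝ) (ω : Ω) : ℝ :=
  ∑ t ∈ Finset.Icc 1 T, g (X t ω) * v t ω

theorem sqSum_nonneg (g : E → ℝ) (ω : Ω) : 0 ≤ sqSum T X g ω :=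
  Finset.sum_nonneg fun _ _ => sq_nonneg _

theorem sqSum_le_add {g h : E → ℝ} (hg : ∀ y, |g y| ≤ M) (hh : ∀ y, |h y| ≤ M)
    (hgh : ∀ y, |g y - h y| ≤ δ) (ω : Ω) : sqSum T X g ω ≤ sqSum T X h ω + T * (2 * M * δ) := by
  have hterm : ∀ y, g y ^ 2 ≤ h y ^ 2 + 2 * M * δ := fun y => by
    have hsum : |g y + h y| ≤ 2 * M := (abs_add_le _ _).trans (by linarith [hg y, hh y])
    have hprod : (g y + h y) * (g y - h y) ≤ 2 * M * δ := by
      refine (le_abs_self _).trans ((abs_mul _ _).trans_le ?_)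
      exact mul_le_mul hsum (hgh y) (abs_nonneg _) ((abs_nonneg _).trans hsum)
    linarith
  calc sqSum T X g ω ≤ ∑ t ∈ Finset.Icc 1 T, (h (X t ω) ^ 2 + 2 * M * δ) :=
        Finset.sum_le_sum fun t _ => hterm _
    _ = sqSum T X h ω + T * (2 * M * δ) := by simp [sqSum, Finset.sum_add_distrib]

theorem noiseSum_le_add {g h : E → ℝ} (hgh : ∀ y, |g y - h y| ≤ δ) (ω : Ω) :
    noiseSum T X v g ω ≤ noiseSum T X v h ω + δ * ∑ t ∈ Finset.Icc 1 T, |v t ω| := by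
  rw [Finset.mul_sum, noiseSum, noiseSum, ← Finset.sum_add_distrib]
  refine Finset.sum_le_sum fun t _ => ?_
  have : (g (X t ω) - h (X t ω)) * v t ω ≤ δ * |v t ω| :=
    (le_abs_self _).trans ((abs_mul _ _).trans_le (by gcongr; exact hgh _))
  linarith

section Integrals

variable [MeasurableSpace E] {mΩ : MeasurableSpace Ω} {P : Measure Ω} [IsFiniteMeasure P]
  {g : Ω → E → ℝ}

theorem integrable_sq_comp {Z : Ω → E} (hZ : Measurable Z)
    (hg : Measurable fun p : Ω × E => g p.1 p.2) (hgM : ∀ ω y, |g ω y| ≤ M) :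
    Integrable (fun ω => g ω (Z ω) ^ 2) P := by
  refine Integrable.of_bound ((hg.comp (measurable_id.prodMk hZ)).pow_const 2).aestronglyMeasurable
    (M ^ 2) (ae_of_all _ fun ω => ?_)
  rw [Real.norm_of_nonneg (sq_nonneg _), sq_le_sq]
  exact (hgM ω _).trans (le_abs_self M)

theorem integrable_sqSum (hX : ∀ t ∈ Set.Icc 1 T, Measurable (X t))
    (hg : Measurable fun p : Ω × E => g p.1 p.2) (hgM : ∀ ω y, |g ω y| ≤ M) :
    Integrable (fun ω => sqSum T X (g ω) ω) P :=
  integrable_finsetSum _ fun t ht => integrable_sq_comp (hX t (Finset.mem_Icc.1 ht)) hg hgM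

theorem integrable_sqSum_const {g : E → ℝ} (hX : ∀ t ∈ Set.Icc 1 T, Measurable (X t))
    (hg : Measurable g) (hgM : ∀ y, |g y| ≤ M) : Integrable (sqSum T X g) P :=
  integrable_sqSum (g := fun _ => g) hX (hg.comp measurable_snd) fun _ => hgM

theorem integral_sqSum {g : E → ℝ} (hX : ∀ t ∈ Set.Icc 1 T, Measurable (X t))
    (hg : Measurable g) (hgM : ∀ y, |g y| ≤ M) :
    ∫ ω, sqSum T X g ω ∂P = ∑ t ∈ Finset.Icc 1 T, ∫ ω, g (X t ω) ^ 2 ∂P :=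
  integral_finsetSum _ fun t ht => integrable_sq_comp (g := fun _ => g)
    (hX t (Finset.mem_Icc.1 ht)) (hg.comp measurable_snd) fun _ => hgM

theorem integrable_sqSum_prod (hX : ∀ t ∈ Set.Icc 1 T, Measurable (X t))
    (hg : Measurable fun p : Ω × E => g p.1 p.2) (hgM : ∀ ω y, |g ω y| ≤ M) :
    Integrable (fun p : Ω × Ω => sqSum T X (g p.1) p.2) (P.prod P) :=
  integrable_sqSum (X := fun t (p : Ω × Ω) => X t p.2) (g := fun p => g p.1)
    (fun t ht => (hX t ht).comp measurable_snd)
    (hg.comp ((measurable_fst.comp measurable_fst).prodMk measurable_snd)) fun p => hgM p.1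

omit [IsFiniteMeasure P] in
theorem integrable_noiseSum (hX : ∀ t ∈ Set.Icc 1 T, Measurable (X t))
    (hv : ∀ t ∈ Set.Icc 1 T, Integrable (v t) P)
    (hg : Measurable fun p : Ω × E => g p.1 p.2) (hgM : ∀ ω y, |g ω y| ≤ M) :
    Integrable (fun ω => noiseSum T X v (g ω) ω) P := by
  refine integrable_finsetSum _ fun t ht => ?_
  have ht' := Finset.mem_Icc.1 ht
  exact (hv t ht').bdd_mul
    (hg.comp (measurable_id.prodMk (hX t ht'))).aestronglyMeasurable
    (ae_of_all _ fun ω => hgM ω _)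

theorem integral_noiseSum_eq_zero {𝒢 : Filtration ℕ mΩ} {g : E → ℝ}
    (hX : ∀ t ∈ Set.Icc 1 T, Measurable[𝒢 (t - 1)] (X t))
    (hv : ∀ t ∈ Set.Icc 1 T, Integrable (v t) P)
    (hvc : ∀ t ∈ Set.Icc 1 T, P[v t | 𝒢 (t - 1)] =ᵐ[P] 0)
    (hg : Measurable g) (hgM : ∀ y, |g y| ≤ M) : ∫ ω, noiseSum T X v g ω ∂P = 0 := by
  have hint : ∀ t ∈ Finset.Icc 1 T, Integrable (fun ω => g (X t ω) * v t ω) P := fun t ht =>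
    have ht' := Finset.mem_Icc.1 ht
    (hv t ht').bdd_mul (hg.comp ((hX t ht').mono (𝒢.le _) le_rfl)).aestronglyMeasurable
      (ae_of_all _ fun ω => hgM _)
  refine (integral_finsetSum _ hint).trans (Finset.sum_eq_zero fun t ht => ?_)
  have ht' := Finset.mem_Icc.1 ht
  exact integral_mul_eq_zero_of_condExp_eq_zero (𝒢.le _) (hg.comp (hX t ht')) (hint t ht)
    (hv t ht') (hvc t ht')

end Integrals

end PathSums

/-- The noise `v_1, …, v_T` is adapted to `𝒢` and conditionally sub-Gaussian with constants at
most `K`. -/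
structure IsSubGaussianNoise {Ω : Type*} {mΩ : MeasurableSpace Ω} (P : Measure Ω)
    (𝒢 : Filtration ℕ mΩ) (T : ℕ) (v : ℕ → Ω → ℝ) (K : ℝ) : Prop where
  adapted : ∀ t ∈ Set.Icc 1 T, Measurable[𝒢 t] (v t)
  isCondSubGaussian : ∃ κ : ℕ → ℝ, ∀ t ∈ Set.Icc 1 T,
    κ t ≤ K ∧ IsCondSubGaussian P (𝒢 (t - 1)) (v t) (κ t)

section UniformBounds

variable {Ω E ι : Type*} {mΩ : MeasurableSpace Ω} {P : Measure Ω} [IsProbabilityMeasure P]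
  [MeasurableSpace E] [Fintype ι] {𝒢 : Filtration ℕ mΩ} {T : ℕ} {X : ℕ → Ω → E} {v : ℕ → Ω → ℝ}
  {K M δ : ℝ} {g : Ω → E → ℝ} {h : ι → E → ℝ}

namespace IsSubGaussianNoise

omit [IsProbabilityMeasure P] in
theorem centred (hv : IsSubGaussianNoise P 𝒢 T v K) {t : ℕ} (ht : t ∈ Set.Icc 1 T) :
    P[v t | 𝒢 (t - 1)] =ᵐ[P] 0 :=
  have ⟨_, hκ⟩ := hv.isCondSubGaussian
  (hκ t ht).2.centred

omit [IsProbabilityMeasure P] in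
theorem integrable (hv : IsSubGaussianNoise P 𝒢 T v K) {t : ℕ} (ht : t ∈ Set.Icc 1 T) :
    Integrable (v t) P :=
  have ⟨_, hκ⟩ := hv.isCondSubGaussian
  (hκ t ht).2.integrable

theorem integral_abs_le (hv : IsSubGaussianNoise P 𝒢 T v K) {t : ℕ} (ht : t ∈ Set.Icc 1 T) :
    ∫ ω, |v t ω| ∂P ≤ 2 * K := by
  obtain ⟨κ, hκ⟩ := hv.isCondSubGaussian
  obtain ⟨hκK, hsub⟩ := hκ t ht
  obtain ⟨hint, hle⟩ := hsub.integrable_mul_exp_sq (𝒢.le _) (w := fun _ => 1) measurable_const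
    (fun _ => zero_le_one) (integrable_const 1)
  calc ∫ ω, |v t ω| ∂P
      ≤ ∫ ω, κ t * (1 * Real.exp (v t ω ^ 2 / κ t ^ 2)) ∂P :=
        integral_mono hsub.integrable.abs (hint.const_mul _) fun ω => by
          simpa using abs_le_mul_exp_sq_div hsub.pos (v t ω)
    _ ≤ κ t * 2 := by
        rw [integral_const_mul]
        exact mul_le_mul_of_nonneg_left (by simpa using hle) hsub.pos.le
    _ ≤ 2 * K := by linarith

theorem integral_sum_abs_le (hv : IsSubGaussianNoise P 𝒢 T v K) :
    ∫ ω, ∑ t ∈ Finset.Icc 1 T, |v t ω| ∂P ≤ T * (2 * K) := by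
  rw [integral_finsetSum _ fun t ht => (hv.integrable (Finset.mem_Icc.1 ht)).abs]
  simpa using Finset.sum_le_card_nsmul _ _ _ fun t ht => hv.integral_abs_le (Finset.mem_Icc.1 ht)

theorem exists_integral_le (hv : IsSubGaussianNoise P 𝒢 T v K)
    (hX : ∀ t ∈ Set.Icc 1 T, Measurable[𝒢 (t - 1)] (X t)) (hh : ∀ j, Measurable (h j))
    (hhK : ∀ j y, |h j y| * K ≤ 1) :
    ∃ Z : Ω → ℝ, Integrable Z P ∧ ∫ ω, Z ω ∂P ≤ Real.log (1 + Fintype.card ι) ∧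
      ∀ j ω, noiseSum T X v (h j) ω ≤ K ^ 2 * sqSum T X (h j) ω + Z ω := by
  obtain ⟨κ, hκ⟩ := hv.isCondSubGaussian
  obtain ⟨Z, hZi, hZint, hZ⟩ := exists_integral_le_of_isCondSubGaussian 𝒢
    (a := fun j t ω => h j (X t ω)) (fun t ht => (hκ t ht).2) hv.adapted
    (fun j t ht => (hh j).comp (hX t ht))
    fun j t ht ω => (mul_le_mul_of_nonneg_left (hκ t ht).1 (abs_nonneg _)).trans (hhK j _)
  refine ⟨Z, hZi, hZint, fun j ω => ?_⟩
  rw [← sub_le_iff_le_add', noiseSum, sqSum, Finset.mul_sum, ← Finset.sum_sub_distrib]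
  refine (Finset.sum_le_sum fun t ht => ?_).trans (hZ j ω)
  have ⟨hκK, hsub⟩ := hκ t (Finset.mem_Icc.1 ht)
  have := pow_le_pow_left₀ hsub.pos.le hκK 2
  gcongr

theorem integral_noiseSum_le (hv : IsSubGaussianNoise P 𝒢 T v K) (hK : 0 ≤ K)
    (hX : ∀ t ∈ Set.Icc 1 T, Measurable[𝒢 (t - 1)] (X t))
    (hh : ∀ j, Measurable (h j)) (hhM : ∀ j y, |h j y| ≤ M)
    (hg : Measurable fun p : Ω × E => g p.1 p.2) (hgM : ∀ ω y, |g ω y| ≤ M)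
    (hgh : ∀ ω, ∃ j, ∀ y, |g ω y - h j y| ≤ δ) (hδ : 0 ≤ δ) (hMK : M * K ≤ 1) :
    ∫ ω, noiseSum T X v (g ω) ω ∂P ≤
      Real.log (1 + Fintype.card ι) + K ^ 2 * (∫ ω, sqSum T X (g ω) ω ∂P + T * (2 * M * δ)) +
        δ * (T * (2 * K)) := by
  have hX' : ∀ t ∈ Set.Icc 1 T, Measurable (X t) := fun t ht => (hX t ht).mono (𝒢.le _) le_rfl
  obtain ⟨Z, hZi, hZint, hZ⟩ := hv.exists_integral_le hX hh fun j y =>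
    (mul_le_mul_of_nonneg_right (hhM j y) hK).trans hMK
  have hpoint : ∀ ω, noiseSum T X v (g ω) ω ≤
      Z ω + K ^ 2 * (sqSum T X (g ω) ω + T * (2 * M * δ)) +
        δ * ∑ t ∈ Finset.Icc 1 T, |v t ω| := fun ω => by
    obtain ⟨j, hj⟩ := hgh ω
    have hnoise := noiseSum_le_add (T := T) (X := X) (v := v) hj ω
    have hsq : sqSum T X (h j) ω ≤ sqSum T X (g ω) ω + T * (2 * M * δ) :=
      sqSum_le_add (hhM j) (hgM ω) (fun y => abs_sub_comm (g ω y) _ ▸ hj y) ω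
    linarith [hZ j ω, mul_le_mul_of_nonneg_left hsq (sq_nonneg K)]
  have hvi : Integrable (fun ω => ∑ t ∈ Finset.Icc 1 T, |v t ω|) P :=
    integrable_finsetSum _ fun t ht => (hv.integrable (Finset.mem_Icc.1 ht)).abs
  have hsq : Integrable (fun ω => sqSum T X (g ω) ω + T * (2 * M * δ)) P :=
    (integrable_sqSum hX' hg hgM).add (integrable_const _)
  have hZsq : Integrable (fun ω => Z ω + K ^ 2 * (sqSum T X (g ω) ω + T * (2 * M * δ))) P :=
    hZi.add (hsq.const_mul _)
  calc ∫ ω, noiseSum T X v (g ω) ω ∂P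
      ≤ ∫ ω, (Z ω + K ^ 2 * (sqSum T X (g ω) ω + T * (2 * M * δ)) +
          δ * ∑ t ∈ Finset.Icc 1 T, |v t ω|) ∂P :=
        integral_mono (integrable_noiseSum hX' (fun t ht => hv.integrable ht) hg hgM)
          (hZsq.add (hvi.const_mul _)) hpoint
    _ = ∫ ω, Z ω ∂P + K ^ 2 * (∫ ω, sqSum T X (g ω) ω ∂P + T * (2 * M * δ)) +
          δ * ∫ ω, ∑ t ∈ Finset.Icc 1 T, |v t ω| ∂P := by
        rw [integral_add hZsq (hvi.const_mul _), integral_add hZi (hsq.const_mul _),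
          integral_const_mul, integral_const_mul,
          integral_add (integrable_sqSum hX' hg hgM) (integrable_const _)]
        simp
    _ ≤ _ := by
        gcongr
        exact hv.integral_sum_abs_le

theorem mul_integral_noiseSum_mul_le (hv : IsSubGaussianNoise P 𝒢 T v K) (hK : 0 ≤ K)
    (hX : ∀ t ∈ Set.Icc 1 T, Measurable[𝒢 (t - 1)] (X t))
    {e : E → ℝ} {C : ℝ} (he : Measurable e) (hC : 0 ≤ C) (heC : ∀ y, |e y| ≤ C)
    (hh : ∀ j, Measurable (h j)) (hhM : ∀ j y, |h j y| ≤ M)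
    (hg : Measurable fun p : Ω × E => g p.1 p.2) (hgM : ∀ ω y, |g ω y| ≤ M)
    (hgh : ∀ ω, ∃ j, ∀ y, |g ω y - h j y| ≤ δ) (hδ : 0 ≤ δ)
    {lam : ℝ} (hlam : 0 ≤ lam) (hlamK : lam * C * M * K ≤ 1) :
    lam * ∫ ω, noiseSum T X v (fun y => e y * g ω y) ω ∂P ≤
      Real.log (1 + Fintype.card ι) +
        K ^ 2 * (lam * C) ^ 2 * (∫ ω, sqSum T X (g ω) ω ∂P + T * (2 * M * δ)) +
        lam * C * δ * (T * (2 * K)) := by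
  have hscale : ∀ {y : E} {a c : ℝ}, |a| ≤ c → |lam * e y * a| ≤ lam * C * c := by
    intro y a c ha
    rw [abs_mul, abs_mul, abs_of_nonneg hlam]
    gcongr
    exact heC y
  have hg' : Measurable fun p : Ω × E => lam * e p.2 * g p.1 p.2 :=
    ((he.comp measurable_snd).const_mul lam).mul hg
  have hnoise := hv.integral_noiseSum_le hK hX (h := fun j y => lam * e y * h j y)
    (g := fun ω y => lam * e y * g ω y) (δ := lam * C * δ) (fun j => (he.const_mul lam).mul (hh j))
    (fun j y => hscale (hhM j y)) hg' (fun ω y => hscale (hgM ω y))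
    (fun ω => (hgh ω).imp fun j hj y => mul_sub (lam * e y) _ _ ▸ hscale (hj y))
    (by positivity) hlamK
  have hX' : ∀ t ∈ Set.Icc 1 T, Measurable (X t) := fun t ht => (hX t ht).mono (𝒢.le _) le_rfl
  have hsq : ∫ ω, sqSum T X (fun y => lam * e y * g ω y) ω ∂P ≤
      (lam * C) ^ 2 * ∫ ω, sqSum T X (g ω) ω ∂P := by
    rw [← integral_const_mul]
    refine integral_mono (integrable_sqSum hX' hg' fun ω y => hscale (hgM ω y))
      ((integrable_sqSum hX' hg hgM).const_mul _) fun ω => ?_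
    simp only [sqSum, Finset.mul_sum]
    gcongr with t
    rw [← mul_pow]
    refine sq_le_sq.2 ((hscale le_rfl).trans_eq ?_)
    rw [abs_mul _ (g ω _), abs_of_nonneg (mul_nonneg hlam hC)]
  have heq : ∫ ω, noiseSum T X v (fun y => lam * e y * g ω y) ω ∂P =
      lam * ∫ ω, noiseSum T X v (fun y => e y * g ω y) ω ∂P := by
    simp only [noiseSum, mul_assoc, ← Finset.mul_sum, integral_const_mul]
  rw [← heq]
  nlinarith [mul_le_mul_of_nonneg_left hsq (sq_nonneg K)]

end IsSubGaussianNoise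

theorem exists_integral_sqSum_le_of_betaMixing {b : ℕ} (hb : 1 ≤ b)
    (hX : ∀ t ∈ Set.Icc 1 T, Measurable (X t)) {β : ℝ} (hβ0 : 0 ≤ β)
    (hβ : betaMixing P T X (b + 1) ≤ β)
    (hh : ∀ j, Measurable (h j)) (hM : 0 < M) (hhM : ∀ j y, |h j y| ≤ M) {x : ℝ} (hx : 0 < x) :
    ∃ Z : Ω → ℝ, Integrable Z P ∧
      ∫ ω, Z ω ∂P ≤ 2 * (M ^ 2 * b / x) * (Real.log (1 + Fintype.card ι) +
        T * ((Real.log (1 + Fintype.card ι) + T) * (2 * β))) ∧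
      ∀ j ω, (1 - x) * ∫ ω', sqSum T X (h j) ω' ∂P ≤ sqSum T X (h j) ω + Z ω := by
  have ⟨Z, hZi, hZint, hZ⟩ := exists_integral_le_of_betaMixing P hb hX hβ0 hβ
    (fun j => (hh j).pow_const 2) (fun _ _ => sq_nonneg _) (pow_pos hM 2)
    (fun j y => sq_abs (h j y) ▸ pow_le_pow_left₀ (abs_nonneg _) (hhM j y) 2) hx
  exact ⟨Z, hZi, hZint, fun j ω => integral_sqSum (P := P) hX (hh j) (hhM j) ▸ hZ j ω⟩

theorem mul_integral_integral_sqSum_le {b : ℕ} (hb : 1 ≤ b)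
    (hX : ∀ t ∈ Set.Icc 1 T, Measurable (X t)) {β : ℝ} (hβ0 : 0 ≤ β)
    (hβ : betaMixing P T X (b + 1) ≤ β)
    (hh : ∀ j, Measurable (h j)) (hM : 0 < M) (hhM : ∀ j y, |h j y| ≤ M)
    (hg : Measurable fun p : Ω × E => g p.1 p.2) (hgM : ∀ ω y, |g ω y| ≤ M)
    (hgh : ∀ ω, ∃ j, ∀ y, |g ω y - h j y| ≤ δ) (hδ : 0 ≤ δ)
    {x : ℝ} (hx : 0 < x) (hx1 : x ≤ 1) :
    (1 - x) * ∫ ω, ∫ ω', sqSum T X (g ω) ω' ∂P ∂P ≤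
      ∫ ω, sqSum T X (g ω) ω ∂P +
        2 * (M ^ 2 * b / x) * (Real.log (1 + Fintype.card ι) +
          T * ((Real.log (1 + Fintype.card ι) + T) * (2 * β))) + 4 * T * M * δ := by
  obtain ⟨Z, hZi, hZint, hZ⟩ := exists_integral_sqSum_le_of_betaMixing hb hX hβ0 hβ hh hM hhM hx
  have hpoint : ∀ ω, (1 - x) * ∫ ω', sqSum T X (g ω) ω' ∂P ≤
      sqSum T X (g ω) ω + Z ω + 4 * T * M * δ := fun ω => by
    obtain ⟨j, hj⟩ := hgh ω
    have hhi : Integrable (sqSum T X (h j)) P := integrable_sqSum_const hX (hh j) (hhM j)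
    have hcopy : ∫ ω', sqSum T X (g ω) ω' ∂P ≤ ∫ ω', sqSum T X (h j) ω' ∂P + T * (2 * M * δ) := by
      calc _ ≤ ∫ ω', (sqSum T X (h j) ω' + T * (2 * M * δ)) ∂P :=
            integral_mono (integrable_sqSum_const hX hg.of_uncurry_left (hgM ω))
              (hhi.add (integrable_const _)) (sqSum_le_add (hgM ω) (hhM j) hj)
        _ = _ := by simp [integral_add hhi (integrable_const _)]
    have hsample : sqSum T X (h j) ω ≤ sqSum T X (g ω) ω + T * (2 * M * δ) :=
      sqSum_le_add (hhM j) (hgM ω) (fun y => abs_sub_comm (g ω y) _ ▸ hj y) ω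
    have hslack : 0 ≤ x * (T * (2 * M * δ)) := by positivity
    linarith [hZ j ω, mul_le_mul_of_nonneg_left hcopy (sub_nonneg.2 hx1)]
  have hsq : Integrable (fun ω => sqSum T X (g ω) ω + Z ω) P :=
    (integrable_sqSum hX hg hgM).add hZi
  calc _ = ∫ ω, (1 - x) * ∫ ω', sqSum T X (g ω) ω' ∂P ∂P := (integral_const_mul _ _).symm
    _ ≤ ∫ ω, (sqSum T X (g ω) ω + Z ω + 4 * T * M * δ) ∂P :=
        integral_mono ((integrable_sqSum_prod hX hg hgM).integral_prod_left.const_mul _)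
          (hsq.add (integrable_const _)) hpoint
    _ = ∫ ω, sqSum T X (g ω) ω ∂P + ∫ ω, Z ω ∂P + 4 * T * M * δ := by
        rw [integral_add hsq (integrable_const _), integral_add (integrable_sqSum hX hg hgM) hZi]
        simp
    _ ≤ _ := by gcongr

end UniformBounds

/-! ### The oracle inequality -/

/-- A measurable function that is bounded by `F` and vanishes off the unit cube, such as the
members of `sparseDNNClass` and the target `f₀ = m 1_{[0,1]^d}`. -/
structure IsCubeBounded {d : ℕ} (F : ℝ) (f : (Fin d → ℝ) → ℝ) : Prop where
  measurable : Measurable f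
  abs_le : ∀ x, |f x| ≤ F
  eq_zero_of_notMem : ∀ x ∉ unitCube d, f x = 0

theorem IsCubeBounded.indicator {d : ℕ} {F : ℝ} {f : (Fin d → ℝ) → ℝ} (hf : Measurable f)
    (hF : ∀ x ∈ unitCube d, |f x| ≤ F) : IsCubeBounded F ((unitCube d).indicator f) where
  measurable := hf.indicator measurableSet_Icc
  abs_le x := by
    by_cases hx : x ∈ unitCube d
    · simpa only [Set.indicator_of_mem hx] using hF x hx
    · simpa only [Set.indicator_of_notMem hx, abs_zero] using
        (abs_nonneg _).trans (hF 0 ⟨le_rfl, zero_le_one⟩)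
  eq_zero_of_notMem _ hx := Set.indicator_of_notMem hx _

theorem IsCubeBounded.nonneg {d : ℕ} {F : ℝ} {f : (Fin d → ℝ) → ℝ} (hf : IsCubeBounded F f) :
    0 ≤ F :=
  (abs_nonneg _).trans (hf.abs_le 0)

theorem IsCubeBounded.abs_sub_le {d : ℕ} {F : ℝ} {f g : (Fin d → ℝ) → ℝ} (hf : IsCubeBounded F f)
    (hg : IsCubeBounded F g) (x : Fin d → ℝ) : |f x - g x| ≤ 2 * F :=
  (abs_sub _ _).trans (by linarith [hf.abs_le x, hg.abs_le x])

theorem IsCubeBounded.mul_sub {d : ℕ} {C F : ℝ} {e f g : (Fin d → ℝ) → ℝ}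
    (he : IsCubeBounded C e) (hf : IsCubeBounded F f) (hg : IsCubeBounded F g) :
    IsCubeBounded (C * (2 * F)) fun x => e x * (f x - g x) where
  measurable := he.measurable.mul (hf.measurable.sub hg.measurable)
  abs_le x := by
    rw [abs_mul]
    exact mul_le_mul (he.abs_le x) (hf.abs_sub_le hg x) (abs_nonneg _) he.nonneg
  eq_zero_of_notMem x hx := by rw [he.eq_zero_of_notMem x hx, zero_mul]

namespace sparseDNNClass

variable {d : ℕ} {σ : ℝ → ℝ} {L N B F S : ℝ} {f : (Fin d → ℝ) → ℝ}

theorem isCubeBounded (hσ : Continuous σ) (hf : f ∈ sparseDNNClass d σ L N B F S) :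
    IsCubeBounded F f := by
  obtain ⟨g, -, -, -, -, -, hF, rfl⟩ := hf
  exact .indicator ((continuous_apply 0).comp (g.continuous_eval hσ)).measurable hF

theorem eq_zero_of_lt_one (hS : S < 1) (hf : f ∈ sparseDNNClass d σ L N B F S) : f = 0 := by
  obtain ⟨g, -, -, -, -, hg, -, rfl⟩ := hf
  have hsparsity : g.sparsity = 0 := Nat.lt_one_iff.1 (by exact_mod_cast hg.trans_lt hS)
  have htheta : ∀ a ∈ g.theta, a = 0 := by
    simpa [DNN.sparsity, List.length_eq_zero_iff, List.filter_eq_nil_iff] using hsparsity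
  ext x
  simp [DNN.eval_eq_zero htheta]

end sparseDNNClass

section Risk

variable {Ω : Type*} {d T : ℕ} {X : ℕ → Ω → (Fin d → ℝ)} {v Y : ℕ → Ω → ℝ}
  {m η : (Fin d → ℝ) → ℝ} {𝓕 : Set ((Fin d → ℝ) → ℝ)} {F δ : ℝ}

theorem bddBelow_empRisk (𝓕 : Set ((Fin d → ℝ) → ℝ)) (ω : Ω) :
    BddBelow (Set.range fun f : 𝓕 => empRisk T X Y f ω) :=
  ⟨0, by rintro _ ⟨f, rfl⟩; unfold empRisk; positivity⟩

theorem iInf_empRisk_le {f : (Fin d → ℝ) → ℝ} (hf : f ∈ 𝓕) (ω : Ω) :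
    ⨅ f : 𝓕, empRisk T X Y f ω ≤ empRisk T X Y f ω :=
  ciInf_le (bddBelow_empRisk 𝓕 ω) ⟨f, hf⟩

theorem mul_empRisk_sub_empRisk (hT : 0 < T)
    (hY : ∀ t ∈ Set.Icc 1 T, ∀ ω, Y t ω = m (X t ω) + η (X t ω) * v t ω)
    {f f' : (Fin d → ℝ) → ℝ} (hf : IsCubeBounded F f) (hf' : IsCubeBounded F f') (ω : Ω) :
    T * (empRisk T X Y f ω - empRisk T X Y f' ω) =
      sqSum T X (fun x => f x - (unitCube d).indicator m x) ω -
        sqSum T X (fun x => f' x - (unitCube d).indicator m x) ω -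
      2 * (noiseSum T X v
          (fun x => (unitCube d).indicator η x * (f x - (unitCube d).indicator m x)) ω -
        noiseSum T X v
          (fun x => (unitCube d).indicator η x * (f' x - (unitCube d).indicator m x)) ω) := by
  have hT' : (T : ℝ) ≠ 0 := by exact_mod_cast hT.ne'
  simp only [empRisk, sqSum, noiseSum]
  rw [← mul_sub, ← mul_assoc, mul_one_div_cancel hT', one_mul, ← Finset.sum_sub_distrib,
    ← Finset.sum_sub_distrib, ← Finset.sum_sub_distrib, Finset.mul_sum, ← Finset.sum_sub_distrib]
  refine Finset.sum_congr rfl fun t ht => ?_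
  rw [hY t (Finset.mem_Icc.1 ht)]
  by_cases hx : X t ω ∈ unitCube d
  · simp only [Set.indicator_of_mem hx]
    ring
  · simp [hf.eq_zero_of_notMem _ hx, hf'.eq_zero_of_notMem _ hx, Set.indicator_of_notMem hx]

theorem empRisk_le_add {f f' : (Fin d → ℝ) → ℝ} (hf : IsCubeBounded F f)
    (hf' : IsCubeBounded F f') (h : ∀ x, |f x - f' x| ≤ δ) (ω : Ω) :
    empRisk T X Y f ω ≤
      empRisk T X Y f' ω + δ * (1 / T * ∑ t ∈ Finset.Icc 1 T, (2 * |Y t ω| + 2 * F)) := by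
  rw [empRisk, empRisk, mul_left_comm, ← mul_add, Finset.mul_sum _ _ δ, ← Finset.sum_add_distrib]
  gcongr with t
  have hsum : |2 * Y t ω - f (X t ω) - f' (X t ω)| ≤ 2 * |Y t ω| + 2 * F := by
    have := abs_sub (2 * Y t ω - f (X t ω)) (f' (X t ω))
    have := abs_sub (2 * Y t ω) (f (X t ω))
    rw [abs_mul, abs_two] at this
    linarith [hf.abs_le (X t ω), hf'.abs_le (X t ω)]
  have hprod : (f' (X t ω) - f (X t ω)) * (2 * Y t ω - f (X t ω) - f' (X t ω)) ≤
      δ * (2 * |Y t ω| + 2 * F) := by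
    refine (le_abs_self _).trans ((abs_mul _ _).trans_le ?_)
    exact mul_le_mul (abs_sub_comm (f (X t ω)) _ ▸ h _) hsum (abs_nonneg _)
      ((abs_nonneg _).trans (h (X t ω)))
  linarith

theorem iInf_eq_iInf_of_forall_exists_le_add {α : Type*} {s t : Set α} {Q : α → ℝ} (hst : s ⊆ t)
    (ht : t.Nonempty) (hQ : BddBelow (Set.range fun a : t => Q a))
    (h : ∀ a ∈ t, ∀ ε > 0, ∃ a' ∈ s, Q a' ≤ Q a + ε) : ⨅ a : t, Q a = ⨅ a : s, Q a := by
  have : Nonempty t := ht.to_subtype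
  have : Nonempty s := have ⟨a, ha⟩ := ht; have ⟨a', ha', _⟩ := h a ha 1 one_pos; ⟨⟨a', ha'⟩⟩
  have hQs : BddBelow (Set.range fun a : s => Q a) :=
    hQ.mono (by rintro _ ⟨a, rfl⟩; exact ⟨⟨a, hst a.2⟩, rfl⟩)
  refine le_antisymm (le_ciInf fun a => ciInf_le hQ ⟨a, hst a.2⟩) (le_ciInf fun a => ?_)
  refine le_of_forall_pos_le_add fun ε hε => ?_
  obtain ⟨a', ha', hle⟩ := h a a.2 ε hε
  exact (ciInf_le hQs ⟨a', ha'⟩).trans hle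

theorem measurable_iInf_empRisk [MeasurableSpace Ω] (hX : ∀ t ∈ Set.Icc 1 T, Measurable (X t))
    (hY : ∀ t ∈ Set.Icc 1 T, Measurable (Y t)) (h𝓕 : ∀ f ∈ 𝓕, IsCubeBounded F f)
    (hne : 𝓕.Nonempty) (hnet : ∀ δ : ℝ, 0 < δ → ∃ A, IsSupNet δ 𝓕 A) :
    Measurable fun ω => ⨅ f : 𝓕, empRisk T X Y f ω := by
  choose A hA𝓕 hA using fun n : ℕ => hnet (1 / (n + 1)) (by positivity)
  have hsub : (⋃ n, (A n : Set _)) ⊆ 𝓕 := Set.iUnion_subset hA𝓕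
  have : Countable (⋃ n, (A n : Set ((Fin d → ℝ) → ℝ))) :=
    (Set.countable_iUnion fun n => (A n).countable_toSet).to_subtype
  have hF : 0 ≤ F := have ⟨f, hf⟩ := hne; (h𝓕 f hf).nonneg
  have hiInf : ∀ ω, ⨅ f : 𝓕, empRisk T X Y f ω =
      ⨅ f : (⋃ n, (A n : Set _) : Set ((Fin d → ℝ) → ℝ)), empRisk T X Y f ω := fun ω => by
    refine iInf_eq_iInf_of_forall_exists_le_add (Q := fun f => empRisk T X Y f ω) hsub hne
      (bddBelow_empRisk 𝓕 ω)
      fun f hf ε hε => ?_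
    set c := 1 / (T : ℝ) * ∑ t ∈ Finset.Icc 1 T, (2 * |Y t ω| + 2 * F)
    have : 0 ≤ c := by positivity
    obtain ⟨n, hn⟩ := exists_nat_one_div_lt (show 0 < ε / (c + 1) by positivity)
    obtain ⟨f', hf', hff'⟩ := hA n f hf
    refine ⟨f', Set.mem_iUnion.2 ⟨n, hf'⟩, (empRisk_le_add (h𝓕 f' (hA𝓕 n hf')) (h𝓕 f hf)
      (fun x => abs_sub_comm (f x) _ ▸ hff' x) ω).trans (add_le_add_right ?_ _)⟩
    calc 1 / ((n : ℝ) + 1) * c ≤ ε / (c + 1) * (c + 1) := by gcongr; linarith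
      _ = ε := div_mul_cancel₀ _ (by positivity)
  simp only [hiInf]
  refine Measurable.iInf fun f => (Finset.measurable_fun_sum _ fun t ht => ?_).const_mul _
  have ht' := Finset.mem_Icc.1 ht
  exact ((hY t ht').sub ((h𝓕 f (hsub f.2)).measurable.comp (hX t ht'))).pow_const 2

end Risk

/-- The model `Y_t = m(X_t) + η(X_t) v_t`, `1 ≤ t ≤ T`, with `|η| ≤ Cη` on `[0,1]^d`, predictable
regressors and adapted, conditionally sub-Gaussian noise: a `RegressionModel` without the
normalisation of the conditional variance and without mixing. -/
structure SubGaussianRegression {Ω : Type*} {mΩ : MeasurableSpace Ω} {d : ℕ} (P : Measure Ω)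
    (𝒢 : Filtration ℕ mΩ) (T : ℕ) (X : ℕ → Ω → (Fin d → ℝ)) (v Y : ℕ → Ω → ℝ)
    (m η : (Fin d → ℝ) → ℝ) (Cη K : ℝ) : Prop where
  measurable_m : Measurable m
  measurable_η : Measurable η
  η_le : ∀ x ∈ unitCube d, |η x| ≤ Cη
  model : ∀ t ∈ Set.Icc 1 T, ∀ ω, Y t ω = m (X t ω) + η (X t ω) * v t ω
  noise : IsSubGaussianNoise P 𝒢 T v K
  predictable : ∀ t ∈ Set.Icc 1 T, Measurable[𝒢 (t - 1)] (X t)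

section Risk

variable {Ω : Type*} {mΩ : MeasurableSpace Ω} {P : Measure Ω} [IsProbabilityMeasure P]
  {𝒢 : Filtration ℕ mΩ} {d T : ℕ} {X : ℕ → Ω → (Fin d → ℝ)} {v Y : ℕ → Ω → ℝ}
  {m η : (Fin d → ℝ) → ℝ} {Cη C₁ C₂ K F : ℝ} {𝓕 : Set ((Fin d → ℝ) → ℝ)}
  {fhat : Ω → (Fin d → ℝ) → ℝ} {f f₀ : (Fin d → ℝ) → ℝ}

omit [IsProbabilityMeasure P] in
theorem genError_nonneg (fhat : Ω → (Fin d → ℝ) → ℝ) (f₀ : (Fin d → ℝ) → ℝ) :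
    0 ≤ genError P T X fhat f₀ :=
  integral_nonneg fun _ => by positivity

omit [IsProbabilityMeasure P] in
theorem optGap_nonneg (h : ∀ ω, fhat ω ∈ 𝓕) : 0 ≤ optGap P T X Y 𝓕 fhat :=
  integral_nonneg fun ω => sub_nonneg.2 (iInf_empRisk_le (h ω) ω)

theorem mul_genError (hT : 0 < T) (hX : ∀ t ∈ Set.Icc 1 T, Measurable (X t))
    (hfm : Measurable fun p : Ω × (Fin d → ℝ) => fhat p.1 p.2)
    (hf : ∀ ω, IsCubeBounded F (fhat ω)) (hf₀ : IsCubeBounded F f₀) :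
    T * genError P T X fhat f₀ =
      ∫ ω, ∫ ω', sqSum T X (fun y => fhat ω y - f₀ y) ω' ∂P ∂P := by
  have hT' : (T : ℝ) ≠ 0 := by exact_mod_cast hT.ne'
  rw [genError, integral_const_mul, ← mul_assoc, mul_one_div_cancel hT', one_mul]
  exact integral_prod _ (integrable_sqSum_prod (g := fun ω y => fhat ω y - f₀ y) hX
    (hfm.sub (hf₀.measurable.comp measurable_snd)) fun ω => (hf ω).abs_sub_le hf₀)

theorem mul_genError_const (hT : 0 < T) (hX : ∀ t ∈ Set.Icc 1 T, Measurable (X t))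
    (hf : IsCubeBounded F f) (hf₀ : IsCubeBounded F f₀) :
    T * genError P T X (fun _ => f) f₀ = ∫ ω, sqSum T X (fun y => f y - f₀ y) ω ∂P := by
  rw [mul_genError hT hX (hf.measurable.comp measurable_snd) (fun _ => hf) hf₀]
  simp

omit [IsProbabilityMeasure P] in
theorem RegressionModel.subGaussianRegression
    (h : RegressionModel P 𝒢 T X v Y m η Cη C₁ C₂ K) :
    SubGaussianRegression P 𝒢 T X v Y m η Cη K where
  measurable_m := h.measurable_m
  measurable_η := h.measurable_η
  η_le := h.η_le
  model := h.model
  predictable := h.predictable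
  noise.adapted := h.adapted
  noise.isCondSubGaussian := by
    obtain ⟨κ, hκ⟩ := h.subGaussian
    refine ⟨κ, fun t ht => ?_⟩
    obtain ⟨hpos, hK, hint, hle⟩ := hκ t ht
    exact ⟨hK, (h.adapted t ht).mono (𝒢.le t) le_rfl, hpos, h.centred t ht, hint, hle⟩

namespace SubGaussianRegression

variable (h : SubGaussianRegression P 𝒢 T X v Y m η Cη K)
include h

omit [IsProbabilityMeasure P] in
theorem measurable_X (t : ℕ) (ht : t ∈ Set.Icc 1 T) : Measurable (X t) :=
  (h.predictable t ht).mono (𝒢.le _) le_rfl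

omit [IsProbabilityMeasure P] in
theorem measurable_Y (t : ℕ) (ht : t ∈ Set.Icc 1 T) : Measurable (Y t) := by
  rw [funext (h.model t ht)]
  exact (h.measurable_m.comp (h.measurable_X t ht)).add
    ((h.measurable_η.comp (h.measurable_X t ht)).mul ((h.noise.adapted t ht).mono (𝒢.le t) le_rfl))

omit [IsProbabilityMeasure P] in
theorem measurable_of_isEstimator (hest : IsEstimator T X Y fhat) :
    Measurable fun p : Ω × (Fin d → ℝ) => fhat p.1 p.2 := by
  have hdata : sigmaBetween (fun t ω => (Y t ω, X t ω)) 1 T ≤ mΩ :=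
    sigmaBetween_le fun t ht => (h.measurable_Y t ht).prodMk (h.measurable_X t ht)
  exact Measurable.mono hest (sup_le_sup (MeasurableSpace.comap_mono hdata) le_rfl) le_rfl

omit [IsProbabilityMeasure P] in
theorem isCubeBounded_η : IsCubeBounded Cη ((unitCube d).indicator η) :=
  .indicator h.measurable_η h.η_le

omit [IsProbabilityMeasure P] in
theorem isCubeBounded_m (hmF : ∀ x ∈ unitCube d, |m x| ≤ F) :
    IsCubeBounded F ((unitCube d).indicator m) :=
  .indicator h.measurable_m hmF

end SubGaussianRegression

end Risk

section Oracle

variable {Ω : Type*} {mΩ : MeasurableSpace Ω} {P : Measure Ω} [IsProbabilityMeasure P]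
  {𝒢 : Filtration ℕ mΩ} {d T : ℕ} {X : ℕ → Ω → (Fin d → ℝ)} {v Y : ℕ → Ω → ℝ}
  {m η : (Fin d → ℝ) → ℝ} {Cη K F : ℝ} {𝓕 : Set ((Fin d → ℝ) → ℝ)}
  {fhat : Ω → (Fin d → ℝ) → ℝ} {f : (Fin d → ℝ) → ℝ}

omit [IsProbabilityMeasure P] in
theorem IsSubGaussianNoise.nonneg (hv : IsSubGaussianNoise P 𝒢 T v K) (hT : 0 < T) : 0 ≤ K :=
  have ⟨_, hκ⟩ := hv.isCondSubGaussian
  have ⟨hκK, hκ₁⟩ := hκ 1 ⟨le_rfl, hT⟩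
  hκ₁.pos.le.trans hκK

theorem IsSupNet.exists_abs_sub_sub_le {α : Type*} {𝓕 : Set (α → ℝ)} {A : Finset (α → ℝ)}
    {δ : ℝ} (hA : IsSupNet δ 𝓕 A) {f : α → ℝ} (f₀ : α → ℝ) (hf : f ∈ 𝓕) :
    ∃ j : A, ∀ y, |f y - f₀ y - (j.1 y - f₀ y)| ≤ δ :=
  have ⟨f', hf', hle⟩ := hA.2 f hf
  ⟨⟨f', hf'⟩, fun y => by rw [sub_sub_sub_cancel_right]; exact hle y⟩

namespace SubGaussianRegression

variable (h : SubGaussianRegression P 𝒢 T X v Y m η Cη K)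
  (hmF : ∀ x ∈ unitCube d, |m x| ≤ F)
include h hmF

theorem integrable_sqSum_sub (h𝓕 : ∀ ω, IsCubeBounded F (fhat ω))
    (hfm : Measurable fun p : Ω × (Fin d → ℝ) => fhat p.1 p.2) :
    Integrable (fun ω => sqSum T X (fun y => fhat ω y - (unitCube d).indicator m y) ω) P :=
  integrable_sqSum (g := fun ω y => fhat ω y - (unitCube d).indicator m y) h.measurable_X
    (hfm.sub ((h.isCubeBounded_m hmF).measurable.comp measurable_snd))
    fun ω => (h𝓕 ω).abs_sub_le (h.isCubeBounded_m hmF)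

omit [IsProbabilityMeasure P] in
theorem integrable_noiseSum_mul_sub (h𝓕 : ∀ ω, IsCubeBounded F (fhat ω))
    (hfm : Measurable fun p : Ω × (Fin d → ℝ) => fhat p.1 p.2) :
    Integrable (fun ω => noiseSum T X v (fun y =>
      (unitCube d).indicator η y * (fhat ω y - (unitCube d).indicator m y)) ω) P :=
  integrable_noiseSum (g := fun ω y =>
      (unitCube d).indicator η y * (fhat ω y - (unitCube d).indicator m y)) h.measurable_X
    (fun _ => h.noise.integrable)
    ((h.isCubeBounded_η.measurable.comp measurable_snd).mul
      (hfm.sub ((h.isCubeBounded_m hmF).measurable.comp measurable_snd)))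
    fun ω => (h.isCubeBounded_η.mul_sub (h𝓕 ω) (h.isCubeBounded_m hmF)).abs_le

theorem integral_noiseSum_mul_sub_eq_zero (hf : IsCubeBounded F f) :
    ∫ ω, noiseSum T X v (fun y =>
      (unitCube d).indicator η y * (f y - (unitCube d).indicator m y)) ω ∂P = 0 :=
  have he := h.isCubeBounded_η.mul_sub hf (h.isCubeBounded_m hmF)
  integral_noiseSum_eq_zero h.predictable (fun _ => h.noise.integrable)
    (fun _ => h.noise.centred) he.measurable he.abs_le

variable (h𝓕 : ∀ f ∈ 𝓕, IsCubeBounded F f)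
include h𝓕

omit [IsProbabilityMeasure P] in
theorem mul_empRisk_sub_iInf_le (hT : 0 < T) (hf : f ∈ 𝓕) (ω : Ω) :
    T * (empRisk T X Y f ω - ⨅ f' : 𝓕, empRisk T X Y f' ω) ≤
      T * (2 * (2 * F) * (2 * F)) + 2 * (Cη * (2 * F) * ∑ t ∈ Finset.Icc 1 T, |v t ω|) := by
  set f₀ := (unitCube d).indicator m
  set e := (unitCube d).indicator η
  set D := T * (2 * (2 * F) * (2 * F)) + 2 * (Cη * (2 * F) * ∑ t ∈ Finset.Icc 1 T, |v t ω|)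
  have hT' : (0 : ℝ) < T := by exact_mod_cast hT
  have : Nonempty 𝓕 := ⟨⟨f, hf⟩⟩
  have hm := h.isCubeBounded_m hmF
  suffices hQ : ∀ f' : 𝓕, empRisk T X Y f ω - D / T ≤ empRisk T X Y f' ω by
    have := le_ciInf hQ
    rw [sub_le_comm, le_div_iff₀' hT'] at this
    exact this
  intro f'
  have hf' := h𝓕 f' f'.2
  rw [sub_le_comm, le_div_iff₀' hT', mul_empRisk_sub_empRisk hT h.model (h𝓕 f hf) hf']
  have hsq := sqSum_le_add (T := T) (X := X) ((h𝓕 f hf).abs_sub_le hm) (hf'.abs_sub_le hm)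
    (fun x => by rw [sub_sub_sub_cancel_right]; exact (h𝓕 f hf).abs_sub_le hf' x) ω
  have hnoise := noiseSum_le_add (T := T) (X := X) (v := v)
    (g := fun x => e x * (f'.1 x - f₀ x)) (h := fun x => e x * (f x - f₀ x)) (δ := Cη * (2 * F))
    (fun x => by
      rw [← mul_sub, sub_sub_sub_cancel_right, abs_mul]
      exact mul_le_mul (h.isCubeBounded_η.abs_le x) (hf'.abs_sub_le (h𝓕 f hf) x) (abs_nonneg _)
        h.isCubeBounded_η.nonneg) ω
  linarith

variable (hnet : ∀ δ : ℝ, 0 < δ → ∃ A, IsSupNet δ 𝓕 A)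
  (hfm : Measurable fun p : Ω × (Fin d → ℝ) => fhat p.1 p.2) (hfhat : ∀ ω, fhat ω ∈ 𝓕)
include hnet hfm hfhat

theorem integrable_empRisk_sub_iInf (hT : 0 < T) :
    Integrable (fun ω => empRisk T X Y (fhat ω) ω - ⨅ f : 𝓕, empRisk T X Y f ω) P := by
  have hT' : (0 : ℝ) < T := by exact_mod_cast hT
  have hne : 𝓕.Nonempty := have ⟨ω⟩ := P.nonempty_of_neZero; ⟨_, hfhat ω⟩
  have hmeas : Measurable fun ω => empRisk T X Y (fhat ω) ω :=
    (Finset.measurable_fun_sum _ fun t ht =>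
      ((h.measurable_Y t (Finset.mem_Icc.1 ht)).sub (hfm.comp (measurable_id.prodMk
        (h.measurable_X t (Finset.mem_Icc.1 ht))))).pow_const 2).const_mul _
  have hsum : Integrable (fun ω => ∑ t ∈ Finset.Icc 1 T, |v t ω|) P :=
    integrable_finsetSum _ fun t ht => (h.noise.integrable (Finset.mem_Icc.1 ht)).abs
  refine Integrable.mono' (((integrable_const (T * (2 * (2 * F) * (2 * F)))).add
    ((hsum.const_mul (Cη * (2 * F))).const_mul 2)).div_const (T : ℝ))
    (hmeas.sub (measurable_iInf_empRisk h.measurable_X h.measurable_Y h𝓕 hne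
      hnet)).aestronglyMeasurable (.of_forall fun ω => ?_)
  rw [Real.norm_of_nonneg (sub_nonneg.2 (iInf_empRisk_le (hfhat ω) ω)), le_div_iff₀' hT']
  exact h.mul_empRisk_sub_iInf_le hmF h𝓕 hT (hfhat ω) ω

theorem integral_sqSum_le (hT : 0 < T) (hf : f ∈ 𝓕) :
    ∫ ω, sqSum T X (fun y => fhat ω y - (unitCube d).indicator m y) ω ∂P ≤
      T * (optGap P T X Y 𝓕 fhat + genError P T X (fun _ => f) ((unitCube d).indicator m)) +
        2 * ∫ ω, noiseSum T X v (fun y =>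
          (unitCube d).indicator η y * (fhat ω y - (unitCube d).indicator m y)) ω ∂P := by
  set f₀ := (unitCube d).indicator m
  set e := (unitCube d).indicator η
  have hfc := h𝓕 f hf
  have hfm' : Measurable fun p : Ω × (Fin d → ℝ) => f p.2 := hfc.measurable.comp measurable_snd
  have hsq := h.integrable_sqSum_sub hmF (fun ω => h𝓕 _ (hfhat ω)) hfm
  have hsqf := h.integrable_sqSum_sub hmF (fun _ => hfc) hfm'
  have hnoise := h.integrable_noiseSum_mul_sub hmF (fun ω => h𝓕 _ (hfhat ω)) hfm
  have hnoisef := h.integrable_noiseSum_mul_sub hmF (fun _ => hfc) hfm'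
  have hgap := (h.integrable_empRisk_sub_iInf hmF h𝓕 hnet hfm hfhat hT).const_mul (T : ℝ)
  have hpt : ∀ ω, sqSum T X (fun y => fhat ω y - f₀ y) ω ≤
      T * (empRisk T X Y (fhat ω) ω - ⨅ f : 𝓕, empRisk T X Y f ω) +
        sqSum T X (fun y => f y - f₀ y) ω +
        2 * (noiseSum T X v (fun y => e y * (fhat ω y - f₀ y)) ω -
          noiseSum T X v (fun y => e y * (f y - f₀ y)) ω) := fun ω => by
    have hinf : (T : ℝ) * (empRisk T X Y (fhat ω) ω - empRisk T X Y f ω) ≤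
        T * (empRisk T X Y (fhat ω) ω - ⨅ f : 𝓕, empRisk T X Y f ω) := by
      gcongr
      exact iInf_empRisk_le hf ω
    linarith [mul_empRisk_sub_empRisk hT h.model (h𝓕 _ (hfhat ω)) hfc ω]
  have hdiff : Integrable (fun ω => noiseSum T X v (fun y => e y * (fhat ω y - f₀ y)) ω -
      noiseSum T X v (fun y => e y * (f y - f₀ y)) ω) P := hnoise.sub hnoisef
  refine (integral_mono hsq ((hgap.fun_add hsqf).fun_add (hdiff.const_mul 2)) hpt).trans_eq ?_
  rw [integral_add (hgap.fun_add hsqf) (hdiff.const_mul 2),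
    integral_add hgap hsqf, integral_const_mul, integral_const_mul, integral_sub hnoise hnoisef,
    h.integral_noiseSum_mul_sub_eq_zero hmF hfc,
    ← mul_genError_const hT h.measurable_X hfc (h.isCubeBounded_m hmF), optGap]
  ring

/-- The noise term of `integral_sqSum_le` is at most `x` times the left-hand side, up to the
price of the net, and is absorbed there. -/
theorem mul_integral_sqSum_le_of_isSupNet (hT : 0 < T) (hf : f ∈ 𝓕) {δ : ℝ} (hδ : 0 ≤ δ)
    {A : Finset ((Fin d → ℝ) → ℝ)} (hA : IsSupNet δ 𝓕 A) {x lam : ℝ} (hx1 : x ≤ 1)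
    (hlam : 0 < lam) (hlamx : 2 * lam * (K ^ 2 * Cη ^ 2) ≤ x)
    (hlamK : lam * Cη * (2 * F) * K ≤ 1) :
    (1 - x) * ∫ ω, sqSum T X (fun y => fhat ω y - (unitCube d).indicator m y) ω ∂P ≤
      T * (optGap P T X Y 𝓕 fhat + genError P T X (fun _ => f) ((unitCube d).indicator m)) +
        2 / lam * Real.log (1 + A.card) + (4 * F + 4 * Cη * K) * (T * δ) := by
  set f₀ := (unitCube d).indicator m
  have hm : IsCubeBounded F f₀ := h.isCubeBounded_m hmF
  have he := h.isCubeBounded_η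
  have hF := hm.nonneg
  have hbasic := h.integral_sqSum_le hmF h𝓕 hnet hfm hfhat hT hf
  have hnoise := h.noise.mul_integral_noiseSum_mul_le (h.noise.nonneg hT) h.predictable
    he.measurable he.nonneg he.abs_le
    (h := fun (j : A) y => j.1 y - f₀ y) (g := fun ω y => fhat ω y - f₀ y)
    (fun j => (h𝓕 j (hA.1 j.2)).measurable.sub hm.measurable)
    (fun j => (h𝓕 j (hA.1 j.2)).abs_sub_le hm) (hfm.sub (hm.measurable.comp measurable_snd))
    (fun ω => (h𝓕 _ (hfhat ω)).abs_sub_le hm) (fun ω => hA.exists_abs_sub_sub_le f₀ (hfhat ω))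
    hδ hlam.le hlamK
  rw [Fintype.card_coe] at hnoise
  set a := ∫ ω, sqSum T X (fun y => fhat ω y - f₀ y) ω ∂P
  set I := ∫ ω, noiseSum T X v (fun y => (unitCube d).indicator η y * (fhat ω y - f₀ y)) ω ∂P
  set ℓ := Real.log (1 + (A.card : ℝ))
  have ha : 0 ≤ a := integral_nonneg fun ω => sqSum_nonneg _ _
  have hI : 2 * I ≤ 2 / lam * ℓ + x * (a + 4 * F * (T * δ)) + 4 * Cη * K * (T * δ) := calc
    2 * I = 2 / lam * (lam * I) := by field_simp
    _ ≤ 2 / lam * (ℓ + K ^ 2 * (lam * Cη) ^ 2 * (a + T * (2 * (2 * F) * δ)) +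
        lam * Cη * δ * (T * (2 * K))) := by gcongr
    _ = 2 / lam * ℓ + 2 * lam * (K ^ 2 * Cη ^ 2) * (a + 4 * F * (T * δ)) +
        4 * Cη * K * (T * δ) := by field_simp; ring
    _ ≤ _ := by gcongr
  have hxδ : x * (4 * F * (T * δ)) ≤ 4 * F * (T * δ) := mul_le_of_le_one_left (by positivity) hx1
  linarith

theorem mul_genError_le_of_isSupNet (hT : 0 < T) (hF : 0 < F) (hf : f ∈ 𝓕) {δ : ℝ} (hδ : 0 ≤ δ)
    {A : Finset ((Fin d → ℝ) → ℝ)} (hA : IsSupNet δ 𝓕 A) {b : ℕ} (hb : 1 ≤ b) {β : ℝ}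
    (hβ0 : 0 ≤ β) (hβ : betaMixing P T X (b + 1) ≤ β) {x lam : ℝ} (hx : 0 < x) (hx1 : x ≤ 1)
    (hlam : 0 < lam) (hlamx : 2 * lam * (K ^ 2 * Cη ^ 2) ≤ x)
    (hlamK : lam * Cη * (2 * F) * K ≤ 1) :
    (1 - x) ^ 2 * (T * genError P T X fhat ((unitCube d).indicator m)) ≤
      T * (optGap P T X Y 𝓕 fhat + genError P T X (fun _ => f) ((unitCube d).indicator m)) +
        2 / lam * Real.log (1 + A.card) + (12 * F + 4 * Cη * K) * (T * δ) +
        2 * ((2 * F) ^ 2 * b / x) *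
          (Real.log (1 + A.card) + T * ((Real.log (1 + A.card) + T) * (2 * β))) := by
  set f₀ := (unitCube d).indicator m
  have hm : IsCubeBounded F f₀ := h.isCubeBounded_m hmF
  have hinSample := h.mul_integral_sqSum_le_of_isSupNet hmF h𝓕 hnet hfm hfhat hT hf hδ hA hx1
    hlam hlamx hlamK
  have hdecouple := mul_integral_integral_sqSum_le hb h.measurable_X hβ0 hβ
    (h := fun (j : A) y => j.1 y - f₀ y) (g := fun ω y => fhat ω y - f₀ y)
    (fun j => (h𝓕 j (hA.1 j.2)).measurable.sub hm.measurable) (by positivity : 0 < 2 * F)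
    (fun j => (h𝓕 j (hA.1 j.2)).abs_sub_le hm) (hfm.sub (hm.measurable.comp measurable_snd))
    (fun ω => (h𝓕 _ (hfhat ω)).abs_sub_le hm) (fun ω => hA.exists_abs_sub_sub_le f₀ (hfhat ω))
    hδ hx hx1
  rw [← mul_genError hT h.measurable_X hfm (fun ω => h𝓕 _ (hfhat ω)) hm,
    Fintype.card_coe] at hdecouple
  set a := ∫ ω, sqSum T X (fun y => fhat ω y - f₀ y) ω ∂P
  set R := genError P T X fhat f₀
  set mix := 2 * ((2 * F) ^ 2 * b / x) *
    (Real.log (1 + A.card) + T * ((Real.log (1 + A.card) + T) * (2 * β)))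
  have hlog : 0 ≤ Real.log (1 + (A.card : ℝ)) := Real.log_nonneg (by simp)
  have hrem : (1 - x) * (mix + 4 * T * (2 * F) * δ) ≤ mix + 4 * T * (2 * F) * δ :=
    mul_le_of_le_one_left (by positivity) (by linarith)
  calc (1 - x) ^ 2 * (T * R) = (1 - x) * ((1 - x) * (T * R)) := by ring
    _ ≤ (1 - x) * (a + mix + 4 * T * (2 * F) * δ) :=
      mul_le_mul_of_nonneg_left hdecouple (by linarith)
    _ ≤ _ := by linarith

end SubGaussianRegression

end Oracle

theorem exists_noise_scale (Cη K : ℝ) :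
    ∃ q : ℝ, 0 < q ∧ ∀ x F : ℝ, 0 < x → x ≤ 1 → 1 ≤ F →
      2 * (x / (q * F)) * (K ^ 2 * Cη ^ 2) ≤ x ∧ x / (q * F) * Cη * (2 * F) * K ≤ 1 := by
  refine ⟨2 * (K ^ 2 * Cη ^ 2) + 2 * |Cη * K| + 1, by positivity, fun x F hx hx1 hF => ?_⟩
  set q := 2 * (K ^ 2 * Cη ^ 2) + 2 * |Cη * K| + 1
  have hvar : 2 * (K ^ 2 * Cη ^ 2) ≤ q := by linarith [abs_nonneg (Cη * K)]
  have hexp : 2 * (Cη * K) ≤ q := by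
    linarith [le_abs_self (Cη * K), (by positivity : 0 ≤ K ^ 2 * Cη ^ 2)]
  have hq0 : 0 < q := by positivity
  constructor
  · calc 2 * (x / (q * F)) * (K ^ 2 * Cη ^ 2) = x / (q * F) * (2 * (K ^ 2 * Cη ^ 2)) := by ring
      _ ≤ x / (q * F) * (q * F) := by
        exact mul_le_mul_of_nonneg_left (hvar.trans (le_mul_of_one_le_right hq0.le hF))
          (by positivity)
      _ = x := div_mul_cancel₀ _ (by positivity)
  · calc x / (q * F) * Cη * (2 * F) * K = x / q * (2 * (Cη * K)) := by field_simp
      _ ≤ x / q * q := by gcongr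
      _ = x := div_mul_cancel₀ _ hq0.ne'
      _ ≤ 1 := hx1

theorem exists_block_length {C₂ T : ℝ} (C₁ : ℝ) (hC₂ : 0 < C₂) (hT : 0 < T)
    (hlog : 1 ≤ Real.log T) :
    ∃ b : ℕ, 1 ≤ b ∧ b ≤ (2 / C₂ + 1) * Real.log T ∧
      C₁ * Real.exp (-C₂ * (b + 1 : ℕ)) ≤ |C₁| / T ^ 2 := by
  have hpos : 0 < 2 * Real.log T / C₂ := by positivity
  refine ⟨⌈2 * Real.log T / C₂⌉₊, Nat.ceil_pos.2 hpos, ?_, ?_⟩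
  · calc (⌈2 * Real.log T / C₂⌉₊ : ℝ) ≤ 2 * Real.log T / C₂ + 1 :=
          (Nat.ceil_lt_add_one hpos.le).le
      _ ≤ 2 * Real.log T / C₂ + Real.log T := by gcongr
      _ = _ := by ring
  · have hceil := Nat.le_ceil (2 * Real.log T / C₂)
    rw [div_le_iff₀ hC₂] at hceil
    have hexp : Real.exp (-C₂ * (⌈2 * Real.log T / C₂⌉₊ + 1 : ℕ)) ≤ 1 / T ^ 2 := by
      rw [← Real.le_log_iff_exp_le (by positivity), one_div, Real.log_inv, Real.log_pow]
      push_cast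
      linarith
    calc _ ≤ |C₁| * (1 / T ^ 2) := by gcongr; exact le_abs_self _
      _ = _ := by ring

theorem mixing_remainder_le {x F ℓ C₀ Λ k c T lT : ℝ} {b : ℕ} (hx : 0 < x) (hT : 1 ≤ T)
    (hℓ0 : 0 ≤ ℓ) (hℓ : ℓ ≤ C₀ * Λ) (hΛ : 1 ≤ Λ) (hb : b ≤ k * lT) (hc : 0 ≤ c) :
    2 * ((2 * F) ^ 2 * b / x) * (ℓ + T * ((ℓ + T) * (2 * (c / T ^ 2)))) ≤
      8 * k / x * ((1 + 2 * c) * C₀ + 2 * c) * (F ^ 2 * (Λ * lT)) := by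
  have : 0 < T := by linarith
  have hlog : ℓ + T * ((ℓ + T) * (2 * (c / T ^ 2))) ≤ ((1 + 2 * c) * C₀ + 2 * c) * Λ := calc
    _ = ℓ + 2 * c * (ℓ / T) + 2 * c := by field_simp; ring
    _ ≤ ℓ + 2 * c * ℓ + 2 * c * Λ :=
      add_le_add (by gcongr; exact div_le_self hℓ0 hT) (le_mul_of_one_le_right (by positivity) hΛ)
    _ = (1 + 2 * c) * ℓ + 2 * c * Λ := by ring
    _ ≤ (1 + 2 * c) * (C₀ * Λ) + 2 * c * Λ := by gcongr
    _ = _ := by ring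
  calc _ ≤ 2 * ((2 * F) ^ 2 * b / x) * (((1 + 2 * c) * C₀ + 2 * c) * Λ) := by gcongr
    _ ≤ 2 * ((2 * F) ^ 2 * (k * lT) / x) * (((1 + 2 * c) * C₀ + 2 * c) * Λ) := by
      refine mul_le_mul_of_nonneg_right (by gcongr) (le_trans ?_ hlog)
      positivity
    _ = _ := by ring

theorem oracle_remainder_le {x q F ℓ C₀ Λ k c T lT Cη K : ℝ} {b : ℕ} (hx : 0 < x) (hq : 0 < q)
    (hF : 1 ≤ F) (hT : 1 ≤ T) (hC₀ : 0 ≤ C₀) (hℓ0 : 0 ≤ ℓ) (hℓ : ℓ ≤ C₀ * Λ) (hΛ : 1 ≤ Λ)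
    (hlT : 1 ≤ lT) (hb : b ≤ k * lT) (hc : 0 ≤ c) :
    2 / (x / (q * F)) * ℓ + (12 * F + 4 * Cη * K) * (T * T⁻¹) +
        2 * ((2 * F) ^ 2 * b / x) * (ℓ + T * ((ℓ + T) * (2 * (c / T ^ 2)))) ≤
      (2 * q * C₀ / x + 12 + 4 * |Cη * K| + 8 * k / x * ((1 + 2 * c) * C₀ + 2 * c)) *
        (F ^ 2 * (Λ * lT)) := by
  have hF2 : F ≤ F ^ 2 := le_self_pow₀ hF two_ne_zero
  have hF2' : F ^ 2 ≤ F ^ 2 * (Λ * lT) :=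
    le_mul_of_one_le_right (by positivity) (one_le_mul_of_one_le_of_one_le hΛ hlT)
  have hcover : 2 / (x / (q * F)) * ℓ ≤ 2 * q * C₀ / x * (F ^ 2 * (Λ * lT)) := calc
    _ = 2 * q / x * (F * ℓ) := by field_simp
    _ ≤ 2 * q / x * (F ^ 2 * (C₀ * (Λ * lT))) := by
      gcongr
      exact hℓ.trans (by gcongr; exact le_mul_of_one_le_right (by linarith) hlT)
    _ = _ := by ring
  have hnoise : 4 * Cη * K ≤ 4 * |Cη * K| * (F ^ 2 * (Λ * lT)) := calc
    4 * Cη * K ≤ 4 * |Cη * K| := by linarith [le_abs_self (Cη * K)]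
    _ ≤ _ := le_mul_of_one_le_right (by positivity) (by linarith)
  have hmix := mixing_remainder_le (F := F) hx hT hℓ0 hℓ hΛ hb hc
  rw [mul_inv_cancel₀ (by linarith)]
  linarith

theorem le_mul_add_ciInf_add {ι : Type*} [Nonempty ι] {ρ R G r : ℝ} {f : ι → ℝ} (hρ : 0 < ρ)
    (h : ∀ i, R ≤ ρ * (G + f i) + r) : R ≤ ρ * (G + ⨅ i, f i) + r := by
  have hinf : (R - r) / ρ - G ≤ ⨅ i, f i := le_ciInf fun i => by
    rw [sub_le_iff_le_add', div_le_iff₀' hρ]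
    linarith [h i]
  rw [sub_le_iff_le_add', div_le_iff₀' hρ] at hinf
  linarith

theorem le_mul_add_of_one_sub_sq_mul_le {ρ x T R G E p Λ : ℝ} (hT : 0 < T) (hρ : 0 < ρ)
    (hρx : 1 ≤ ρ * (1 - x) ^ 2) (hR : 0 ≤ R)
    (h : (1 - x) ^ 2 * (T * R) ≤ T * G + E * (p * Λ)) :
    R ≤ ρ * G + ρ * E * p * (Λ / T) := by
  refine le_of_mul_le_mul_left ?_ hT
  calc T * R ≤ ρ * (1 - x) ^ 2 * (T * R) := le_mul_of_one_le_left (by positivity) hρx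
    _ = ρ * ((1 - x) ^ 2 * (T * R)) := by ring
    _ ≤ ρ * (T * G + E * (p * Λ)) := by gcongr
    _ = _ := by field_simp

theorem exists_one_le_mul_one_sub_sq {ρ : ℝ} (hρ : 1 < ρ) :
    ∃ x : ℝ, 0 < x ∧ x ≤ 1 ∧ 1 ≤ ρ * (1 - x) ^ 2 := by
  have : 0 < ρ := by linarith
  refine ⟨(ρ - 1) / (2 * ρ), div_pos (by linarith) (by linarith), ?_, ?_⟩
  · rw [div_le_one (by linarith)]
    linarith
  · have hsq : ρ * (1 - (ρ - 1) / (2 * ρ)) ^ 2 = 1 + (ρ - 1) ^ 2 / (4 * ρ) := by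
      field_simp
      ring
    rw [hsq]
    exact le_add_of_nonneg_right (by positivity)

theorem one_le_log_of_three_le {u : ℝ} (hu : 3 ≤ u) : 1 ≤ Real.log u := by
  rw [Real.le_log_iff_exp_le (by linarith)]
  linarith [Real.exp_one_lt_three]

theorem one_le_log_network_size {L N B T : ℝ} (hL : 0 ≤ L) (hN : 0 ≤ N) (hB : 1 ≤ B)
    (hT : 3 ≤ T) : 1 ≤ Real.log ((L + 1) * (N + 1) * B * T) := by
  have hLN : 1 ≤ (L + 1) * (N + 1) := one_le_mul_of_one_le_of_one_le (by linarith) (by linarith)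
  exact one_le_log_of_three_le
    (hT.trans (le_mul_of_one_le_left (by linarith) (one_le_mul_of_one_le_of_one_le hLN hB)))

theorem exists_one_sub_sq_mul_genError_le (d : ℕ) (Cσ s₀ : ℝ≥0) (Cη C₁ C₂ K x : ℝ) (hC₂ : 0 < C₂)
    (hx : 0 < x) (hx1 : x ≤ 1) :
    ∃ E : ℝ, 0 < E ∧
      ∀ (σ : ℝ → ℝ), LipschitzWith Cσ σ → |σ 0| ≤ s₀ →
      ∀ {Ω : Type*} [mΩ : MeasurableSpace Ω] (P : Measure Ω) [IsProbabilityMeasure P]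
        (𝒢 : Filtration ℕ mΩ) (T : ℕ), 3 ≤ T →
      ∀ (X : ℕ → Ω → (Fin d → ℝ)) (v Y : ℕ → Ω → ℝ) (m η : (Fin d → ℝ) → ℝ),
        SubGaussianRegression P 𝒢 T X v Y m η Cη K →
        (∀ t : ℕ, 1 ≤ t → betaMixing P T X t ≤ C₁ * Real.exp (-C₂ * t)) →
      ∀ (L N B F S : ℝ), 0 ≤ L → 0 ≤ N → 1 ≤ B → 1 ≤ F → 1 ≤ S →
        (∀ x ∈ unitCube d, |m x| ≤ F) →
      ∀ (fhat : Ω → (Fin d → ℝ) → ℝ), (Measurable fun p : Ω × (Fin d → ℝ) => fhat p.1 p.2) →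
        (∀ ω, fhat ω ∈ sparseDNNClass d σ L N B F S) →
      ∀ f ∈ sparseDNNClass d σ L N B F S,
        (1 - x) ^ 2 * (T * genError P T X fhat ((unitCube d).indicator m)) ≤
          T * (optGap P T X Y (sparseDNNClass d σ L N B F S) fhat +
              genError P T X (fun _ => f) ((unitCube d).indicator m)) +
            E * (F ^ 2 *
              (S * (L + 1) * Real.log ((L + 1) * (N + 1) * B * T) * Real.log T)) := by
  obtain ⟨C₀, hC₀, hcover⟩ := exists_isSupNet_sparseDNNClass_log_card_le d Cσ s₀
  obtain ⟨q, hq, hscale⟩ := exists_noise_scale Cη K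
  refine ⟨2 * q * C₀ / x + 12 + 4 * |Cη * K| +
    8 * (2 / C₂ + 1) / x * ((1 + 2 * |C₁|) * C₀ + 2 * |C₁|), by positivity, ?_⟩
  intro σ hσ hσ0 Ω mΩ P _ 𝒢 T hT X v Y m η h hmix L N B F S hL hN hB hF hS hmF fhat hfm hfhat f hf
  have hT3 : (3 : ℝ) ≤ T := by exact_mod_cast hT
  obtain ⟨b, hb, hbk, hbβ⟩ := exists_block_length (T := T) C₁ hC₂ (by linarith)
    (one_le_log_of_three_le hT3)
  obtain ⟨A, hA, hcard⟩ := hcover σ hσ hσ0 L N B F S (T : ℝ)⁻¹ hL hN hB hS (by positivity)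
    (by rw [one_div]; gcongr)
  rw [inv_inv] at hcard
  have hnet : ∀ δ : ℝ, 0 < δ → ∃ A, IsSupNet δ (sparseDNNClass d σ L N B F S) A := fun δ hδ =>
    have ⟨A, hA, _⟩ := hcover σ hσ hσ0 L N B F S (min δ (1 / 3)) hL hN hB hS
      (lt_min hδ (by norm_num)) (min_le_right _ _)
    ⟨A, hA.mono (min_le_left _ _)⟩
  obtain ⟨hlamx, hlamK⟩ := hscale x F hx hx1 hF
  have horacle := h.mul_genError_le_of_isSupNet hmF
    (fun f => sparseDNNClass.isCubeBounded hσ.continuous) hnet hfm hfhat (by omega) (by linarith)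
    hf (by positivity) hA hb (by positivity) ((hmix _ (Nat.le_add_left 1 b)).trans hbβ) hx hx1
    (by positivity) hlamx hlamK
  have hΛ : 1 ≤ S * (L + 1) * Real.log ((L + 1) * (N + 1) * B * T) :=
    one_le_mul_of_one_le_of_one_le (one_le_mul_of_one_le_of_one_le hS (by linarith))
      (one_le_log_network_size hL hN hB hT3)
  have hrem := oracle_remainder_le (Cη := Cη) (K := K) hx hq hF (by linarith : (1 : ℝ) ≤ T) hC₀.le
    (Real.log_nonneg (by simp)) hcard hΛ (one_le_log_of_three_le hT3) hbk (abs_nonneg C₁)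
  linarith

theorem mainTheorem6_general (d : ℕ) (Cσ s₀ : ℝ≥0) (Cη C₁ C₂ K ρ : ℝ) (hC₂ : 0 < C₂)
    (hρ : 1 < ρ) :
    ∃ Cρ : ℝ, 0 < Cρ ∧
      ∀ (σ : ℝ → ℝ), LipschitzWith Cσ σ → |σ 0| ≤ s₀ →
      ∀ {Ω : Type*} [mΩ : MeasurableSpace Ω] (P : Measure Ω) [IsProbabilityMeasure P]
        (𝒢 : Filtration ℕ mΩ) (T : ℕ), 3 ≤ T →
      ∀ (X : ℕ → Ω → (Fin d → ℝ)) (v Y : ℕ → Ω → ℝ) (m η : (Fin d → ℝ) → ℝ),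
        SubGaussianRegression P 𝒢 T X v Y m η Cη K →
        (∀ t : ℕ, 1 ≤ t → betaMixing P T X t ≤ C₁ * Real.exp (-C₂ * t)) →
      ∀ (L N B F S : ℝ), 0 < L → 0 < N → 1 ≤ B → 1 ≤ F → 0 < S →
        (∀ x ∈ unitCube d, |m x| ≤ F) →
      ∀ (fhat : Ω → (Fin d → ℝ) → ℝ), (Measurable fun p : Ω × (Fin d → ℝ) => fhat p.1 p.2) →
        (∀ ω, fhat ω ∈ sparseDNNClass d σ L N B F S) →
        genError P T X fhat ((unitCube d).indicator m) ≤
          ρ * (optGap P T X Y (sparseDNNClass d σ L N B F S) fhat +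
              ⨅ f : sparseDNNClass d σ L N B F S,
                genError P T X (fun _ => f) ((unitCube d).indicator m)) +
            Cρ * F ^ 2 *
              (S * (L + 1) * Real.log ((L + 1) * (N + 1) * B * T) * Real.log T / T) := by
  obtain ⟨x, hx, hx1, hρx⟩ := exists_one_le_mul_one_sub_sq hρ
  obtain ⟨E, hE, horacle⟩ := exists_one_sub_sq_mul_genError_le d Cσ s₀ Cη C₁ C₂ K x hC₂ hx hx1
  refine ⟨ρ * E, by positivity, ?_⟩
  intro σ hσ hσ0 Ω mΩ P _ 𝒢 T hT X v Y m η h hmix L N B F S hL hN hB hF hS hmF fhat hfm hfhat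
  have hT3 : (3 : ℝ) ≤ T := by exact_mod_cast hT
  have : Nonempty (sparseDNNClass d σ L N B F S) :=
    have ⟨ω⟩ := P.nonempty_of_neZero
    ⟨⟨fhat ω, hfhat ω⟩⟩
  refine le_mul_add_ciInf_add (by linarith) fun f => ?_
  rcases lt_or_ge S 1 with hS1 | hS1
  · -- All parameters vanish, so that the class is `{0}` and `fhat` is the oracle itself.
    have hfhat_eq : fhat = fun _ => f.1 := funext fun ω =>
      (sparseDNNClass.eq_zero_of_lt_one hS1 (hfhat ω)).trans
        (sparseDNNClass.eq_zero_of_lt_one hS1 f.2).symm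
    rw [← hfhat_eq]
    have hlog := one_le_log_network_size hL.le hN.le hB hT3
    have hR := genError_nonneg (P := P) (T := T) (X := X) fhat ((unitCube d).indicator m)
    have hgap := optGap_nonneg (P := P) (T := T) (X := X) (Y := Y) hfhat
    refine le_add_of_le_of_nonneg ((le_add_of_nonneg_left hgap).trans
      (le_mul_of_one_le_left (by positivity) hρ.le)) (by positivity)
  · exact le_mul_add_of_one_sub_sq_mul_le (by linarith) (by linarith) hρx (genError_nonneg _ _)
      (horacle σ hσ hσ0 P 𝒢 T hT X v Y m η h hmix L N B F S hL.le hN.le hB hF hS1 hmF fhat hfm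
        hfhat f f.2)

theorem mainTheorem6 (d : ℕ) (Cσ s₀ : ℝ≥0) (Cη C₁ C₂ K ρ : ℝ) (hC₂ : 0 < C₂) (hρ : 1 < ρ) :
    ∃ Cρ : ℝ, 0 < Cρ ∧
      ∀ (σ : ℝ → ℝ), LipschitzWith Cσ σ → |σ 0| ≤ s₀ →
      ∀ {Ω : Type*} [mΩ : MeasurableSpace Ω] (P : Measure Ω) [IsProbabilityMeasure P]
        (𝒢 : Filtration ℕ mΩ) (T : ℕ), 3 ≤ T →
      ∀ (X : ℕ → Ω → (Fin d → ℝ)) (v Y : ℕ → Ω → ℝ) (m η : (Fin d → ℝ) → ℝ),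
        RegressionModel P 𝒢 T X v Y m η Cη C₁ C₂ K →
      ∀ (L N B F S : ℝ), 0 < L → 0 < N → 1 ≤ B → 1 ≤ F → 0 < S →
        (∀ x ∈ unitCube d, |m x| ≤ F) →
      ∀ (fhat : Ω → (Fin d → ℝ) → ℝ), IsEstimator T X Y fhat →
        (∀ ω, fhat ω ∈ sparseDNNClass d σ L N B F S) →
        genError P T X fhat ((unitCube d).indicator m) ≤
          ρ * (optGap P T X Y (sparseDNNClass d σ L N B F S) fhat +
              ⨅ f : sparseDNNClass d σ L N B F S,
                genError P T X (fun _ => f) ((unitCube d).indicator m)) +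
            Cρ * F ^ 2 *
              (S * (L + 1) * Real.log ((L + 1) * (N + 1) * B * T) * Real.log T / T) := by
  obtain ⟨Cρ, hCρ, hmain⟩ := mainTheorem6_general d Cσ s₀ Cη C₁ C₂ K ρ hC₂ hρ
  exact ⟨Cρ, hCρ, fun σ hσ hσ0 _ _ P _ 𝒢 T hT X v Y m η h L N B F S hL hN hB hF hS hm fhat hest =>
    hmain σ hσ hσ0 P 𝒢 T hT X v Y m η h.subGaussianRegression h.mixing L N B F S hL hN hB hF hS hm
      fhat (h.subGaussianRegression.measurable_of_isEstimator hest)⟩
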